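/- Let $d\ge 2$ be an integer, let $\frac4d<\alpha<\frac4{d-1}$, and write $z=(x,y)\in\mathbb R^d\times\mathbb R$. Let $$\Sigma=\{u\in H^1(\mathbb R^{d+1};\mathbb C):\ yu\in L^2(\mathbb R^{d+1})\},$$ and for $\omega>0$ and $\phi\in\Sigma$ set $$S_\omega(\phi)=\tfrac12\|\nabla_z\phi\|_2^2+\tfrac12\|y\phi\|_2^2-\tfrac1{\alpha+2}\|\phi\|_{\alpha+2}^{\alpha+2}+\tfrac{\omega}{2}\|\phi\|_2^2,\qquad Q(\phi)=\|\nabla_x\phi\|_2^2-\tfrac{\alpha d}{2(\alpha+2)}\|\phi\|_{\alpha+2}^{\alpha+2},$$ where $\|\cdot\|_p$ is the norm of $L^p(\mathbb R^{d+1})$. Then for every $\omega>0$ the minimization problem $$m_\omega=\inf\{S_\omega(\phi):\ \phi\in\Sigma\setminus\{0\},\ Q(\phi)=0\}$$ admits a minimizer $\phi_\omega$ (that is, $\phi_\omega\in\Sigma\setminus\{0\}$, $Q(\phi_\omega)=0$ and $S_\omega(\phi_\omega)=m_\omega$) which is real-valued and positive almost everywhere and which is a weak solution of $$-\Delta_z\phi+y^2\phi+\omega\phi=|\phi|^\alpha\phi\quad\text{in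 }\mathbb R^{d+1},$$ i.e. for every $\psi\in\Sigma$, $$\int_{\mathbb R^{d+1}}\big(\nabla_z\phi_\omega\cdot\overline{\nabla_z\psi}+y^2\phi_\omega\overline\psi+\omega\phi_\omega\overline\psi\big)\,dz=\int_{\mathbb R^{d+1}}|\phi_\omega|^\alpha\phi_\omega\overline\psi\,dz .$$ -/

import Mathlib

noncomputable section

open MeasureTheory
open scoped ComplexConjugate

namespace PartialHarmonic

/-- The space `ℝ^d × ℝ` of points `z = (x, y)`; its `volume` is Lebesgue measure. -/
abbrev Space (d : ℕ) : Type := EuclideanSpace ℝ (Fin d) × ℝ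

/-- The complex Hilbert space `L²(ℝ^d × ℝ; ℂ)`. -/
abbrev L2 (d : ℕ) : Type := Lp ℂ 2 (volume : Measure (Space d))

/-- The unit vector in the direction `x_i`. -/
def dirX {d : ℕ} (i : Fin d) : Space d := (EuclideanSpace.single i 1, 0)

/-- The unit vector in the direction `y`. -/
def dirY (d : ℕ) : Space d := (0, 1)

open scoped ContDiff in
/-- `g ∈ L²` is the weak derivative of `u ∈ L²` in the direction `v`. -/
def HasWeakDeriv {d : ℕ} (v : Space d) (u g : L2 d) : Prop :=
  ∀ θ : Space d → ℝ, ContDiff ℝ ∞ θ → HasCompactSupport θ →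
    ∫ z, (fderiv ℝ θ z v) • u z = - ∫ z, θ z • g z

/-- The weak derivative of an `L²` function is unique. -/
theorem HasWeakDeriv.unique {d : ℕ} {v : Space d} {u g g' : L2 d}
    (h : HasWeakDeriv v u g) (h' : HasWeakDeriv v u g') : g = g' := by
  have li : ∀ f : L2 d, LocallyIntegrable f volume := fun f =>
    (Lp.memLp f).locallyIntegrable (by norm_num)
  apply Lp.ext
  apply ae_eq_of_integral_contDiff_smul_eq (li g) (li g')
  intro θ hθ hc
  have := (h θ hθ hc).symm.trans (h' θ hθ hc)
  exact neg_injective this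

open Classical in
/-- The weak derivative of `u` in the direction `v`, whenever it exists in `L²`. -/
def weakDeriv {d : ℕ} (v : Space d) (u : L2 d) : L2 d :=
  if h : ∃ g, HasWeakDeriv v u g then h.choose else 0

theorem HasWeakDeriv.weakDeriv_eq {d : ℕ} {v : Space d} {u g : L2 d}
    (h : HasWeakDeriv v u g) : weakDeriv v u = g := by
  have hex : ∃ g, HasWeakDeriv v u g := ⟨g, h⟩
  rw [weakDeriv, dif_pos hex]
  exact hex.choose_spec.unique h

/-- The Sobolev space `H¹(ℝ^d × ℝ; ℂ)`. -/
def H1 (d : ℕ) : Set (L2 d) :=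
  {u | (∀ i : Fin d, ∃ g, HasWeakDeriv (dirX i) u g) ∧ ∃ g, HasWeakDeriv (dirY d) u g}

/-- The energy space `Σ` of all `u ∈ H¹` with `y u ∈ L²`. -/
def energySpace (d : ℕ) : Set (L2 d) :=
  {u | u ∈ H1 d ∧ MemLp (fun z : Space d => (z.2 : ℂ) * u z) 2 volume}

/-- `‖∇_x u‖₂²`. -/
def gradXSq {d : ℕ} (u : L2 d) : ℝ := ∑ i : Fin d, ‖weakDeriv (dirX i) u‖ ^ 2

/-- `‖∂_y u‖₂²`. -/
def derivYSq {d : ℕ} (u : L2 d) : ℝ := ‖weakDeriv (dirY d) u‖ ^ 2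

/-- The mass `M(u) = ∫ |u|²`. -/
def mass {d : ℕ} (u : L2 d) : ℝ := ∫ z, ‖u z‖ ^ 2

/-- `‖y u‖₂²`. -/
def potentialSq {d : ℕ} (u : L2 d) : ℝ := ∫ z, z.2 ^ 2 * ‖u z‖ ^ 2

/-- `‖u‖_{α+2}^{α+2}`. -/
def nonlinearTerm {d : ℕ} (α : ℝ) (u : L2 d) : ℝ := ∫ z, ‖u z‖ ^ (α + 2)

/-- The energy `E(u)`. -/
def energy {d : ℕ} (α : ℝ) (u : L2 d) : ℝ :=
  1 / 2 * (gradXSq u + derivYSq u) + 1 / 2 * potentialSq u - 1 / (α + 2) * nonlinearTerm α u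

/-- The action `S_ω(u) = E(u) + (ω/2) M(u)`. -/
def action {d : ℕ} (α ω : ℝ) (u : L2 d) : ℝ := energy α u + ω / 2 * mass u

/-- The semivirial functional `Q(u) = ‖∇_x u‖₂² - αd/(2(α+2)) ‖u‖_{α+2}^{α+2}`. -/
def semivirial {d : ℕ} (α : ℝ) (u : L2 d) : ℝ :=
  gradXSq u - α * d / (2 * (α + 2)) * nonlinearTerm α u

/-- The constraint set `K = {φ ∈ Σ ∖ {0} : Q(φ) = 0}`. -/
def constraintSet (d : ℕ) (α : ℝ) : Set (L2 d) :=
  {φ | φ ∈ energySpace d ∧ φ ≠ 0 ∧ semivirial α φ = 0}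

/-- `m_ω = inf {S_ω(φ) : φ ∈ K}`. -/
def minAction (d : ℕ) (α ω : ℝ) : ℝ := sInf (action α ω '' constraintSet d α)

/-- `φ ∈ Σ` is a weak solution of `-Δφ + y²φ + ωφ = |φ|^α φ`: the equation holds when tested
against every `ψ ∈ Σ`. The inner product of `L²` is conjugate-linear in its first entry. -/
def IsWeakSolution {d : ℕ} (α ω : ℝ) (φ : L2 d) : Prop :=
  φ ∈ energySpace d ∧ ∀ ψ ∈ energySpace d,
    Integrable (fun z : Space d => ((‖φ z‖ ^ α : ℝ) : ℂ) * φ z * conj (ψ z)) volume ∧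
    ∑ i : Fin d, inner ℂ (weakDeriv (dirX i) ψ) (weakDeriv (dirX i) φ)
        + inner ℂ (weakDeriv (dirY d) ψ) (weakDeriv (dirY d) φ)
        + (∫ z : Space d, ((z.2 ^ 2 : ℝ) : ℂ) * φ z * conj (ψ z))
        + (ω : ℂ) * inner ℂ ψ φ
      = ∫ z : Space d, ((‖φ z‖ ^ α : ℝ) : ℂ) * φ z * conj (ψ z)

/-- `φ` is real-valued and strictly positive, as an element of `L²`, i.e. almost everywhere. -/
def IsPositive {d : ℕ} (φ : L2 d) : Prop :=
  ∀ᵐ z : Space d, (φ z).im = 0 ∧ 0 < (φ z).re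

end PartialHarmonic

end

noncomputable section

open MeasureTheory Filter Topology
open scoped ComplexConjugate ContDiff ENNReal NNReal

namespace PartialHarmonic

variable {d : ℕ}

/-! On the constraint the action is a quadratic form. Subtracting `2/(αd)` times `Q` removes the
nonlinear term and leaves `redAction`, whose coefficient `1/2 - 2/(αd)` in front of `‖∇_x u‖²` is
positive because `αd > 4`. A nonzero `u` with `Q(u) ≤ 0` reaches `Q = 0` after multiplication by
some `t ≤ 1`, which cannot increase the form. So the problem is to minimize `redAction` over nonzero
`u` with `Q(u) ≤ 0` (`minAction_le_of_semivirial_nonpos`).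

Compactness. A minimizing sequence is bounded in the energy space. Dilating the Sobolev inequality
in `x` alone keeps `‖∇_x u‖`, hence the `L^(α+2)` norm, away from zero (`exists_le_gradXSq`). Since
`α + 2` lies strictly between `2` and the critical exponent, mollifications of the sequence stay
large at some points. The bound on `yu` confines the `y` coordinates of these points, so
translations in `x` suffice to produce a nonzero weak limit `v` (`exists_translate_weakTendsto`).
The quadratic terms split along weak limits, the nonlinear one by Brezis–Lieb. If `Q(v) > 0`, the
remainders eventually have `Q < 0` and cost at least the infimum, which leaves nothing for `v ≠ 0`.
Thus `Q(v) ≤ 0` and `v` costs at most the infimum (`exists_redAction_le_minAction`). The modulus of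
`v` is no more expensive, which gives a nonnegative minimizer.

Equation. Perturb the minimizer in a direction `ψ` and dilate in `x` to return to the constraint. To
first order the dilation changes the action by a multiple of `Q(φ) = 0`, so no Lagrange multiplier
survives (`re_weakForm_eq_zero`).

Positivity. A nonnegative solution is a supersolution of `-Δφ + (y² + ω)φ = 0`. Testing with
shrinking radial bumps shows that normalized local means, corrected by an exponential factor, are
monotone in the scale (`IsWeakSolution.monotoneOn_localMean`). At a Lebesgue point of value `0` they
tend to `0`, hence vanish at every scale, and `φ = 0`. No regularity of `φ` is needed. -/

instance instIsAddHaarMeasureSpace : (volume : Measure (Space d)).IsAddHaarMeasure :=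
  inferInstanceAs (Measure.IsAddHaarMeasure
    ((volume : Measure (EuclideanSpace ℝ (Fin d))).prod (volume : Measure ℝ)))

instance instFactTwoNeTop : Fact ((2 : ℝ≥0∞) ≠ ⊤) := ⟨by simp⟩

/-! ### Elements of `L²` given by functions -/

open Classical in
/-- The element of `L²` represented by `f`, or `0` if `f` is not square integrable. -/
def toL2 (f : Space d → ℂ) : L2 d := if h : MemLp f 2 volume then h.toLp f else 0

theorem coeFn_toL2 {f : Space d → ℂ} (h : MemLp f 2 volume) : toL2 f =ᵐ[volume] f := by
  rw [toL2, dif_pos h]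
  exact h.coeFn_toLp

theorem toL2_eq_of_ae {f : Space d → ℂ} {g : L2 d} (h : g =ᵐ[volume] f) : toL2 f = g := by
  have hf : MemLp f 2 volume := (memLp_congr_ae h).1 (Lp.memLp g)
  exact Lp.ext ((coeFn_toL2 hf).trans h.symm)

theorem norm_sq_eq_integral (u : L2 d) : ‖u‖ ^ 2 = ∫ z, ‖u z‖ ^ 2 := by
  have h : RCLike.re (inner ℂ u u) = ‖u‖ ^ 2 := by
    rw [inner_self_eq_norm_sq_to_K]; norm_cast
  rw [← h, L2.inner_def]
  have : ∀ z, inner ℂ (u z) (u z) = ((‖u z‖ ^ 2 : ℝ) : ℂ) := fun z => by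
    rw [inner_self_eq_norm_sq_to_K]; norm_cast
  simp_rw [this]
  rw [integral_complex_ofReal]
  simp

theorem norm_toL2_sq {f : Space d → ℂ} (h : MemLp f 2 volume) :
    ‖toL2 f‖ ^ 2 = ∫ z, ‖f z‖ ^ 2 := by
  rw [norm_sq_eq_integral]
  refine integral_congr_ae ?_
  filter_upwards [coeFn_toL2 h] with z hz
  rw [hz]

theorem mass_eq (u : L2 d) : mass u = ‖u‖ ^ 2 := (norm_sq_eq_integral u).symm

theorem integrable_norm_sq (u : L2 d) : Integrable (fun z => ‖u z‖ ^ 2) volume :=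
  (memLp_two_iff_integrable_sq_norm (Lp.aestronglyMeasurable u)).1 (Lp.memLp u)

theorem inner_eq_integral (f g : L2 d) : inner ℂ f g = ∫ z, conj (f z) * g z := by
  rw [L2.inner_def]
  refine integral_congr_ae (Eventually.of_forall fun z => ?_)
  simp [mul_comm]

theorem inner_toL2_left {f : Space d → ℂ} (h : MemLp f 2 volume) (g : L2 d) :
    inner ℂ (toL2 f) g = ∫ z, conj (f z) * g z := by
  rw [inner_eq_integral]
  refine integral_congr_ae ?_
  filter_upwards [coeFn_toL2 h] with z hz
  rw [hz]

theorem memLp_ofReal_of_compact {θ : Space d → ℝ} (hc : Continuous θ) (hs : HasCompactSupport θ) :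
    MemLp (fun z => (θ z : ℂ)) 2 volume :=
  (Complex.continuous_ofReal.comp hc).memLp_of_hasCompactSupport
    (hs.comp_left (g := fun x : ℝ => (x : ℂ)) (by simp))

/-- The element of `L²` represented by a real test function. -/
def realL2 (θ : Space d → ℝ) : L2 d := toL2 fun z => (θ z : ℂ)

theorem coeFn_realL2 {θ : Space d → ℝ} (hc : Continuous θ) (hs : HasCompactSupport θ) :
    realL2 θ =ᵐ[volume] fun z => (θ z : ℂ) := coeFn_toL2 (memLp_ofReal_of_compact hc hs)

theorem inner_realL2 {θ : Space d → ℝ} (hc : Continuous θ) (hs : HasCompactSupport θ) (g : L2 d) :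
    inner ℂ (realL2 θ) g = ∫ z, θ z • g z := by
  rw [realL2, inner_toL2_left (memLp_ofReal_of_compact hc hs)]
  simp

theorem continuous_fderiv_apply {θ : Space d → ℝ} (hθ : ContDiff ℝ ∞ θ) (v : Space d) :
    Continuous fun z => fderiv ℝ θ z v :=
  (hθ.continuous_fderiv (by simp)).clm_apply continuous_const

theorem contDiff_fderiv_apply {θ : Space d → ℝ} (hθ : ContDiff ℝ ∞ θ) (v : Space d) :
    ContDiff ℝ ∞ fun z => fderiv ℝ θ z v :=
  (hθ.fderiv_right (m := ∞) (by simp)).clm_apply contDiff_const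

theorem hasCompactSupport_fderiv_apply {θ : Space d → ℝ} (hs : HasCompactSupport θ)
    (v : Space d) : HasCompactSupport fun z => fderiv ℝ θ z v :=
  hs.fderiv_apply ℝ v

/-- Pairings with fixed vectors of `L²` turn linearity and stability under weak limits into
properties of the inner product. -/
theorem hasWeakDeriv_iff {v : Space d} {u g : L2 d} : HasWeakDeriv v u g ↔
    ∀ θ : Space d → ℝ, ContDiff ℝ ∞ θ → HasCompactSupport θ →
      inner ℂ (realL2 fun z => fderiv ℝ θ z v) u = - inner ℂ (realL2 θ) g := by
  refine forall_congr' fun θ => forall_congr' fun hθ => forall_congr' fun hs => ?_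
  rw [inner_realL2 (continuous_fderiv_apply hθ v) (hasCompactSupport_fderiv_apply hs v),
    inner_realL2 hθ.continuous hs]

/-! ### Algebra of weak derivatives -/

theorem HasWeakDeriv.add {v : Space d} {u u' g g' : L2 d} (h : HasWeakDeriv v u g)
    (h' : HasWeakDeriv v u' g') : HasWeakDeriv v (u + u') (g + g') := by
  rw [hasWeakDeriv_iff] at *
  intro θ hθ hs
  rw [inner_add_right, inner_add_right, h θ hθ hs, h' θ hθ hs]; ring

theorem HasWeakDeriv.smul {v : Space d} {u g : L2 d} (c : ℂ) (h : HasWeakDeriv v u g) :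
    HasWeakDeriv v (c • u) (c • g) := by
  rw [hasWeakDeriv_iff] at *
  intro θ hθ hs
  rw [inner_smul_right, inner_smul_right, h θ hθ hs]; ring

theorem HasWeakDeriv.sub {v : Space d} {u u' g g' : L2 d} (h : HasWeakDeriv v u g)
    (h' : HasWeakDeriv v u' g') : HasWeakDeriv v (u - u') (g - g') := by
  have := h.add (h'.smul (-1))
  simpa [sub_eq_add_neg] using this

theorem integrable_smul_of_compact {θ : Space d → ℝ} (hc : Continuous θ)
    (hs : HasCompactSupport θ) (u : L2 d) : Integrable (fun z => θ z • u z) volume := by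
  have := (memLp_ofReal_of_compact hc hs).integrable_mul (Lp.memLp u)
  exact this.congr (Eventually.of_forall fun z => by simp)

theorem HasWeakDeriv.dir_add {v w : Space d} {u g g' : L2 d} (h : HasWeakDeriv v u g)
    (h' : HasWeakDeriv w u g') : HasWeakDeriv (v + w) u (g + g') := by
  intro θ hθ hs
  have e1 : ∀ z, fderiv ℝ θ z (v + w) • u z = fderiv ℝ θ z v • u z + fderiv ℝ θ z w • u z :=
    fun z => by rw [map_add, add_smul]
  simp_rw [e1]
  rw [integral_add
    (integrable_smul_of_compact (continuous_fderiv_apply hθ v)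
      (hasCompactSupport_fderiv_apply hs v) u)
    (integrable_smul_of_compact (continuous_fderiv_apply hθ w)
      (hasCompactSupport_fderiv_apply hs w) u), h θ hθ hs, h' θ hθ hs,
    ← inner_realL2 hθ.continuous hs, ← inner_realL2 hθ.continuous hs,
    ← inner_realL2 hθ.continuous hs, inner_add_right]
  ring

theorem HasWeakDeriv.dir_smul {v : Space d} {u g : L2 d} (c : ℝ) (h : HasWeakDeriv v u g) :
    HasWeakDeriv (c • v) u ((c : ℂ) • g) := by
  intro θ hθ hs
  have e1 : ∀ z, fderiv ℝ θ z (c • v) • u z = c • (fderiv ℝ θ z v • u z) :=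
    fun z => by rw [map_smul, smul_assoc]
  simp_rw [e1]
  rw [integral_smul, h θ hθ hs, ← inner_realL2 hθ.continuous hs, ← inner_realL2 hθ.continuous hs,
    inner_smul_right]
  simp

theorem HasWeakDeriv.dir_zero (u : L2 d) : HasWeakDeriv 0 u 0 := by
  intro θ hθ hs
  rw [← inner_realL2 hθ.continuous hs]
  simp

theorem HasWeakDeriv.dir_sum {ι : Type*} (s : Finset ι) {v : ι → Space d} {u : L2 d}
    {g : ι → L2 d} (h : ∀ i ∈ s, HasWeakDeriv (v i) u (g i)) :
    HasWeakDeriv (∑ i ∈ s, v i) u (∑ i ∈ s, g i) := by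
  classical
  induction s using Finset.induction_on with
  | empty => simpa using HasWeakDeriv.dir_zero u
  | insert a s ha ih =>
    rw [Finset.sum_insert ha, Finset.sum_insert ha]
    exact (h a (by simp)).dir_add (ih fun i hi => h i (by simp [hi]))

/-- A smooth compactly supported function has its classical derivative as weak derivative. -/
theorem hasWeakDeriv_realL2 {f : Space d → ℝ} (hf : ContDiff ℝ ∞ f) (hs : HasCompactSupport f)
    (v : Space d) : HasWeakDeriv v (realL2 f) (realL2 fun z => fderiv ℝ f z v) := by
  intro θ hθ hθs
  have e1 : ∫ z, fderiv ℝ θ z v • (realL2 f) z = ∫ z, ((fderiv ℝ θ z v * f z : ℝ) : ℂ) := by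
    refine integral_congr_ae ?_
    filter_upwards [coeFn_realL2 hf.continuous hs] with z hz
    rw [hz]; simp
  have e2 : ∫ z, θ z • (realL2 fun z => fderiv ℝ f z v) z
      = ∫ z, ((θ z * fderiv ℝ f z v : ℝ) : ℂ) := by
    refine integral_congr_ae ?_
    filter_upwards [coeFn_realL2 (continuous_fderiv_apply hf v)
      (hasCompactSupport_fderiv_apply hs v)] with z hz
    rw [hz]; simp
  rw [e1, e2, integral_complex_ofReal, integral_complex_ofReal]
  rw [integral_mul_fderiv_eq_neg_fderiv_mul_of_integrable]
  · simp
  · exact ((continuous_fderiv_apply hθ v).mul hf.continuous).integrable_of_hasCompactSupport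
      hs.mul_left
  · exact (hθ.continuous.mul (continuous_fderiv_apply hf v)).integrable_of_hasCompactSupport
      hθs.mul_right
  · exact (hθ.continuous.mul hf.continuous).integrable_of_hasCompactSupport hθs.mul_right
  · exact fun x _ => (hθ.differentiable (by simp)) x
  · exact fun x _ => (hf.differentiable (by simp)) x

/-! ### Multiplication by `y` -/

/-- `g ∈ L²` represents `y u`. -/
def HasMulY (u g : L2 d) : Prop := g =ᵐ[volume] fun z => (z.2 : ℂ) * u z

/-- The element `y u` of `L²`, whenever `y u` is square integrable. -/
def mulY (u : L2 d) : L2 d := toL2 fun z => (z.2 : ℂ) * u z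

theorem HasMulY.mulY_eq {u g : L2 d} (h : HasMulY u g) : mulY u = g := toL2_eq_of_ae h

theorem HasMulY.unique {u g g' : L2 d} (h : HasMulY u g) (h' : HasMulY u g') : g = g' :=
  Lp.ext (h.trans h'.symm)

theorem hasMulY_mulY {u : L2 d} (h : MemLp (fun z : Space d => (z.2 : ℂ) * u z) 2 volume) :
    HasMulY u (mulY u) := coeFn_toL2 h

theorem HasMulY.memLp {u g : L2 d} (h : HasMulY u g) :
    MemLp (fun z : Space d => (z.2 : ℂ) * u z) 2 volume := (memLp_congr_ae h).1 (Lp.memLp g)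

theorem HasMulY.add {u u' g g' : L2 d} (h : HasMulY u g) (h' : HasMulY u' g') :
    HasMulY (u + u') (g + g') := by
  filter_upwards [h, h', Lp.coeFn_add u u', Lp.coeFn_add g g'] with z h1 h2 h3 h4
  rw [h3, h4, Pi.add_apply, Pi.add_apply, h1, h2, mul_add]

theorem HasMulY.smul {u g : L2 d} (c : ℂ) (h : HasMulY u g) : HasMulY (c • u) (c • g) := by
  filter_upwards [h, Lp.coeFn_smul c u, Lp.coeFn_smul c g] with z h1 h3 h4
  rw [h3, h4, Pi.smul_apply, Pi.smul_apply, h1, smul_eq_mul, smul_eq_mul, mul_left_comm]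

theorem HasMulY.sub {u u' g g' : L2 d} (h : HasMulY u g) (h' : HasMulY u' g') :
    HasMulY (u - u') (g - g') := by
  have := h.add (h'.smul (-1))
  simpa [sub_eq_add_neg] using this

/-- The factor `y` moves onto the test function, where it is harmless because of compact support. In
this form multiplication by `y` falls under the same closure principle for weak limits as weak
derivatives. -/
theorem hasMulY_iff {u g : L2 d} : HasMulY u g ↔
    ∀ θ : Space d → ℝ, ContDiff ℝ ∞ θ → HasCompactSupport θ →
      inner ℂ (realL2 fun z => z.2 * θ z) u = inner ℂ (realL2 θ) g := by
  have cy : ∀ {θ : Space d → ℝ}, ContDiff ℝ ∞ θ → Continuous fun z : Space d => z.2 * θ z :=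
    fun hθ => continuous_snd.mul hθ.continuous
  constructor
  · intro h θ hθ hs
    rw [inner_realL2 (cy hθ) hs.mul_left, inner_realL2 hθ.continuous hs]
    refine integral_congr_ae ?_
    filter_upwards [h] with z hz
    rw [hz]; simp; ring
  · intro h
    have li : ∀ f : L2 d, LocallyIntegrable f volume := fun f =>
      (Lp.memLp f).locallyIntegrable (by norm_num)
    have li2 : LocallyIntegrable (fun z : Space d => (z.2 : ℂ) * u z) volume := by
      refine (locallyIntegrable_iff).2 fun k hk => ?_
      exact ((li u).integrableOn_isCompact hk).continuousOn_mul
        (Complex.continuous_ofReal.comp continuous_snd).continuousOn hk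
    refine ae_eq_of_integral_contDiff_smul_eq (li g) li2 fun θ hθ hs => ?_
    have := h θ hθ hs
    rw [inner_realL2 (cy hθ) hs.mul_left, inner_realL2 hθ.continuous hs] at this
    rw [← this]
    refine integral_congr_ae (Eventually.of_forall fun z => ?_)
    simp; ring

/-! ### The energy space -/

theorem mem_energySpace_iff {u : L2 d} : u ∈ energySpace d ↔
    (∀ i : Fin d, HasWeakDeriv (dirX i) u (weakDeriv (dirX i) u)) ∧
      HasWeakDeriv (dirY d) u (weakDeriv (dirY d) u) ∧ HasMulY u (mulY u) := by
  constructor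
  · rintro ⟨⟨hx, ⟨gy, hy⟩⟩, hm⟩
    refine ⟨fun i => ?_, ?_, hasMulY_mulY hm⟩
    · obtain ⟨g, hg⟩ := hx i
      rwa [hg.weakDeriv_eq]
    · rwa [hy.weakDeriv_eq]
  · rintro ⟨hx, hy, hm⟩
    exact ⟨⟨fun i => ⟨_, hx i⟩, ⟨_, hy⟩⟩, hm.memLp⟩

theorem mem_energySpace_of {u : L2 d} {gx : Fin d → L2 d} {gy h : L2 d}
    (hx : ∀ i, HasWeakDeriv (dirX i) u (gx i)) (hy : HasWeakDeriv (dirY d) u gy)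
    (hm : HasMulY u h) : u ∈ energySpace d :=
  ⟨⟨fun i => ⟨_, hx i⟩, ⟨_, hy⟩⟩, hm.memLp⟩

theorem potentialSq_eq {u : L2 d} (hu : u ∈ energySpace d) : potentialSq u = ‖mulY u‖ ^ 2 := by
  rw [norm_sq_eq_integral, potentialSq]
  refine integral_congr_ae ?_
  filter_upwards [hasMulY_mulY hu.2] with z hz
  rw [hz, norm_mul, mul_pow, Complex.norm_real, Real.norm_eq_abs, sq_abs]

theorem add_mem_energySpace {u v : L2 d} (hu : u ∈ energySpace d) (hv : v ∈ energySpace d) :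
    u + v ∈ energySpace d := by
  rw [mem_energySpace_iff] at hu hv
  exact mem_energySpace_of (fun i => (hu.1 i).add (hv.1 i)) (hu.2.1.add hv.2.1)
    (hu.2.2.add hv.2.2)

theorem smul_mem_energySpace (c : ℂ) {u : L2 d} (hu : u ∈ energySpace d) :
    c • u ∈ energySpace d := by
  rw [mem_energySpace_iff] at hu
  exact mem_energySpace_of (fun i => (hu.1 i).smul c) (hu.2.1.smul c) (hu.2.2.smul c)

theorem sub_mem_energySpace {u v : L2 d} (hu : u ∈ energySpace d) (hv : v ∈ energySpace d) :
    u - v ∈ energySpace d := by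
  have := add_mem_energySpace hu (smul_mem_energySpace (-1) hv)
  simpa [sub_eq_add_neg] using this

theorem realL2_mem_energySpace {f : Space d → ℝ} (hf : ContDiff ℝ ∞ f)
    (hs : HasCompactSupport f) : realL2 f ∈ energySpace d := by
  refine mem_energySpace_of (h := realL2 fun z => z.2 * f z)
    (fun i => hasWeakDeriv_realL2 hf hs (dirX i))
    (hasWeakDeriv_realL2 hf hs (dirY d)) ?_
  filter_upwards [coeFn_realL2 hf.continuous hs,
    coeFn_realL2 (θ := fun z : Space d => z.2 * f z) (continuous_snd.mul hf.continuous)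
      hs.mul_left] with z h1 h2
  rw [h1, h2]; simp

/-! ### Weak sequential compactness in a Hilbert space -/

section WeakConvergence

variable {H : Type*} [NormedAddCommGroup H] [InnerProductSpace ℂ H]

/-- Weak convergence of a sequence in a Hilbert space. -/
def WeakTendsto (x : ℕ → H) (w : H) : Prop :=
  ∀ f : H, Tendsto (fun n => inner ℂ f (x n)) atTop (𝓝 (inner ℂ f w))

theorem WeakTendsto.sub_const {x : ℕ → H} {w : H} (h : WeakTendsto x w) (c : H) :
    WeakTendsto (fun n => x n - c) (w - c) := fun f => by
  simpa only [inner_sub_right] using (h f).sub_const _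

/-- Bounded sequences in a separable Hilbert space have weakly convergent subsequences. -/
theorem exists_weakTendsto_subseq [CompleteSpace H] [TopologicalSpace.SeparableSpace H]
    {x : ℕ → H} {C : ℝ} (hx : ∀ n, ‖x n‖ ≤ C) :
    ∃ w : H, ∃ s : ℕ → ℕ, StrictMono s ∧ WeakTendsto (x ∘ s) w := by
  -- Sequential Banach–Alaoglu for the Riesz functionals of `x n`. These pair `x n` in the first
  -- slot, hence the conjugation further down.
  have hsc := WeakDual.isSeqCompact_closedBall ℂ H (0 : StrongDual ℂ H) C
  obtain ⟨a, -, s, hs, hlim⟩ := hsc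
    (x := fun n => StrongDual.toWeakDual (InnerProductSpace.toDual ℂ H (x n))) (fun n => by
      simpa using hx n)
  refine ⟨(InnerProductSpace.toDual ℂ H).symm (WeakDual.toStrongDual a), s, hs, fun f => ?_⟩
  have h1 : Tendsto (fun n => (InnerProductSpace.toDual ℂ H (x (s n))) f) atTop (𝓝 (a f)) := by
    have := (WeakDual.eval_continuous (𝕜 := ℂ) (E := H) f).continuousAt (x := a)
    exact this.tendsto.comp hlim
  have h2 : Tendsto (fun n => conj ((InnerProductSpace.toDual ℂ H (x (s n))) f)) atTop
      (𝓝 (conj (a f))) := (Complex.continuous_conj.tendsto _).comp h1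
  have h3 : inner ℂ f ((InnerProductSpace.toDual ℂ H).symm (WeakDual.toStrongDual a))
      = conj (a f) := by
    rw [← inner_conj_symm, InnerProductSpace.toDual_symm_apply]
    rfl
  rw [h3]
  refine h2.congr fun n => ?_
  rw [InnerProductSpace.toDual_apply_apply, inner_conj_symm]
  rfl

/-- Expand the square: the only varying term is the cross term, which converges by weak convergence
against `w`. This is the Hilbert space analogue of Brezis–Lieb and splits every quadratic term of
the action. -/
theorem WeakTendsto.norm_sq_sub {x : ℕ → H} {w : H} (h : WeakTendsto x w) :
    Tendsto (fun n => ‖x n‖ ^ 2 - ‖x n - w‖ ^ 2) atTop (𝓝 (‖w‖ ^ 2)) := by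
  have h1 : Tendsto (fun n => 2 * (inner ℂ w (x n)).re - ‖w‖ ^ 2) atTop
      (𝓝 (2 * (inner ℂ w w).re - ‖w‖ ^ 2)) :=
    (((Complex.continuous_re.tendsto _).comp (h w)).const_mul 2).sub_const _
  have h2 : (inner ℂ w w).re = ‖w‖ ^ 2 := by
    have := inner_self_eq_norm_sq (𝕜 := ℂ) w
    simpa using this
  rw [h2] at h1
  refine (h1.congr fun n => ?_).trans (by rw [show 2 * ‖w‖ ^ 2 - ‖w‖ ^ 2 = ‖w‖ ^ 2 by ring])
  rw [← norm_neg (x n - w), neg_sub, @norm_sub_sq ℂ]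
  simp

theorem WeakTendsto.norm_le {x : ℕ → H} {w : H} (h : WeakTendsto x w) {C : ℝ}
    (hx : ∀ n, ‖x n‖ ≤ C) : ‖w‖ ≤ C := by
  have hC : 0 ≤ C := (norm_nonneg _).trans (hx 0)
  have h1 : ‖inner ℂ w w‖ ≤ ‖w‖ * C :=
    le_of_tendsto (h w).norm (Eventually.of_forall fun n =>
      (norm_inner_le_norm w (x n)).trans (mul_le_mul_of_nonneg_left (hx n) (norm_nonneg _)))
  have h2 : ‖inner ℂ w w‖ = ‖w‖ * ‖w‖ := by
    rw [inner_self_eq_norm_sq_to_K]; simp [sq]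
  rcases (norm_nonneg w).eq_or_lt with h0 | h0
  · rwa [← h0]
  · rw [h2] at h1
    exact le_of_mul_le_mul_left h1 h0

/-- Relations defined by testing are closed under weak limits. -/
theorem exists_weakTendsto_of_relation [CompleteSpace H] [TopologicalSpace.SeparableSpace H]
    {ι : Type*} {a b : ι → H} {x g : ℕ → H} {w : H} {C : ℝ}
    (huniq : ∀ k k' : H, (∀ i, inner ℂ (a i) w = inner ℂ (b i) k) →
      (∀ i, inner ℂ (a i) w = inner ℂ (b i) k') → k = k')
    (hR : ∀ n i, inner ℂ (a i) (x n) = inner ℂ (b i) (g n)) (hg : ∀ n, ‖g n‖ ≤ C)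
    (hx : WeakTendsto x w) :
    ∃ k : H, (∀ i, inner ℂ (a i) w = inner ℂ (b i) k) ∧ WeakTendsto g k := by
  -- Every subsequence of `g` has a further subsequence with a weak limit, and that limit satisfies
  -- the tested relation. Since the relation determines it, all these limits coincide and the whole
  -- sequence converges.
  have key : ∀ t : ℕ → ℕ, Tendsto t atTop atTop → ∃ k : H, ∃ s : ℕ → ℕ,
      (∀ i, inner ℂ (a i) w = inner ℂ (b i) k) ∧ WeakTendsto (fun n => g (t (s n))) k := by
    intro t ht
    obtain ⟨k, s, hs, hk⟩ := exists_weakTendsto_subseq (x := g ∘ t) (fun n => hg (t n))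
    refine ⟨k, s, fun i => ?_, hk⟩
    refine tendsto_nhds_unique ((hx (a i)).comp (ht.comp hs.tendsto_atTop)) ?_
    refine (hk (b i)).congr fun n => ?_
    simp only [Function.comp_apply]
    rw [hR]
  obtain ⟨k, s, hk, -⟩ := key id tendsto_id
  refine ⟨k, hk, fun f => tendsto_of_subseq_tendsto fun t ht => ?_⟩
  obtain ⟨k', s', hk', hw⟩ := key t ht
  rw [huniq k k' hk hk']
  exact ⟨s', hw f⟩

end WeakConvergence

/-- Weak derivatives pass to weak limits. -/
theorem HasWeakDeriv.of_weakTendsto {v : Space d} {x g : ℕ → L2 d} {w : L2 d} {C : ℝ}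
    (h : ∀ n, HasWeakDeriv v (x n) (g n)) (hg : ∀ n, ‖g n‖ ≤ C) (hx : WeakTendsto x w) :
    ∃ k, HasWeakDeriv v w k ∧ WeakTendsto g k := by
  let ι := {θ : Space d → ℝ // ContDiff ℝ ∞ θ ∧ HasCompactSupport θ}
  -- The sign from integration by parts is absorbed into the second family of test vectors.
  have conv : ∀ u k : L2 d, (∀ i : ι, inner ℂ (realL2 fun z => fderiv ℝ i.1 z v) u
      = inner ℂ (-realL2 i.1) k) ↔ HasWeakDeriv v u k := fun u k => by
    rw [hasWeakDeriv_iff]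
    simp only [inner_neg_left]
    exact ⟨fun h θ h1 h2 => h ⟨θ, h1, h2⟩, fun h i => h i.1 i.2.1 i.2.2⟩
  obtain ⟨k, hk, hw⟩ := exists_weakTendsto_of_relation
    (a := fun i : ι => realL2 fun z => fderiv ℝ i.1 z v) (b := fun i : ι => -realL2 i.1)
    (x := x) (g := g) (w := w) (C := C)
    (fun k k' h1 h2 => ((conv w k).1 h1).unique ((conv w k').1 h2))
    (fun n i => (conv (x n) (g n)).2 (h n) i) hg hx
  exact ⟨k, (conv w k).1 hk, hw⟩

/-- Multiplication by `y` passes to weak limits. -/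
theorem HasMulY.of_weakTendsto {x g : ℕ → L2 d} {w : L2 d} {C : ℝ}
    (h : ∀ n, HasMulY (x n) (g n)) (hg : ∀ n, ‖g n‖ ≤ C) (hx : WeakTendsto x w) :
    ∃ k, HasMulY w k ∧ WeakTendsto g k := by
  let ι := {θ : Space d → ℝ // ContDiff ℝ ∞ θ ∧ HasCompactSupport θ}
  have conv : ∀ u k : L2 d, (∀ i : ι, inner ℂ (realL2 fun z => z.2 * i.1 z) u
      = inner ℂ (realL2 i.1) k) ↔ HasMulY u k := fun u k => by
    rw [hasMulY_iff]
    exact ⟨fun h θ h1 h2 => h ⟨θ, h1, h2⟩, fun h i => h i.1 i.2.1 i.2.2⟩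
  obtain ⟨k, hk, hw⟩ := exists_weakTendsto_of_relation
    (a := fun i : ι => realL2 fun z => z.2 * i.1 z) (b := fun i : ι => realL2 i.1)
    (x := x) (g := g) (w := w) (C := C)
    (fun k k' h1 h2 => ((conv w k).1 h1).unique ((conv w k').1 h2))
    (fun n i => (conv (x n) (g n)).2 (h n) i) hg hx
  exact ⟨k, (conv w k).1 hk, hw⟩

/-! ### Weak derivatives, convolutions and translations -/

theorem locallyIntegrable_coe (u : L2 d) : LocallyIntegrable u volume :=
  (Lp.memLp u).locallyIntegrable (by norm_num)

theorem HasWeakDeriv.integral_complex {v : Space d} {u g : L2 d} (h : HasWeakDeriv v u g)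
    {Ψ : Space d → ℂ} (hΨ : ContDiff ℝ ∞ Ψ) (hs : HasCompactSupport Ψ) :
    ∫ z, u z * fderiv ℝ Ψ z v = - ∫ z, g z * Ψ z := by
  have hre : ContDiff ℝ ∞ fun z => (Ψ z).re := Complex.reCLM.contDiff.comp hΨ
  have him : ContDiff ℝ ∞ fun z => (Ψ z).im := Complex.imCLM.contDiff.comp hΨ
  have hsre : HasCompactSupport fun z => (Ψ z).re := hs.comp_left (g := Complex.re) rfl
  have hsim : HasCompactSupport fun z => (Ψ z).im := hs.comp_left (g := Complex.im) rfl
  have hd : Differentiable ℝ Ψ := hΨ.differentiable (by simp)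
  have dre : ∀ z, fderiv ℝ (fun z => (Ψ z).re) z v = (fderiv ℝ Ψ z v).re := fun z => by
    have := (Complex.reCLM.hasFDerivAt.comp z (hd z).hasFDerivAt).fderiv
    change fderiv ℝ (Complex.reCLM ∘ Ψ) z v = _
    rw [this]; rfl
  have dim : ∀ z, fderiv ℝ (fun z => (Ψ z).im) z v = (fderiv ℝ Ψ z v).im := fun z => by
    have := (Complex.imCLM.hasFDerivAt.comp z (hd z).hasFDerivAt).fderiv
    change fderiv ℝ (Complex.imCLM ∘ Ψ) z v = _
    rw [this]; rfl
  have e1 := h _ hre hsre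
  have e2 := h _ him hsim
  have i1 := integrable_smul_of_compact (continuous_fderiv_apply hre v)
    (hasCompactSupport_fderiv_apply hsre v) u
  have i2 := integrable_smul_of_compact (continuous_fderiv_apply him v)
    (hasCompactSupport_fderiv_apply hsim v) u
  have i3 := integrable_smul_of_compact hre.continuous hsre g
  have i4 := integrable_smul_of_compact him.continuous hsim g
  have l : ∫ z, u z * fderiv ℝ Ψ z v = (∫ z, fderiv ℝ (fun z => (Ψ z).re) z v • u z)
      + Complex.I * ∫ z, fderiv ℝ (fun z => (Ψ z).im) z v • u z := by
    rw [← integral_const_mul, ← integral_add i1 (i2.const_mul _)]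
    refine integral_congr_ae (Eventually.of_forall fun z => ?_)
    simp only [dre, dim, Complex.real_smul]
    conv_lhs => rw [← Complex.re_add_im (fderiv ℝ Ψ z v)]
    ring
  have r : ∫ z, g z * Ψ z = (∫ z, (Ψ z).re • g z) + Complex.I * ∫ z, (Ψ z).im • g z := by
    rw [← integral_const_mul, ← integral_add i3 (i4.const_mul _)]
    refine integral_congr_ae (Eventually.of_forall fun z => ?_)
    simp only [Complex.real_smul]
    conv_lhs => rw [← Complex.re_add_im (Ψ z)]
    ring
  rw [l, r, e1, e2]; ring

/-- The convolution of `u ∈ L²` with a function `Ψ`. -/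
def conv (u : L2 d) (Ψ : Space d → ℂ) (x : Space d) : ℂ := ∫ t, u t * Ψ (x - t)

theorem conv_eq_convolution (u : L2 d) (Ψ : Space d → ℂ) :
    conv u Ψ = convolution u Ψ (ContinuousLinearMap.mul ℝ ℂ) volume := rfl

theorem contDiff_conv (u : L2 d) {Ψ : Space d → ℂ} (hΨ : ContDiff ℝ ∞ Ψ)
    (hs : HasCompactSupport Ψ) : ContDiff ℝ ∞ (conv u Ψ) := by
  rw [conv_eq_convolution]
  exact hs.contDiff_convolution_right _ (locallyIntegrable_coe u) hΨ

theorem fderiv_conv_apply (u : L2 d) {Ψ : Space d → ℂ} (hΨ : ContDiff ℝ ∞ Ψ)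
    (hs : HasCompactSupport Ψ) (x v : Space d) :
    fderiv ℝ (conv u Ψ) x v = ∫ t, u t * fderiv ℝ Ψ (x - t) v := by
  rw [conv_eq_convolution, (hs.hasFDerivAt_convolution_right _ (locallyIntegrable_coe u)
    (hΨ.of_le (by simp)) x).fderiv, convolution_precompR_apply _ (locallyIntegrable_coe u)
    (hs.fderiv ℝ) (hΨ.continuous_fderiv (by simp))]
  rfl

/-- The classical derivative falls on `Ψ`. As a function of `t`, `Ψ (x - t)` is an admissible test
function, and its reflected argument cancels the sign of integration by parts. -/
theorem HasWeakDeriv.fderiv_conv {v : Space d} {u g : L2 d} (h : HasWeakDeriv v u g)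
    {Ψ : Space d → ℂ} (hΨ : ContDiff ℝ ∞ Ψ) (hs : HasCompactSupport Ψ) (x : Space d) :
    fderiv ℝ (conv u Ψ) x v = conv g Ψ x := by
  rw [fderiv_conv_apply u hΨ hs]
  have hΨ' : ContDiff ℝ ∞ fun t => Ψ (x - t) := hΨ.comp (contDiff_const.sub contDiff_id)
  have hs' : HasCompactSupport fun t => Ψ (x - t) :=
    hs.comp_homeomorph (Homeomorph.subLeft x)
  have key := h.integral_complex hΨ' hs'
  have e : ∀ t, fderiv ℝ (fun t => Ψ (x - t)) t v = - fderiv ℝ Ψ (x - t) v := fun t => by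
    have h1 : HasFDerivAt (fun t => Ψ (x - t))
        ((fderiv ℝ Ψ (x - t)).comp (-ContinuousLinearMap.id ℝ (Space d))) t :=
      ((hΨ.differentiable (by simp)) (x - t)).hasFDerivAt.comp t
        ((hasFDerivAt_id t).const_sub x)
    rw [h1.fderiv]; simp
  simp_rw [e, mul_neg] at key
  rw [integral_neg, neg_inj] at key
  exact key

/-! ### Translations and weak differentiability -/

/-- Translation `u ↦ u (· + a)` on `L²`. -/
def trans (a : Space d) : L2 d →ₗᵢ[ℂ] L2 d :=
  Lp.compMeasurePreservingₗᵢ ℂ (fun z => z + a) (measurePreserving_add_right volume a)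

theorem coeFn_trans (a : Space d) (u : L2 d) : trans a u =ᵐ[volume] fun z => u (z + a) :=
  Lp.coeFn_compMeasurePreserving u (measurePreserving_add_right volume a)

theorem trans_zero (u : L2 d) : trans (0 : Space d) u = u := by
  refine Lp.ext ?_
  filter_upwards [coeFn_trans 0 u] with z hz
  rw [hz, add_zero]

/-- Pairing a translate with a test function is a convolution evaluated at the shift, hence smooth
in the shift even though `u` is only square integrable. -/
theorem inner_trans {Ψ : Space d → ℂ} (hΨ : MemLp Ψ 2 volume) (a : Space d) (u : L2 d) :
    inner ℂ (toL2 Ψ) (trans a u) = conv u (fun w => conj (Ψ (-w))) a := by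
  rw [inner_toL2_left hΨ, conv]
  have : ∫ z, conj (Ψ z) * (trans a u) z = ∫ z, conj (Ψ z) * u (z + a) := by
    refine integral_congr_ae ?_
    filter_upwards [coeFn_trans a u] with z hz
    rw [hz]
  rw [this, ← integral_add_right_eq_self (fun t => u t * conj (Ψ (-(a - t)))) a]
  refine integral_congr_ae (Eventually.of_forall fun z => ?_)
  simp [mul_comm]

theorem contDiff_conj_comp_neg {Ψ : Space d → ℂ} (hΨ : ContDiff ℝ ∞ Ψ) :
    ContDiff ℝ ∞ fun w => conj (Ψ (-w)) :=
  Complex.conjCLE.contDiff.comp (hΨ.comp contDiff_neg)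

theorem hasCompactSupport_conj_comp_neg {Ψ : Space d → ℂ} (hs : HasCompactSupport Ψ) :
    HasCompactSupport fun w => conj (Ψ (-w)) :=
  (hs.comp_homeomorph (Homeomorph.neg (Space d))).comp_left (g := conj) (by simp)

theorem hasDerivAt_inner_trans {Ψ : Space d → ℂ} (hΨ : ContDiff ℝ ∞ Ψ)
    (hs : HasCompactSupport Ψ) (v : Space d) (u : L2 d) (s : ℝ) :
    HasDerivAt (fun s : ℝ => inner ℂ (toL2 Ψ) (trans (s • v) u))
      (fderiv ℝ (conv u (fun w => conj (Ψ (-w)))) (s • v) v) s := by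
  have hm : MemLp Ψ 2 volume := hΨ.continuous.memLp_of_hasCompactSupport hs
  simp_rw [inner_trans hm]
  have h1 := ((contDiff_conv u (contDiff_conj_comp_neg hΨ)
    (hasCompactSupport_conj_comp_neg hs)).differentiable (by simp) (s • v)).hasFDerivAt
  have h2 : HasDerivAt (fun s : ℝ => s • v) v s := by
    simpa using (hasDerivAt_id s).smul_const v
  exact h1.comp_hasDerivAt s h2

/-- Test functions are dense in `L²`, so the bound extends to all vectors, in particular to `w`
itself. -/
theorem norm_le_of_inner_le_of_dense {w : L2 d} {C : ℝ} (hC0 : 0 ≤ C)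
    (h : ∀ Ψ : Space d → ℂ, ContDiff ℝ ∞ Ψ → HasCompactSupport Ψ →
      ‖inner ℂ (toL2 Ψ) w‖ ≤ C * ‖toL2 Ψ‖) : ‖w‖ ≤ C := by
  have hC : ∀ f : L2 d, ‖inner ℂ f w‖ ≤ C * ‖f‖ := by
    have hcl : IsClosed {f : L2 d | ‖inner ℂ f w‖ ≤ C * ‖f‖} :=
      isClosed_le (by fun_prop) (by fun_prop)
    have hd := Lp.dense_hasCompactSupport_contDiff (F := ℂ) (μ := (volume : Measure (Space d)))
      (p := 2) (by simp)
    intro f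
    refine hcl.closure_subset_iff.2 ?_ (hd f)
    rintro f ⟨g, hfg, hg1, hg2⟩
    have : toL2 g = f := toL2_eq_of_ae hfg
    rw [← this]
    exact h g hg2 hg1
  have := hC w
  have h2 : ‖inner ℂ w w‖ = ‖w‖ * ‖w‖ := by
    rw [inner_self_eq_norm_sq_to_K]; simp [sq]
  rw [h2] at this
  rcases (norm_nonneg w).eq_or_lt with h0 | h0
  · rwa [← h0]
  · exact le_of_mul_le_mul_right this h0

/-- Translation estimate in terms of the weak derivative. -/
theorem HasWeakDeriv.norm_trans_sub_le {v : Space d} {u g : L2 d} (h : HasWeakDeriv v u g) :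
    ‖trans v u - u‖ ≤ ‖g‖ := by
  refine norm_le_of_inner_le_of_dense (norm_nonneg g) fun Ψ hΨ hs => ?_
  have hm : MemLp Ψ 2 volume := hΨ.continuous.memLp_of_hasCompactSupport hs
  have hder : ∀ s : ℝ, HasDerivAt (fun s : ℝ => inner ℂ (toL2 Ψ) (trans (s • v) u))
      (inner ℂ (toL2 Ψ) (trans (s • v) g)) s := fun s => by
    have := hasDerivAt_inner_trans hΨ hs v u s
    rwa [h.fderiv_conv (contDiff_conj_comp_neg hΨ) (hasCompactSupport_conj_comp_neg hs),
      ← inner_trans hm] at this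
  -- Mean value inequality for `s ↦ ⟨Ψ, u(· + s v)⟩` on `[0, 1]`. Its derivative is the same pairing
  -- for `g`, bounded uniformly in `s` because translations are isometries.
  have key := norm_image_sub_le_of_norm_deriv_le_segment_01' (C := ‖g‖ * ‖toL2 Ψ‖)
    (fun s _ => (hder s).hasDerivWithinAt) (fun s _ => by
      refine (norm_inner_le_norm _ _).trans ?_
      rw [LinearIsometry.norm_map, mul_comm])
  simpa only [one_smul, zero_smul, trans_zero, ← inner_sub_right] using key

theorem hasDerivAt_inner_realL2_trans {θ : Space d → ℝ} (hθ : ContDiff ℝ ∞ θ)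
    (hc : HasCompactSupport θ) (v : Space d) (u : L2 d) :
    HasDerivAt (fun s : ℝ => inner ℂ (realL2 θ) (trans (s • v) u))
      (-inner ℂ (realL2 fun z => fderiv ℝ θ z v) u) 0 := by
  have hΨ : ContDiff ℝ ∞ fun z => (θ z : ℂ) := Complex.ofRealCLM.contDiff.comp hθ
  have hΨs : HasCompactSupport fun z => (θ z : ℂ) :=
    hc.comp_left (g := fun x : ℝ => (x : ℂ)) (by simp)
  have hder := hasDerivAt_inner_trans hΨ hΨs v u 0
  have c1 := contDiff_conj_comp_neg (Ψ := fun z => (θ z : ℂ)) hΨ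
  have c2 := hasCompactSupport_conj_comp_neg (Ψ := fun z => (θ z : ℂ)) hΨs
  have key : fderiv ℝ (conv u (fun w => conj ((θ (-w) : ℝ) : ℂ))) ((0 : ℝ) • v) v
      = -inner ℂ (realL2 fun z => fderiv ℝ θ z v) u := by
    rw [fderiv_conv_apply u c1 c2,
      inner_realL2 (continuous_fderiv_apply hθ v) (hasCompactSupport_fderiv_apply hc v),
      ← integral_neg]
    refine integral_congr_ae (Eventually.of_forall fun z => ?_)
    have e : HasFDerivAt (fun w => conj ((θ (-w) : ℝ) : ℂ))
        ((Complex.ofRealCLM.comp (fderiv ℝ θ z)).comp (-ContinuousLinearMap.id ℝ (Space d)))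
        ((0 : ℝ) • v - z) := by
      have e0 : (fun w : Space d => conj ((θ (-w) : ℝ) : ℂ)) = fun w => ((θ (-w) : ℝ) : ℂ) := by
        funext w; rw [Complex.conj_ofReal]
      rw [e0]
      have e1 : HasFDerivAt θ (fderiv ℝ θ z) (-((0 : ℝ) • v - z)) := by
        have := ((hθ.differentiable (by simp)) z).hasFDerivAt
        rwa [zero_smul, zero_sub, neg_neg]
      have e2 : HasFDerivAt (fun w : Space d => -w) (-ContinuousLinearMap.id ℝ (Space d))
        ((0 : ℝ) • v - z) := (hasFDerivAt_id _).neg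
      exact Complex.ofRealCLM.hasFDerivAt.comp _ (e1.comp _ e2)
    have e' := congrArg (fun L => L v) e.fderiv
    simp only at e' ⊢
    rw [e']
    simp [mul_comm]
  rw [key] at hder
  exact hder

/-- A Lipschitz bound on translations yields a weak derivative. -/
theorem exists_hasWeakDeriv_of_norm_trans_sub_le {v : Space d} {u : L2 d} {C : ℝ}
    (h : ∀ t : ℝ, ‖trans (t • v) u - u‖ ≤ |t| * C) : ∃ g, HasWeakDeriv v u g ∧ ‖g‖ ≤ C := by
  let t : ℕ → ℝ := fun n => 1 / ((n : ℝ) + 1)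
  have ht : ∀ n, 0 < t n := fun n => by positivity
  have htl : Tendsto t atTop (𝓝 0) := tendsto_one_div_add_atTop_nhds_zero_nat
  -- Difference quotients are bounded by `C`; any weak subsequential limit is the weak derivative.
  let x : ℕ → L2 d := fun n => ((t n)⁻¹ : ℂ) • (trans (t n • v) u - u)
  have hx : ∀ n, ‖x n‖ ≤ C := fun n => by
    have h1 := h (t n)
    rw [abs_of_pos (ht n)] at h1
    simp only [x]
    rw [norm_smul, norm_inv, Complex.norm_real, Real.norm_eq_abs, abs_of_pos (ht n),
      inv_mul_le_iff₀ (ht n)]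
    exact h1
  obtain ⟨g, s, hs, hg⟩ := exists_weakTendsto_subseq hx
  refine ⟨g, ?_, hg.norm_le fun n => hx _⟩
  rw [hasWeakDeriv_iff]
  intro θ hθ hc
  have hder := hasDerivAt_inner_realL2_trans hθ hc v u
  rw [hasDerivAt_iff_tendsto_slope_zero] at hder
  have hlim : Tendsto (fun n => t (s n)) atTop (𝓝[≠] 0) := by
    rw [tendsto_nhdsWithin_iff]
    exact ⟨htl.comp hs.tendsto_atTop, Eventually.of_forall fun n => (ht _).ne'⟩
  have h1 := hder.comp hlim
  have h3 : inner ℂ (realL2 θ) g = -inner ℂ (realL2 fun z => fderiv ℝ θ z v) u := by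
    refine tendsto_nhds_unique (hg (realL2 θ)) (h1.congr fun n => ?_)
    simp only [Function.comp_apply, zero_add, zero_smul, trans_zero, ← inner_sub_right, x]
    rw [inner_smul_right, Complex.real_smul, Complex.ofReal_inv]
  rw [h3, neg_neg]

/-! ### The modulus of a function of the energy space -/

/-- The modulus of an element of `L²`. -/
def absL2 (u : L2 d) : L2 d := toL2 fun z => (‖u z‖ : ℂ)

theorem coeFn_absL2 (u : L2 d) : absL2 u =ᵐ[volume] fun z => (‖u z‖ : ℂ) := by
  refine coeFn_toL2 ?_
  refine (memLp_congr_norm ?_ (Lp.aestronglyMeasurable u) ?_).2 (Lp.memLp u)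
  · exact Complex.continuous_ofReal.comp_aestronglyMeasurable (Lp.aestronglyMeasurable u).norm
  · exact Eventually.of_forall fun z => by simp

/-- The modulus is 1-Lipschitz, so differences of translates do not grow under it. The
characterization of weak derivatives by translations then gives the diamagnetic-type bound without a
chain rule. -/
theorem HasWeakDeriv.exists_absL2 {v : Space d} {u g : L2 d} (h : HasWeakDeriv v u g) :
    ∃ k, HasWeakDeriv v (absL2 u) k ∧ ‖k‖ ≤ ‖g‖ := by
  refine exists_hasWeakDeriv_of_norm_trans_sub_le fun t => ?_
  have h1 := (h.dir_smul t).norm_trans_sub_le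
  rw [norm_smul, Complex.norm_real, Real.norm_eq_abs] at h1
  refine le_trans (Lp.norm_le_norm_of_ae_le ?_) h1
  have q := (measurePreserving_add_right (volume : Measure (Space d)) (t • v)).quasiMeasurePreserving
  filter_upwards [Lp.coeFn_sub (trans (t • v) (absL2 u)) (absL2 u),
    Lp.coeFn_sub (trans (t • v) u) u, coeFn_trans (t • v) (absL2 u), coeFn_trans (t • v) u,
    coeFn_absL2 u, q.ae (coeFn_absL2 u)] with z h1 h2 h3 h4 h5 h6
  rw [h1, h2, Pi.sub_apply, Pi.sub_apply, h3, h4, h5, h6, ← Complex.ofReal_sub, Complex.norm_real]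
  exact abs_norm_sub_norm_le _ _

theorem norm_absL2 (u : L2 d) : ‖absL2 u‖ = ‖u‖ := by
  refine le_antisymm (Lp.norm_le_norm_of_ae_le ?_) (Lp.norm_le_norm_of_ae_le ?_) <;>
  · filter_upwards [coeFn_absL2 u] with z h
    simp [h]

theorem HasMulY.exists_absL2 {u g : L2 d} (h : HasMulY u g) :
    ∃ k, HasMulY (absL2 u) k ∧ ‖k‖ ≤ ‖g‖ := by
  have hm : MemLp (fun z : Space d => (z.2 : ℂ) * absL2 u z) 2 volume := by
    refine (memLp_congr_norm ?_ h.memLp.1 ?_).2 h.memLp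
    · exact (Complex.continuous_ofReal.comp continuous_snd).aestronglyMeasurable.mul
        (Lp.aestronglyMeasurable _)
    · filter_upwards [coeFn_absL2 u] with z h
      simp [h]
  refine ⟨mulY (absL2 u), hasMulY_mulY hm, Lp.norm_le_norm_of_ae_le ?_⟩
  filter_upwards [hasMulY_mulY hm, h, coeFn_absL2 u] with z h1 h2 h3
  rw [h1, h2, h3]; simp

theorem absL2_mem_energySpace {u : L2 d} (hu : u ∈ energySpace d) : absL2 u ∈ energySpace d := by
  rw [mem_energySpace_iff] at hu
  choose gx hx _ using fun i => (hu.1 i).exists_absL2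
  obtain ⟨gy, hy, -⟩ := hu.2.1.exists_absL2
  obtain ⟨k, hk, -⟩ := hu.2.2.exists_absL2
  exact mem_energySpace_of hx hy hk

theorem norm_weakDeriv_absL2_le {v : Space d} {u : L2 d} (h : HasWeakDeriv v u (weakDeriv v u)) :
    ‖weakDeriv v (absL2 u)‖ ≤ ‖weakDeriv v u‖ := by
  obtain ⟨k, hk, hle⟩ := h.exists_absL2
  rwa [hk.weakDeriv_eq]

theorem norm_mulY_absL2_le {u : L2 d} (h : HasMulY u (mulY u)) :
    ‖mulY (absL2 u)‖ ≤ ‖mulY u‖ := by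
  obtain ⟨k, hk, hle⟩ := h.exists_absL2
  rwa [hk.mulY_eq]

theorem nonlinearTerm_absL2 (α : ℝ) (u : L2 d) : nonlinearTerm α (absL2 u) = nonlinearTerm α u := by
  refine integral_congr_ae ?_
  filter_upwards [coeFn_absL2 u] with z h
  simp [h]

/-! ### Translation estimates in the energy space -/

/-- The sum of the `L²` norms of the weak partial derivatives. -/
def gradNorm (u : L2 d) : ℝ := ∑ i : Fin d, ‖weakDeriv (dirX i) u‖ + ‖weakDeriv (dirY d) u‖

theorem gradNorm_nonneg (u : L2 d) : 0 ≤ gradNorm u := by unfold gradNorm; positivity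

theorem eq_sum_dir (a : Space d) : a = ∑ i : Fin d, a.1 i • dirX i + a.2 • dirY d := by
  have h1 : (∑ i : Fin d, a.1 i • (dirX i : Space d)) = (a.1, 0) := by
    refine Prod.ext ?_ ?_
    · rw [Prod.fst_sum]
      simp only [dirX, Prod.smul_mk]
      ext j
      simp [Finset.sum_apply, Pi.single_apply]
    · rw [Prod.snd_sum]
      simp [dirX]
  rw [h1]
  simp [dirY]

theorem abs_fst_apply_le (a : Space d) (i : Fin d) : |a.1 i| ≤ ‖a‖ :=
  (PiLp.norm_apply_le a.1 i).trans (norm_fst_le a)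

theorem norm_trans_sub_le {u : L2 d} (hu : u ∈ energySpace d) (a : Space d) :
    ‖trans a u - u‖ ≤ ‖a‖ * gradNorm u := by
  have hu' := mem_energySpace_iff.1 hu
  have h1 : HasWeakDeriv a u (∑ i : Fin d, ((a.1 i : ℝ) : ℂ) • weakDeriv (dirX i) u
      + (a.2 : ℂ) • weakDeriv (dirY d) u) := by
    have := (HasWeakDeriv.dir_sum Finset.univ
      (fun i _ => (hu'.1 i).dir_smul (a.1 i))).dir_add (hu'.2.1.dir_smul a.2)
    rwa [← eq_sum_dir a] at this
  refine h1.norm_trans_sub_le.trans ?_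
  rw [gradNorm, mul_add, Finset.mul_sum]
  refine (norm_add_le _ _).trans (add_le_add ((norm_sum_le _ _).trans
    (Finset.sum_le_sum fun i _ => ?_)) ?_)
  · rw [norm_smul, Complex.norm_real]
    exact mul_le_mul_of_nonneg_right (abs_fst_apply_le a i) (norm_nonneg _)
  · rw [norm_smul, Complex.norm_real]
    exact mul_le_mul_of_nonneg_right (norm_snd_le a) (norm_nonneg _)

/-! ### Mollification -/

theorem lintegral_enorm_sq (f : L2 d) : ∫⁻ z, ‖f z‖ₑ ^ 2 = ENNReal.ofReal (‖f‖ ^ 2) := by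
  rw [norm_sq_eq_integral, ofReal_integral_eq_lintegral_ofReal (integrable_norm_sq f)
    (Eventually.of_forall fun z => by positivity)]
  refine lintegral_congr fun z => ?_
  rw [ENNReal.ofReal_pow (norm_nonneg _), ofReal_norm]

/-- Averaging against a probability density does not increase a uniform `L²` bound. -/
theorem lintegral_enorm_integral_sq_le {ρ : Space d → ℝ} (hρm : Measurable ρ)
    (hρ0 : ∀ w, 0 ≤ ρ w) (hρ1 : ∫⁻ w, ENNReal.ofReal (ρ w) = 1)
    {f : Space d → Space d → ℂ} (hf : Measurable (Function.uncurry f)) {C : ℝ≥0∞}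
    (hC : ∀ w, ρ w ≠ 0 → ∫⁻ x, ‖f x w‖ₑ ^ 2 ≤ C) :
    ∫⁻ x, ‖∫ w, ρ w • f x w‖ₑ ^ 2 ≤ C := by
  have hρe : Measurable fun w => ENNReal.ofReal (ρ w) := hρm.ennreal_ofReal
  let ν : Measure (Space d) := volume.withDensity fun w => ENNReal.ofReal (ρ w)
  have hν : IsProbabilityMeasure ν := ⟨by simp [ν, hρ1]⟩
  -- Jensen's inequality for the probability measure with density `ρ`; Tonelli then exchanges the
  -- averages.
  have step : ∀ x, ‖∫ w, ρ w • f x w‖ₑ ^ 2 ≤ ∫⁻ w, ENNReal.ofReal (ρ w) * ‖f x w‖ₑ ^ 2 := by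
    intro x
    have hfx : Measurable fun w => f x w := hf.comp measurable_prodMk_left
    have h1 : ‖∫ w, ρ w • f x w‖ₑ ≤ ∫⁻ w, ‖f x w‖ₑ ∂ν := by
      refine (enorm_integral_le_lintegral_enorm _).trans (le_of_eq ?_)
      rw [lintegral_withDensity_eq_lintegral_mul _ hρe hfx.enorm]
      refine lintegral_congr fun w => ?_
      rw [enorm_smul, Real.enorm_eq_ofReal (hρ0 w)]; rfl
    have h2 : (∫⁻ w, ‖f x w‖ₑ ∂ν) ^ 2 ≤ ∫⁻ w, ‖f x w‖ₑ ^ 2 ∂ν := by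
      have h3 := eLpNorm_le_eLpNorm_of_exponent_le (μ := ν) (p := 1) (q := 2) (by norm_num)
        hfx.aestronglyMeasurable
      rw [eLpNorm_one_eq_lintegral_enorm, eLpNorm_eq_lintegral_rpow_enorm_toReal (by simp)
        (by simp)] at h3
      have h4 := pow_le_pow_left' h3 2
      rw [← ENNReal.rpow_natCast (_ ^ _), ← ENNReal.rpow_mul] at h4
      simpa using h4
    refine (pow_le_pow_left' h1 2).trans (h2.trans (le_of_eq ?_))
    rw [lintegral_withDensity_eq_lintegral_mul _ hρe (hfx.enorm.pow_const 2)]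
    rfl
  calc ∫⁻ x, ‖∫ w, ρ w • f x w‖ₑ ^ 2
      ≤ ∫⁻ x, ∫⁻ w, ENNReal.ofReal (ρ w) * ‖f x w‖ₑ ^ 2 := lintegral_mono step
    _ = ∫⁻ w, ∫⁻ x, ENNReal.ofReal (ρ w) * ‖f x w‖ₑ ^ 2 := by
        refine lintegral_lintegral_swap (Measurable.aemeasurable ?_)
        exact (hρe.comp measurable_snd).mul (hf.enorm.pow_const 2)
    _ ≤ ∫⁻ w, ENNReal.ofReal (ρ w) * C := by
        refine lintegral_mono fun w => ?_
        have hfw : Measurable fun x => f x w := hf.comp measurable_prodMk_right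
        rw [lintegral_const_mul _ (hfw.enorm.pow_const 2)]
        by_cases h0 : ρ w = 0
        · simp [h0]
        · exact mul_le_mul_right (hC w h0) _
    _ = C := by rw [lintegral_mul_const _ hρe, hρ1, one_mul]

/-- A smooth probability density supported in the ball of radius `ε`. -/
structure IsMollifier (ε : ℝ) (ρ : Space d → ℝ) : Prop where
  contDiff : ContDiff ℝ ∞ ρ
  hasCompactSupport : HasCompactSupport ρ
  nonneg : ∀ w, 0 ≤ ρ w
  integral_eq : ∫ w, ρ w = 1
  norm_le : ∀ w, ρ w ≠ 0 → ‖w‖ ≤ ε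

theorem exists_isMollifier (d : ℕ) {ε : ℝ} (hε : 0 < ε) : ∃ ρ : Space d → ℝ, IsMollifier ε ρ := by
  let b : ContDiffBump (0 : Space d) := ⟨ε / 2, ε, by positivity, by linarith⟩
  refine ⟨b.normed volume, b.contDiff_normed, b.hasCompactSupport_normed, b.nonneg_normed,
    b.integral_normed, fun w hw => ?_⟩
  have : w ∈ Function.support (b.normed volume) := hw
  rw [b.support_normed_eq] at this
  exact (mem_ball_zero_iff.1 this).le

/-- The mollification of `u ∈ L²` by `ρ`. -/
def moll (ρ : Space d → ℝ) (u : L2 d) : Space d → ℂ := conv u fun w => (ρ w : ℂ)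

theorem moll_apply (ρ : Space d → ℝ) (u : L2 d) (x : Space d) :
    moll ρ u x = ∫ w, ρ w • u (x - w) := by
  rw [moll, conv, ← integral_sub_left_eq_self _ volume x]
  refine integral_congr_ae (Eventually.of_forall fun w => ?_)
  simp [mul_comm]

/-- A value of the mollification is a pairing with a fixed vector of `L²`. Hence weak convergence
implies pointwise convergence of mollifications, and an `L²` bound gives a uniform bound. -/
theorem moll_eq_inner {ρ : Space d → ℝ} (hc : Continuous ρ) (hs : HasCompactSupport ρ) (u : L2 d)
    (x : Space d) : moll ρ u x = inner ℂ (realL2 fun t => ρ (x - t)) u := by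
  rw [inner_realL2 (θ := fun t => ρ (x - t)) (hc.comp (continuous_const.sub continuous_id))
    (hs.comp_homeomorph (Homeomorph.subLeft x)), moll, conv]
  refine integral_congr_ae (Eventually.of_forall fun w => ?_)
  simp [mul_comm]

theorem norm_moll_le {ρ : Space d → ℝ} (hc : Continuous ρ) (hs : HasCompactSupport ρ) (u : L2 d)
    (x : Space d) : ‖moll ρ u x‖ ≤ ‖realL2 ρ‖ * ‖u‖ := by
  rw [moll_eq_inner hc hs]
  refine (norm_inner_le_norm _ _).trans (mul_le_mul_of_nonneg_right (le_of_eq ?_) (norm_nonneg _))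
  have c1 : Continuous fun t => ρ (x - t) := hc.comp (continuous_const.sub continuous_id)
  have c2 : HasCompactSupport fun t => ρ (x - t) := hs.comp_homeomorph (Homeomorph.subLeft x)
  rw [← sq_eq_sq₀ (norm_nonneg _) (norm_nonneg _), realL2, realL2,
    norm_toL2_sq (memLp_ofReal_of_compact c1 c2), norm_toL2_sq (memLp_ofReal_of_compact hc hs)]
  exact integral_sub_left_eq_self (fun t => ‖(ρ t : ℂ)‖ ^ 2) volume x

theorem moll_sub {ρ : Space d → ℝ} (hc : Continuous ρ) (hs : HasCompactSupport ρ) (u v : L2 d)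
    (x : Space d) : moll ρ (u - v) x = moll ρ u x - moll ρ v x := by
  rw [moll_eq_inner hc hs, moll_eq_inner hc hs, moll_eq_inner hc hs, inner_sub_right]

theorem moll_trans (ρ : Space d → ℝ) (a : Space d) (u : L2 d) (x : Space d) :
    moll ρ (trans a u) x = moll ρ u (x + a) := by
  rw [moll_apply, moll_apply]
  have q := (Measure.measurePreserving_sub_left (volume : Measure (Space d)) x).quasiMeasurePreserving
  refine integral_congr_ae ?_
  filter_upwards [q.ae (coeFn_trans a u)] with w hw
  rw [hw, sub_add_eq_add_sub]

namespace IsMollifier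

variable {ε : ℝ} {ρ : Space d → ℝ}

theorem lintegral_eq (hρ : IsMollifier ε ρ) : ∫⁻ w, ENNReal.ofReal (ρ w) = 1 := by
  rw [← ofReal_integral_eq_lintegral_ofReal
    (hρ.contDiff.continuous.integrable_of_hasCompactSupport hρ.hasCompactSupport)
    (Eventually.of_forall hρ.nonneg), hρ.integral_eq, ENNReal.ofReal_one]

theorem contDiff_ofReal (hρ : IsMollifier ε ρ) : ContDiff ℝ ∞ fun w => (ρ w : ℂ) :=
  Complex.ofRealCLM.contDiff.comp hρ.contDiff

theorem hasCompactSupport_ofReal (hρ : IsMollifier ε ρ) :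
    HasCompactSupport fun w => (ρ w : ℂ) :=
  hρ.hasCompactSupport.comp_left (g := fun x : ℝ => (x : ℂ)) (by simp)

theorem contDiff_moll (hρ : IsMollifier ε ρ) (u : L2 d) : ContDiff ℝ ∞ (moll ρ u) :=
  contDiff_conv u hρ.contDiff_ofReal hρ.hasCompactSupport_ofReal

theorem fderiv_moll (hρ : IsMollifier ε ρ) {v : Space d} {u g : L2 d} (h : HasWeakDeriv v u g)
    (x : Space d) : fderiv ℝ (moll ρ u) x v = moll ρ g x :=
  h.fderiv_conv hρ.contDiff_ofReal hρ.hasCompactSupport_ofReal x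

theorem measurable_coe (u : L2 d) : Measurable u := (Lp.stronglyMeasurable u).measurable

theorem lintegral_moll_sq_le (hρ : IsMollifier ε ρ) (u : L2 d) :
    ∫⁻ x, ‖moll ρ u x‖ₑ ^ 2 ≤ ENNReal.ofReal (‖u‖ ^ 2) := by
  simp_rw [moll_apply]
  refine lintegral_enorm_integral_sq_le hρ.contDiff.continuous.measurable hρ.nonneg
    hρ.lintegral_eq (f := fun x w => u (x - w)) ?_ fun w _ => le_of_eq ?_
  · exact (measurable_coe u).comp (measurable_fst.sub measurable_snd)
  · rw [lintegral_sub_right_eq_self (fun x => ‖u x‖ₑ ^ 2) w, lintegral_enorm_sq]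

/-- The error is the average over `‖w‖ ≤ ε` of `u(· - w) - u`, and each of these differences is
controlled by the gradient. -/
theorem lintegral_moll_sub_sq_le (hρ : IsMollifier ε ρ) {u : L2 d} (hu : u ∈ energySpace d) :
    ∫⁻ x, ‖moll ρ u x - u x‖ₑ ^ 2 ≤ ENNReal.ofReal ((ε * gradNorm u) ^ 2) := by
  have e : ∀ x, moll ρ u x - u x = ∫ w, ρ w • (u (x - w) - u x) := fun x => by
    have i1 : Integrable (fun w => ρ w • u (x - w)) volume := by
      have h0 := integrable_smul_of_compact
        (hρ.contDiff.continuous.comp (continuous_const.sub continuous_id))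
        (hρ.hasCompactSupport.comp_homeomorph (Homeomorph.subLeft x)) u
      have h1 := h0.comp_sub_left x
      refine h1.congr (Eventually.of_forall fun w => ?_)
      simp
    have i2 : Integrable (fun w => ρ w • u x) volume :=
      (hρ.contDiff.continuous.integrable_of_hasCompactSupport hρ.hasCompactSupport).smul_const _
    simp_rw [smul_sub]
    rw [integral_sub i1 i2, integral_smul_const, hρ.integral_eq, one_smul, moll_apply]
  simp_rw [e]
  refine lintegral_enorm_integral_sq_le hρ.contDiff.continuous.measurable hρ.nonneg
    hρ.lintegral_eq (f := fun x w => u (x - w) - u x) ?_ fun w hw => ?_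
  · exact ((measurable_coe u).comp (measurable_fst.sub measurable_snd)).sub
      ((measurable_coe u).comp measurable_fst)
  · have h1 : ∫⁻ x, ‖u (x - w) - u x‖ₑ ^ 2 = ∫⁻ x, ‖(trans (-w) u - u) x‖ₑ ^ 2 := by
      refine lintegral_congr_ae ?_
      filter_upwards [Lp.coeFn_sub (trans (-w) u) u, coeFn_trans (-w) u] with x h1 h2
      rw [h1, Pi.sub_apply, h2, sub_eq_add_neg x w]
    rw [h1, lintegral_enorm_sq]
    refine ENNReal.ofReal_le_ofReal (pow_le_pow_left₀ (norm_nonneg _) ?_ 2)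
    refine (norm_trans_sub_le hu (-w)).trans ?_
    rw [norm_neg]
    exact mul_le_mul_of_nonneg_right (hρ.norm_le w hw) (gradNorm_nonneg u)

theorem eLpNorm_moll_le (hρ : IsMollifier ε ρ) (u : L2 d) :
    eLpNorm (moll ρ u) 2 volume ≤ ENNReal.ofReal ‖u‖ := by
  rw [eLpNorm_eq_lintegral_rpow_enorm_toReal (by simp) (by simp)]
  have h := ENNReal.rpow_le_rpow (hρ.lintegral_moll_sq_le u) (z := 1 / 2) (by norm_num)
  rw [ENNReal.ofReal_rpow_of_nonneg (by positivity) (by norm_num), ← Real.sqrt_eq_rpow,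
    Real.sqrt_sq (norm_nonneg _)] at h
  simpa using h

theorem eLpNorm_moll_sub_le (hρ : IsMollifier ε ρ) (hε : 0 ≤ ε) {u : L2 d}
    (hu : u ∈ energySpace d) :
    eLpNorm (fun x => moll ρ u x - u x) 2 volume ≤ ENNReal.ofReal (ε * gradNorm u) := by
  rw [eLpNorm_eq_lintegral_rpow_enorm_toReal (by simp) (by simp)]
  have h := ENNReal.rpow_le_rpow (hρ.lintegral_moll_sub_sq_le hu) (z := 1 / 2) (by norm_num)
  rw [ENNReal.ofReal_rpow_of_nonneg (by positivity) (by norm_num), ← Real.sqrt_eq_rpow,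
    Real.sqrt_sq (mul_nonneg hε (gradNorm_nonneg u))] at h
  simpa using h

end IsMollifier

/-! ### The Sobolev inequality -/

/-- The critical Sobolev exponent `2 (d + 1) / (d - 1)` of `ℝ^d × ℝ`. -/
def critExp (d : ℕ) : ℝ := 2 * (d + 1) / (d - 1)

theorem critExp_pos (hd : 2 ≤ d) : 0 < critExp d := by
  have : (2 : ℝ) ≤ d := by exact_mod_cast hd
  unfold critExp
  apply div_pos <;> linarith

theorem norm_le_sum_dir (L : Space d →L[ℝ] ℂ) :
    ‖L‖ ≤ ∑ i : Fin d, ‖L (dirX i)‖ + ‖L (dirY d)‖ := by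
  refine L.opNorm_le_bound (by positivity) fun a => ?_
  conv_lhs => rw [eq_sum_dir a]
  rw [map_add, map_sum, add_mul, Finset.sum_mul]
  refine (norm_add_le _ _).trans (add_le_add ((norm_sum_le _ _).trans
    (Finset.sum_le_sum fun i _ => ?_)) ?_)
  · rw [map_smul, norm_smul, mul_comm]
    exact mul_le_mul_of_nonneg_left (abs_fst_apply_le a i) (norm_nonneg _)
  · rw [map_smul, norm_smul, mul_comm]
    exact mul_le_mul_of_nonneg_left (norm_snd_le a) (norm_nonneg _)

theorem IsMollifier.eLpNorm_fderiv_moll_le {ε : ℝ} {ρ : Space d → ℝ} (hρ : IsMollifier ε ρ)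
    {u : L2 d} (hu : u ∈ energySpace d) :
    eLpNorm (fderiv ℝ (moll ρ u)) 2 volume ≤ ENNReal.ofReal (gradNorm u) := by
  have hu' := mem_energySpace_iff.1 hu
  have hm : ∀ g : L2 d, AEStronglyMeasurable (fun x => ‖moll ρ g x‖) volume := fun g =>
    (hρ.contDiff_moll g).continuous.norm.aestronglyMeasurable
  have h1 : ∀ x, ‖fderiv ℝ (moll ρ u) x‖ ≤
      ((∑ i : Fin d, fun x => ‖moll ρ (weakDeriv (dirX i) u) x‖)
        + fun x => ‖moll ρ (weakDeriv (dirY d) u) x‖) x := fun x => by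
    refine (norm_le_sum_dir _).trans (le_of_eq ?_)
    rw [hρ.fderiv_moll hu'.2.1, Pi.add_apply, Finset.sum_apply]
    congr 1
    exact Finset.sum_congr rfl fun i _ => by rw [hρ.fderiv_moll (hu'.1 i)]
  refine (eLpNorm_mono_real h1).trans ?_
  refine (eLpNorm_add_le (Finset.aestronglyMeasurable_sum _ fun i _ => hm _) (hm _)
    (by norm_num)).trans ?_
  rw [gradNorm, ENNReal.ofReal_add (Finset.sum_nonneg fun i _ => norm_nonneg _) (norm_nonneg _),
    ENNReal.ofReal_sum_of_nonneg fun i _ => norm_nonneg _]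
  refine add_le_add ((eLpNorm_sum_le (fun i _ => hm _) (by norm_num)).trans
    (Finset.sum_le_sum fun i _ => ?_)) ?_
  · rw [eLpNorm_norm]; exact hρ.eLpNorm_moll_le _
  · rw [eLpNorm_norm]; exact hρ.eLpNorm_moll_le _

/-- Smooth cutoff functions with bounded derivatives, converging to `1`. -/
theorem exists_cutoff (d : ℕ) : ∃ C : ℝ, 0 ≤ C ∧ ∃ χ : ℕ → Space d → ℝ,
    (∀ n, ContDiff ℝ ∞ (χ n)) ∧ (∀ n, HasCompactSupport (χ n)) ∧ (∀ n z, |χ n z| ≤ 1) ∧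
    (∀ n z, ‖fderiv ℝ (χ n) z‖ ≤ C) ∧ ∀ z, Tendsto (fun n => χ n z) atTop (𝓝 1) := by
  let b : ContDiffBump (0 : Space d) := ⟨1, 2, by norm_num, by norm_num⟩
  have hb : ContDiff ℝ ∞ b := b.contDiff
  obtain ⟨C, hC⟩ := (hb.continuous_fderiv (by simp)).bounded_above_of_compact_support
    (b.hasCompactSupport.fderiv ℝ)
  have hC0 : 0 ≤ C := (norm_nonneg _).trans (hC 0)
  let r : ℕ → ℝ := fun n => ((n : ℝ) + 1)⁻¹
  have hr : ∀ n, 0 < r n := fun n => by positivity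
  -- Scaling factors at most `1` keep the derivative bound `C` of the initial bump for every cutoff.
  have hr1 : ∀ n, r n ≤ 1 := fun n => inv_le_one_of_one_le₀ (by simp)
  refine ⟨C, hC0, fun n z => b (r n • z), fun n => hb.comp (contDiff_const_smul _), fun n => ?_,
    fun n z => ?_, fun n z => ?_, fun z => ?_⟩
  · exact b.hasCompactSupport.comp_homeomorph (Homeomorph.smulOfNeZero (r n) (hr n).ne')
  · rw [abs_of_nonneg b.nonneg]; exact b.le_one
  · have h1 : HasFDerivAt (fun z => b (r n • z))
        ((fderiv ℝ b (r n • z)).comp (r n • ContinuousLinearMap.id ℝ (Space d))) z :=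
      ((hb.differentiable (by simp)) (r n • z)).hasFDerivAt.comp z
        ((hasFDerivAt_id z).const_smul (r n))
    rw [h1.fderiv, ContinuousLinearMap.comp_smul, ContinuousLinearMap.comp_id, norm_smul,
      Real.norm_eq_abs, abs_of_pos (hr n)]
    calc r n * ‖fderiv ℝ b (r n • z)‖ ≤ 1 * C :=
          mul_le_mul (hr1 n) (hC _) (norm_nonneg _) zero_le_one
      _ = C := one_mul C
  · have h1 : Tendsto (fun n => r n • z) atTop (𝓝 ((0 : ℝ) • z)) :=
      (tendsto_inv_atTop_zero.comp (tendsto_natCast_atTop_atTop.atTop_add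
        tendsto_const_nhds)).smul_const z
    rw [zero_smul] at h1
    have h2 := (hb.continuous.tendsto 0).comp h1
    have h3 : b (0 : Space d) = 1 := b.one_of_mem_closedBall (by simp [b])
    rwa [h3] at h2

/-- Mollify and cut off, apply the Gagliardo–Nirenberg–Sobolev inequality to the resulting smooth
compactly supported functions, and pass to an almost everywhere limit by Fatou. The cutoff
derivative contributes the `‖u‖` term on the right. -/
theorem exists_eLpNorm_critExp_le (hd : 2 ≤ d) : ∃ C : ℝ, 0 ≤ C ∧ ∀ u ∈ energySpace d,
    eLpNorm u (ENNReal.ofReal (critExp d)) volume ≤ ENNReal.ofReal (C * (‖u‖ + gradNorm u)) := by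
  obtain ⟨C₁, hC₁, χ, hχ1, hχ2, hχ3, hχ4, hχ5⟩ := exists_cutoff d
  set K : ℝ≥0 := SNormLESNormFDerivOfEqConst ℂ (volume : Measure (Space d)) ((2 : ℝ≥0) : ℝ) with hK
  refine ⟨K * (C₁ + 1), by positivity, fun u hu => ?_⟩
  have hd' : (2 : ℝ) ≤ d := by exact_mod_cast hd
  let ε : ℕ → ℝ := fun n => 1 / ((n : ℝ) + 1)
  have hε : ∀ n, 0 < ε n := fun n => by positivity
  have hε0 : Tendsto ε atTop (𝓝 0) := tendsto_one_div_add_atTop_nhds_zero_nat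
  choose ρ hρ using fun n => exists_isMollifier d (hε n)
  have hL2 : Tendsto (fun n => eLpNorm (moll (ρ n) u - (u : Space d → ℂ)) 2 volume) atTop (𝓝 0) := by
    have h1 : Tendsto (fun n => ENNReal.ofReal (ε n * gradNorm u)) atTop (𝓝 0) := by
      have := ENNReal.tendsto_ofReal (hε0.mul_const (gradNorm u))
      simpa using this
    exact tendsto_of_tendsto_of_tendsto_of_le_of_le tendsto_const_nhds h1 (fun _ => zero_le)
      fun n => (hρ n).eLpNorm_moll_sub_le (hε n).le hu
  have hmeas : ∀ n, AEStronglyMeasurable (moll (ρ n) u) volume := fun n =>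
    ((hρ n).contDiff_moll u).continuous.aestronglyMeasurable
  obtain ⟨s, hs, hae⟩ := (tendstoInMeasure_of_tendsto_eLpNorm (by simp) hmeas
    (Lp.aestronglyMeasurable u) hL2).exists_seq_tendsto_ae
  let w : ℕ → Space d → ℂ := fun n z => χ n z • moll (ρ (s n)) u z
  have hw1 : ∀ n, ContDiff ℝ ∞ (w n) := fun n => (hχ1 n).smul ((hρ (s n)).contDiff_moll u)
  have hw2 : ∀ n, HasCompactSupport (w n) := fun n => (hχ2 n).smul_right
  have hwlim : ∀ᵐ z, Tendsto (fun n => w n z) atTop (𝓝 (u z)) := by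
    filter_upwards [hae] with z hz
    have := (hχ5 z).smul hz
    rwa [one_smul] at this
  have hwder : ∀ n, eLpNorm (fderiv ℝ (w n)) 2 volume
      ≤ ENNReal.ofReal ((C₁ + 1) * (‖u‖ + gradNorm u)) := fun n => by
    have hm := (hρ (s n)).contDiff_moll u
    have h1 : ∀ z, ‖fderiv ℝ (w n) z‖ ≤ ((fun z => ‖fderiv ℝ (moll (ρ (s n)) u) z‖)
        + fun z => C₁ * ‖moll (ρ (s n)) u z‖) z := fun z => by
      have h2 := ((hχ1 n).differentiable (by simp) z).hasFDerivAt.smul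
        (hm.differentiable (by simp) z).hasFDerivAt
      have h3 : fderiv ℝ (w n) z = χ n z • fderiv ℝ (moll (ρ (s n)) u) z
        + (fderiv ℝ (χ n) z).smulRight (moll (ρ (s n)) u z) := h2.fderiv
      rw [h3, Pi.add_apply]
      refine (norm_add_le _ _).trans (add_le_add ?_ ?_)
      · rw [norm_smul, Real.norm_eq_abs]
        exact mul_le_of_le_one_left (norm_nonneg _) (hχ3 n z)
      · rw [ContinuousLinearMap.norm_smulRight_apply]
        exact mul_le_mul_of_nonneg_right (hχ4 n z) (norm_nonneg _)
    refine (eLpNorm_mono_real h1).trans ((eLpNorm_add_le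
      (hm.continuous_fderiv (by simp)).norm.aestronglyMeasurable
      (continuous_const.mul hm.continuous.norm).aestronglyMeasurable (by norm_num)).trans ?_)
    have h4 : eLpNorm (fun z => C₁ * ‖moll (ρ (s n)) u z‖) 2 volume
        ≤ ENNReal.ofReal (C₁ * ‖u‖) := by
      have := eLpNorm_const_smul C₁ (fun z => ‖moll (ρ (s n)) u z‖) 2 volume
      simp only [Pi.smul_def, smul_eq_mul] at this
      rw [this, eLpNorm_norm, Real.enorm_eq_ofReal hC₁, ENNReal.ofReal_mul hC₁]
      exact mul_le_mul_right ((hρ _).eLpNorm_moll_le u) _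
    rw [eLpNorm_norm]
    refine (add_le_add ((hρ _).eLpNorm_fderiv_moll_le hu) h4).trans ?_
    rw [← ENNReal.ofReal_add (gradNorm_nonneg u) (by positivity)]
    refine ENNReal.ofReal_le_ofReal ?_
    nlinarith [gradNorm_nonneg u, norm_nonneg u, mul_nonneg hC₁ (gradNorm_nonneg u)]
  have hq : ((critExp d).toNNReal : ℝ) = critExp d := Real.coe_toNNReal _ (critExp_pos hd).le
  have hGNS : ∀ n, eLpNorm (w n) (ENNReal.ofReal (critExp d)) volume
      ≤ ENNReal.ofReal (K * (C₁ + 1) * (‖u‖ + gradNorm u)) := fun n => by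
    have h1 := eLpNorm_le_eLpNorm_fderiv_of_eq (volume : Measure (Space d))
      ((hw1 n).of_le (by simp)) (hw2 n) (p := 2) (p' := (critExp d).toNNReal) (by norm_num)
      (by simp) (by
        rw [hq]
        simp only [critExp, Module.finrank_prod, finrank_euclideanSpace, Fintype.card_fin,
          Module.finrank_self, NNReal.coe_inv, NNReal.coe_ofNat, Nat.cast_add, Nat.cast_one]
        have : (d : ℝ) - 1 ≠ 0 := by linarith
        have : (d : ℝ) + 1 ≠ 0 := by linarith
        field_simp
        ring)
    refine h1.trans ?_
    rw [mul_assoc, ENNReal.ofReal_mul (by positivity), ENNReal.ofReal_coe_nnreal]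
    exact mul_le_mul_right (hwder n) _
  refine (Lp.eLpNorm_lim_le_liminf_eLpNorm
    (fun n => (hw1 n).continuous.aestronglyMeasurable) u hwlim).trans ?_
  exact liminf_le_of_frequently_le' (Frequently.of_forall hGNS)

theorem exists_integral_critExp_le (hd : 2 ≤ d) : ∃ C : ℝ, 0 ≤ C ∧ ∀ u ∈ energySpace d,
    Integrable (fun z => ‖u z‖ ^ critExp d) volume ∧
      ∫ z, ‖u z‖ ^ critExp d ≤ (C * (‖u‖ + gradNorm u)) ^ critExp d := by
  obtain ⟨C, hC, h⟩ := exists_eLpNorm_critExp_le hd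
  refine ⟨C, hC, fun u hu => ?_⟩
  have hq := critExp_pos hd
  have hH : 0 ≤ C * (‖u‖ + gradNorm u) :=
    mul_nonneg hC (add_nonneg (norm_nonneg _) (gradNorm_nonneg u))
  have hm : MemLp u (ENNReal.ofReal (critExp d)) volume :=
    ⟨Lp.aestronglyMeasurable u, (h u hu).trans_lt ENNReal.ofReal_lt_top⟩
  have hi := hm.integrable_norm_rpow (by simpa using hq) (by simp)
  rw [ENNReal.toReal_ofReal hq.le] at hi
  refine ⟨hi, ?_⟩
  have h1 := h u hu
  rw [hm.eLpNorm_eq_integral_rpow_norm (by simpa using hq) (by simp),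
    ENNReal.toReal_ofReal hq.le, ENNReal.ofReal_le_ofReal_iff hH] at h1
  have h2 := Real.rpow_le_rpow (by positivity) h1 hq.le
  rwa [← Real.rpow_mul (integral_nonneg fun z => by positivity), inv_mul_cancel₀ hq.ne',
    Real.rpow_one] at h2

/-- Below the threshold `T` the first term dominates, above it the second. -/
theorem rpow_le_interp {p q t T : ℝ} (hp : 2 ≤ p) (hpq : p ≤ q) (ht : 0 ≤ t) (hT : 0 < T) :
    t ^ p ≤ T ^ (p - 2) * t ^ 2 + T ^ (p - q) * t ^ q := by
  rcases ht.eq_or_lt with rfl | ht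
  · rw [Real.zero_rpow (by linarith), Real.zero_rpow (by linarith)]; simp
  rcases le_total t T with h | h
  · have h1 : t ^ p = t ^ (p - 2) * t ^ 2 := by
      rw [← Real.rpow_natCast, ← Real.rpow_add ht]; norm_num
    have h2 : t ^ (p - 2) ≤ T ^ (p - 2) := Real.rpow_le_rpow ht.le h (by linarith)
    have h3 : 0 ≤ T ^ (p - q) * t ^ q := by positivity
    rw [h1]
    nlinarith [mul_le_mul_of_nonneg_right h2 (sq_nonneg t)]
  · have h1 : t ^ p = t ^ (p - q) * t ^ q := by
      rw [← Real.rpow_add ht]; norm_num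
    have h2 : t ^ (p - q) ≤ T ^ (p - q) :=
      Real.rpow_le_rpow_of_nonpos hT h (by linarith)
    have h3 : 0 ≤ T ^ (p - 2) * t ^ 2 := by positivity
    rw [h1]
    nlinarith [mul_le_mul_of_nonneg_right h2 (Real.rpow_nonneg ht.le q)]

theorem aestronglyMeasurable_norm_rpow (u : L2 d) {p : ℝ} (hp : 0 ≤ p) :
    AEStronglyMeasurable (fun z => ‖u z‖ ^ p) volume :=
  (Real.continuous_rpow_const hp).comp_aestronglyMeasurable (Lp.aestronglyMeasurable u).norm

theorem integrable_norm_rpow (hd : 2 ≤ d) {p : ℝ} (hp : 2 ≤ p) (hpq : p ≤ critExp d) {u : L2 d}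
    (hu : u ∈ energySpace d) : Integrable (fun z => ‖u z‖ ^ p) volume := by
  obtain ⟨C, -, h⟩ := exists_integral_critExp_le hd
  refine ((integrable_norm_sq u).add (h u hu).1).mono'
    (aestronglyMeasurable_norm_rpow u (by linarith)) (Eventually.of_forall fun z => ?_)
  rw [Real.norm_eq_abs, abs_of_nonneg (by positivity)]
  have := rpow_le_interp hp hpq (norm_nonneg (u z)) one_pos
  simpa using this

end PartialHarmonic

end

noncomputable section

open MeasureTheory Filter Topology
open scoped ComplexConjugate ENNReal NNReal

namespace PartialHarmonic

variable {d : ℕ}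

/-! ### Affine changes of the variable `x` -/

/-- The affine map `(x, y) ↦ (r x + a, y)`. -/
def aff (r : ℝ) (a : EuclideanSpace ℝ (Fin d)) (z : Space d) : Space d := (r • z.1 + a, z.2)

/-- The linear part `(x, y) ↦ (r x, y)` of `aff r a`. -/
def affLin (r : ℝ) : Space d →L[ℝ] Space d :=
  (r • ContinuousLinearMap.id ℝ (EuclideanSpace ℝ (Fin d))).prodMap (ContinuousLinearMap.id ℝ ℝ)

theorem hasFDerivAt_aff (r : ℝ) (a : EuclideanSpace ℝ (Fin d)) (z : Space d) :
    HasFDerivAt (aff r a) (affLin r) z := by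
  have : aff r a = fun z : Space d => affLin r z + ((a, 0) : Space d) := by
    funext z; refine Prod.ext ?_ ?_ <;> simp [aff, affLin]
  rw [this]
  exact (affLin r).hasFDerivAt.add_const _

open scoped ContDiff in
theorem contDiff_aff (r : ℝ) (a : EuclideanSpace ℝ (Fin d)) : ContDiff ℝ ∞ (aff (d := d) r a) :=
  ((contDiff_fst.const_smul r).add contDiff_const).prodMk contDiff_snd

theorem aff_aff_inv {r : ℝ} (hr : r ≠ 0) (a : EuclideanSpace ℝ (Fin d)) (z : Space d) :
    aff r a (aff r⁻¹ (-(r⁻¹ • a)) z) = z := by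
  simp [aff, smul_smul, hr]

theorem aff_inv_aff {r : ℝ} (hr : r ≠ 0) (a : EuclideanSpace ℝ (Fin d)) (z : Space d) :
    aff r⁻¹ (-(r⁻¹ • a)) (aff r a z) = z := by
  simp [aff, smul_smul, hr]

/-- `aff r a` as a homeomorphism. -/
def affHomeo {r : ℝ} (hr : r ≠ 0) (a : EuclideanSpace ℝ (Fin d)) : Space d ≃ₜ Space d where
  toFun := aff r a
  invFun := aff r⁻¹ (-(r⁻¹ • a))
  left_inv := aff_inv_aff hr a
  right_inv := aff_aff_inv hr a
  continuous_toFun := (contDiff_aff r a).continuous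
  continuous_invFun := (contDiff_aff _ _).continuous

/-- Only the `d` coordinates of `x` are scaled, so the Jacobian is `r ^ d` rather than `r ^ (d +
1)`. -/
theorem map_aff {r : ℝ} (hr : 0 < r) (a : EuclideanSpace ℝ (Fin d)) :
    Measure.map (aff r a) (volume : Measure (Space d))
      = ENNReal.ofReal ((r ^ d)⁻¹) • (volume : Measure (Space d)) := by
  have h1 : Measure.map (fun x : EuclideanSpace ℝ (Fin d) => r • x + a) volume
      = ENNReal.ofReal ((r ^ d)⁻¹) • volume := by
    have h2 : (fun x : EuclideanSpace ℝ (Fin d) => r • x + a) = (fun x => x + a) ∘ (r • ·) := rfl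
    rw [h2, ← Measure.map_map (measurable_add_const a) (measurable_const_smul r),
      Measure.map_addHaar_smul _ hr.ne', Measure.map_smul, map_add_right_eq_self]
    simp [abs_of_pos hr]
  have h3 : aff (d := d) r a = Prod.map (fun x => r • x + a) id := rfl
  rw [h3, Measure.volume_eq_prod, ← Measure.map_prod_map _ _ (by fun_prop) measurable_id, h1,
    Measure.map_id, Measure.prod_smul_left]

theorem measurableEmbedding_aff {r : ℝ} (hr : 0 < r) (a : EuclideanSpace ℝ (Fin d)) :
    MeasurableEmbedding (aff (d := d) r a) := (affHomeo hr.ne' a).measurableEmbedding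

theorem integral_comp_aff {E : Type*} [NormedAddCommGroup E] [NormedSpace ℝ E] {r : ℝ} (hr : 0 < r)
    (a : EuclideanSpace ℝ (Fin d)) (f : Space d → E) :
    ∫ z, f (aff r a z) = (r ^ d)⁻¹ • ∫ z, f z := by
  rw [← (measurableEmbedding_aff hr a).integral_map, map_aff hr a, integral_smul_measure,
    ENNReal.toReal_ofReal (by positivity)]

theorem quasiMeasurePreserving_aff {r : ℝ} (hr : 0 < r) (a : EuclideanSpace ℝ (Fin d)) :
    Measure.QuasiMeasurePreserving (aff (d := d) r a) volume volume := by
  refine ⟨(contDiff_aff r a).continuous.measurable, ?_⟩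
  rw [map_aff hr a]
  exact Measure.smul_absolutelyContinuous

/-- Composition with `aff r a` on `L²`. -/
def dil (r : ℝ) (a : EuclideanSpace ℝ (Fin d)) (u : L2 d) : L2 d := toL2 fun z => u (aff r a z)

theorem memLp_comp_aff {r : ℝ} (hr : 0 < r) (a : EuclideanSpace ℝ (Fin d)) (u : L2 d) :
    MemLp (fun z => u (aff r a z)) 2 volume := by
  have h1 : MemLp u 2 (Measure.map (aff r a) (volume : Measure (Space d))) := by
    rw [map_aff hr a]
    exact (Lp.memLp u).smul_measure ENNReal.ofReal_ne_top
  exact ((measurableEmbedding_aff hr a).memLp_map_measure_iff).1 h1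

theorem coeFn_dil {r : ℝ} (hr : 0 < r) (a : EuclideanSpace ℝ (Fin d)) (u : L2 d) :
    dil r a u =ᵐ[volume] fun z => u (aff r a z) := coeFn_toL2 (memLp_comp_aff hr a u)

theorem norm_dil_sq {r : ℝ} (hr : 0 < r) (a : EuclideanSpace ℝ (Fin d)) (u : L2 d) :
    ‖dil r a u‖ ^ 2 = (r ^ d)⁻¹ * ‖u‖ ^ 2 := by
  rw [dil, norm_toL2_sq (memLp_comp_aff hr a u), norm_sq_eq_integral,
    integral_comp_aff hr a fun z => ‖u z‖ ^ 2, smul_eq_mul]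

theorem norm_dil_one (a : EuclideanSpace ℝ (Fin d)) (u : L2 d) : ‖dil 1 a u‖ = ‖u‖ := by
  have := norm_dil_sq one_pos a u
  rw [one_pow, inv_one, one_mul] at this
  exact (sq_eq_sq₀ (norm_nonneg _) (norm_nonneg _)).1 this

open scoped ContDiff in
theorem HasWeakDeriv.dil {r : ℝ} (hr : 0 < r) (a : EuclideanSpace ℝ (Fin d)) {v : Space d}
    {u g : L2 d} (h : HasWeakDeriv (affLin r v) u g) :
    HasWeakDeriv v (dil r a u) (dil r a g) := by
  intro θ hθ hs
  -- The test function is transported by the inverse affine map; the Jacobian factor is the same on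
  -- both sides and drops out.
  let θ' : Space d → ℝ := fun z => θ (aff r⁻¹ (-(r⁻¹ • a)) z)
  have hθ' : ContDiff ℝ ∞ θ' := hθ.comp (contDiff_aff _ _)
  have hs' : HasCompactSupport θ' := hs.comp_homeomorph (affHomeo hr.ne' a).symm
  have e0 : θ = fun z => θ' (aff r a z) := by
    funext z; simp only [θ', aff_inv_aff hr.ne']
  have e1 : ∀ z, fderiv ℝ θ z v = fderiv ℝ θ' (aff r a z) (affLin r v) := fun z => by
    have := ((hθ'.differentiable (by simp)) (aff r a z)).hasFDerivAt.comp z (hasFDerivAt_aff r a z)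
    have e2 : fderiv ℝ θ z = (fderiv ℝ θ' (aff r a z)).comp (affLin r) := by
      rw [← this.fderiv]; congr 1
    rw [e2]; rfl
  have l : ∫ z, fderiv ℝ θ z v • (PartialHarmonic.dil r a u) z
      = (r ^ d)⁻¹ • ∫ z, fderiv ℝ θ' z (affLin r v) • u z := by
    rw [← integral_comp_aff hr a fun z => fderiv ℝ θ' z (affLin r v) • u z]
    refine integral_congr_ae ?_
    filter_upwards [coeFn_dil hr a u] with z hz
    rw [hz, e1]
  have r' : ∫ z, θ z • (PartialHarmonic.dil r a g) z = (r ^ d)⁻¹ • ∫ z, θ' z • g z := by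
    rw [← integral_comp_aff hr a fun z => θ' z • g z]
    refine integral_congr_ae ?_
    filter_upwards [coeFn_dil hr a g] with z hz
    rw [hz]
    conv_lhs => rw [e0]
  rw [l, r', h θ' hθ' hs', smul_neg]

theorem affLin_dirX (r : ℝ) (i : Fin d) : affLin r (dirX i) = r • dirX i := by
  simp [affLin, dirX]

theorem affLin_dirY (r : ℝ) : affLin r (dirY d) = dirY d := by
  simp [affLin, dirY]

theorem HasMulY.dil {r : ℝ} (hr : 0 < r) (a : EuclideanSpace ℝ (Fin d)) {u g : L2 d}
    (h : HasMulY u g) : HasMulY (dil r a u) (dil r a g) := by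
  filter_upwards [coeFn_dil hr a u, coeFn_dil hr a g, (quasiMeasurePreserving_aff hr a).ae h]
    with z h1 h2 h3
  rw [h1, h2, h3]; rfl

theorem nonlinearTerm_dil {r : ℝ} (hr : 0 < r) (a : EuclideanSpace ℝ (Fin d)) (α : ℝ) (u : L2 d) :
    nonlinearTerm α (dil r a u) = (r ^ d)⁻¹ * nonlinearTerm α u := by
  rw [nonlinearTerm, nonlinearTerm, ← smul_eq_mul,
    ← integral_comp_aff hr a fun z => ‖u z‖ ^ (α + 2)]
  refine integral_congr_ae ?_
  filter_upwards [coeFn_dil hr a u] with z hz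
  rw [hz]

theorem dil_mem_energySpace {r : ℝ} (hr : 0 < r) (a : EuclideanSpace ℝ (Fin d)) {u : L2 d}
    (hu : u ∈ energySpace d) : dil r a u ∈ energySpace d ∧
      (∀ i, weakDeriv (dirX i) (dil r a u) = dil r a ((r : ℂ) • weakDeriv (dirX i) u)) ∧
      weakDeriv (dirY d) (dil r a u) = dil r a (weakDeriv (dirY d) u) ∧
      mulY (dil r a u) = dil r a (mulY u) := by
  have hu' := mem_energySpace_iff.1 hu
  have hx : ∀ i, HasWeakDeriv (dirX i) (dil r a u) (dil r a ((r : ℂ) • weakDeriv (dirX i) u)) := by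
    intro i
    refine HasWeakDeriv.dil hr a ?_
    rw [affLin_dirX]
    exact (hu'.1 i).dir_smul r
  have hy : HasWeakDeriv (dirY d) (dil r a u) (dil r a (weakDeriv (dirY d) u)) := by
    refine HasWeakDeriv.dil hr a ?_
    rw [affLin_dirY]
    exact hu'.2.1
  have hm := hu'.2.2.dil hr a
  exact ⟨mem_energySpace_of hx hy hm, fun i => (hx i).weakDeriv_eq, hy.weakDeriv_eq, hm.mulY_eq⟩

/-! ### Behaviour of the functionals -/

theorem gradXSq_dil {r : ℝ} (hr : 0 < r) (a : EuclideanSpace ℝ (Fin d)) {u : L2 d}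
    (hu : u ∈ energySpace d) : gradXSq (dil r a u) = (r ^ d)⁻¹ * (r ^ 2 * gradXSq u) := by
  rw [gradXSq, gradXSq, Finset.mul_sum, Finset.mul_sum]
  refine Finset.sum_congr rfl fun i _ => ?_
  rw [(dil_mem_energySpace hr a hu).2.1 i, norm_dil_sq hr, norm_smul, mul_pow, Complex.norm_real,
    Real.norm_eq_abs, sq_abs]

theorem derivYSq_dil {r : ℝ} (hr : 0 < r) (a : EuclideanSpace ℝ (Fin d)) {u : L2 d}
    (hu : u ∈ energySpace d) : derivYSq (dil r a u) = (r ^ d)⁻¹ * derivYSq u := by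
  rw [derivYSq, derivYSq, (dil_mem_energySpace hr a hu).2.2.1, norm_dil_sq hr]

theorem potentialSq_dil {r : ℝ} (hr : 0 < r) (a : EuclideanSpace ℝ (Fin d)) {u : L2 d}
    (hu : u ∈ energySpace d) : potentialSq (dil r a u) = (r ^ d)⁻¹ * potentialSq u := by
  rw [potentialSq_eq hu, potentialSq_eq (dil_mem_energySpace hr a hu).1,
    (dil_mem_energySpace hr a hu).2.2.2, norm_dil_sq hr]

theorem mass_dil {r : ℝ} (hr : 0 < r) (a : EuclideanSpace ℝ (Fin d)) (u : L2 d) :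
    mass (dil r a u) = (r ^ d)⁻¹ * mass u := by
  rw [mass_eq, mass_eq, norm_dil_sq hr]

theorem weakDeriv_smul {v : Space d} (c : ℂ) {u : L2 d} (h : HasWeakDeriv v u (weakDeriv v u)) :
    weakDeriv v (c • u) = c • weakDeriv v u := (h.smul c).weakDeriv_eq

theorem gradXSq_smul (c : ℂ) {u : L2 d} (hu : u ∈ energySpace d) :
    gradXSq (c • u) = ‖c‖ ^ 2 * gradXSq u := by
  rw [gradXSq, gradXSq, Finset.mul_sum]
  refine Finset.sum_congr rfl fun i _ => ?_
  rw [weakDeriv_smul c ((mem_energySpace_iff.1 hu).1 i), norm_smul, mul_pow]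

theorem derivYSq_smul (c : ℂ) {u : L2 d} (hu : u ∈ energySpace d) :
    derivYSq (c • u) = ‖c‖ ^ 2 * derivYSq u := by
  rw [derivYSq, derivYSq, weakDeriv_smul c (mem_energySpace_iff.1 hu).2.1, norm_smul, mul_pow]

theorem potentialSq_smul (c : ℂ) {u : L2 d} (hu : u ∈ energySpace d) :
    potentialSq (c • u) = ‖c‖ ^ 2 * potentialSq u := by
  rw [potentialSq_eq hu, potentialSq_eq (smul_mem_energySpace c hu),
    ((mem_energySpace_iff.1 hu).2.2.smul c).mulY_eq, norm_smul, mul_pow]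

theorem mass_smul (c : ℂ) (u : L2 d) : mass (c • u) = ‖c‖ ^ 2 * mass u := by
  rw [mass_eq, mass_eq, norm_smul, mul_pow]

theorem nonlinearTerm_smul (α : ℝ) (c : ℂ) (u : L2 d) :
    nonlinearTerm α (c • u) = ‖c‖ ^ (α + 2) * nonlinearTerm α u := by
  rw [nonlinearTerm, nonlinearTerm, ← integral_const_mul]
  refine integral_congr_ae ?_
  filter_upwards [Lp.coeFn_smul c u] with z hz
  rw [hz, Pi.smul_apply, norm_smul, Real.mul_rpow (norm_nonneg _) (norm_nonneg _)]

/-- The quadratic form `‖∂_y u‖² + ‖y u‖² + ω ‖u‖²`. -/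
def transForm (ω : ℝ) (u : L2 d) : ℝ := derivYSq u + potentialSq u + ω * mass u

theorem transForm_smul (ω : ℝ) (c : ℂ) {u : L2 d} (hu : u ∈ energySpace d) :
    transForm ω (c • u) = ‖c‖ ^ 2 * transForm ω u := by
  rw [transForm, transForm, derivYSq_smul c hu, potentialSq_smul c hu, mass_smul]; ring

theorem transForm_dil {r : ℝ} (hr : 0 < r) (a : EuclideanSpace ℝ (Fin d)) (ω : ℝ) {u : L2 d}
    (hu : u ∈ energySpace d) : transForm ω (dil r a u) = (r ^ d)⁻¹ * transForm ω u := by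
  rw [transForm, transForm, derivYSq_dil hr a hu, potentialSq_dil hr a hu, mass_dil hr]; ring

theorem gradXSq_nonneg (u : L2 d) : 0 ≤ gradXSq u := by unfold gradXSq; positivity

theorem derivYSq_nonneg (u : L2 d) : 0 ≤ derivYSq u := by unfold derivYSq; positivity

theorem potentialSq_nonneg (u : L2 d) : 0 ≤ potentialSq u :=
  integral_nonneg fun z => by positivity

theorem mass_nonneg (u : L2 d) : 0 ≤ mass u := by rw [mass_eq]; positivity

theorem nonlinearTerm_nonneg (α : ℝ) (u : L2 d) : 0 ≤ nonlinearTerm α u :=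
  integral_nonneg fun z => by positivity

theorem action_eq (α ω : ℝ) (u : L2 d) : action α ω u
    = 1 / 2 * gradXSq u + 1 / 2 * transForm ω u - 1 / (α + 2) * nonlinearTerm α u := by
  rw [action, energy, transForm]; ring

/-- The mass preserving dilation `u ↦ r^(d/2) u (r x, y)`. -/
def scal (r : ℝ) (u : L2 d) : L2 d := ((r ^ ((d : ℝ) / 2) : ℝ) : ℂ) • dil r 0 u

/-- The prefactor `r^(d/2)` compensates the Jacobian in every quadratic term, so only `∇_x` sees the
scale. In the nonlinear term the exponents leave `(α + 2)d/2 - d = αd/2`, which exceeds `2` in the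
mass supercritical range. -/
theorem scal_functionals {r : ℝ} (hr : 0 < r) (α ω : ℝ) {u : L2 d} (hu : u ∈ energySpace d) :
    scal r u ∈ energySpace d ∧ gradXSq (scal r u) = r ^ 2 * gradXSq u ∧
      transForm ω (scal r u) = transForm ω u ∧ mass (scal r u) = mass u ∧
      derivYSq (scal r u) = derivYSq u ∧
      nonlinearTerm α (scal r u) = r ^ (α * d / 2) * nonlinearTerm α u := by
  have h := (dil_mem_energySpace hr 0 hu).1
  have hc : ‖((r ^ ((d : ℝ) / 2) : ℝ) : ℂ)‖ = r ^ ((d : ℝ) / 2) := by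
    rw [Complex.norm_real, Real.norm_eq_abs, abs_of_pos (by positivity)]
  have hc2 : (r ^ ((d : ℝ) / 2)) ^ 2 * (r ^ d)⁻¹ = 1 := by
    rw [← Real.rpow_natCast, ← Real.rpow_mul hr.le, ← Real.rpow_natCast r d]
    norm_num
    rw [mul_inv_cancel₀ (by positivity)]
  refine ⟨smul_mem_energySpace _ h, ?_, ?_, ?_, ?_, ?_⟩
  · rw [scal, gradXSq_smul _ h, gradXSq_dil hr 0 hu, hc, ← mul_assoc, hc2, one_mul]
  · rw [scal, transForm_smul _ _ h, transForm_dil hr 0 ω hu, hc, ← mul_assoc, hc2, one_mul]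
  · rw [scal, mass_smul, mass_dil hr, hc, ← mul_assoc, hc2, one_mul]
  · rw [scal, derivYSq_smul _ h, derivYSq_dil hr 0 hu, hc, ← mul_assoc, hc2, one_mul]
  · rw [scal, nonlinearTerm_smul, nonlinearTerm_dil hr, hc, ← mul_assoc]
    congr 1
    rw [← Real.rpow_mul hr.le, ← Real.rpow_natCast r d, ← Real.rpow_neg hr.le, ← Real.rpow_add hr]
    congr 1
    ring

theorem dil_one_functionals (a : EuclideanSpace ℝ (Fin d)) (α ω : ℝ) {u : L2 d}
    (hu : u ∈ energySpace d) :
    dil 1 a u ∈ energySpace d ∧ gradXSq (dil 1 a u) = gradXSq u ∧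
      transForm ω (dil 1 a u) = transForm ω u ∧
      nonlinearTerm α (dil 1 a u) = nonlinearTerm α u := by
  refine ⟨(dil_mem_energySpace one_pos a hu).1, ?_, ?_, ?_⟩
  · rw [gradXSq_dil one_pos a hu]; simp
  · rw [transForm_dil one_pos a ω hu]; simp
  · rw [nonlinearTerm_dil one_pos]; simp

/-! ### Gagliardo–Nirenberg type bounds -/

/-- The range of parameters: mass supercritical in `x`, energy subcritical in `(x, y)`. -/
structure Admissible (d : ℕ) (α : ℝ) : Prop where
  two_le : 2 ≤ d
  pos : 0 < α
  four_lt : 4 < α * d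
  lt_crit : α + 2 < critExp d

theorem admissible_of {α : ℝ} (hd : 2 ≤ d) (hα₁ : 4 / (d : ℝ) < α)
    (hα₂ : α < 4 / ((d : ℝ) - 1)) : Admissible d α := by
  have hd' : (2 : ℝ) ≤ d := by exact_mod_cast hd
  have h0 : 0 < 4 / (d : ℝ) := by positivity
  refine ⟨hd, h0.trans hα₁, (div_lt_iff₀ (by linarith)).1 hα₁, ?_⟩
  have h1 : critExp d = 4 / ((d : ℝ) - 1) + 2 := by
    have : (d : ℝ) - 1 ≠ 0 := by linarith
    rw [critExp]; field_simp; ring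
  linarith

/-- The left side is a sum of `d + 2` norms, each at most the square root. -/
theorem norm_add_gradNorm_le (u : L2 d) :
    ‖u‖ + gradNorm u ≤ (d + 2) * √(gradXSq u + derivYSq u + mass u) := by
  have hA := gradXSq_nonneg u
  have hD := derivYSq_nonneg u
  have hM := mass_nonneg u
  have h1 : ‖u‖ ≤ √(gradXSq u + derivYSq u + mass u) := by
    refine Real.le_sqrt_of_sq_le ?_
    rw [mass_eq] at *; linarith
  have h2 : ‖weakDeriv (dirY d) u‖ ≤ √(gradXSq u + derivYSq u + mass u) := by
    refine Real.le_sqrt_of_sq_le ?_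
    change derivYSq u ≤ _; linarith
  have h3 : ∀ i : Fin d, ‖weakDeriv (dirX i) u‖ ≤ √(gradXSq u + derivYSq u + mass u) := fun i => by
    refine Real.le_sqrt_of_sq_le ?_
    have : ‖weakDeriv (dirX i) u‖ ^ 2 ≤ gradXSq u :=
      Finset.single_le_sum (f := fun i => ‖weakDeriv (dirX i) u‖ ^ 2)
        (fun i _ => by positivity) (Finset.mem_univ i)
    linarith
  have h4 := Finset.sum_le_sum fun i (_ : i ∈ Finset.univ) => h3 i
  rw [Finset.sum_const, Finset.card_univ, Fintype.card_fin, nsmul_eq_mul] at h4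
  rw [gradNorm]
  linarith

theorem nonlinearTerm_pos (hd : 2 ≤ d) {α : ℝ} (hα : 0 < α) (hq : α + 2 ≤ critExp d) {u : L2 d}
    (hu : u ∈ energySpace d) (h0 : u ≠ 0) : 0 < nonlinearTerm α u := by
  refine (nonlinearTerm_nonneg α u).lt_of_ne' fun h => h0 ?_
  rw [nonlinearTerm, integral_eq_zero_iff_of_nonneg (fun z => by positivity)
    (integrable_norm_rpow hd (by linarith) hq hu)] at h
  refine Lp.ext ?_
  filter_upwards [h, Lp.coeFn_zero ℂ 2 (volume : Measure (Space d))] with z h1 h2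
  rw [h2]
  simp only [Pi.zero_apply] at h1 ⊢
  exact norm_eq_zero.1 ((Real.rpow_eq_zero (norm_nonneg _) (by linarith)).1 h1)

theorem exists_nonlinearTerm_le_norm {α : ℝ} (h : Admissible d α) : ∃ C : ℝ, 0 ≤ C ∧
    ∀ u ∈ energySpace d, nonlinearTerm α u
      ≤ mass u + (C * (‖u‖ + gradNorm u)) ^ critExp d := by
  obtain ⟨C, hC, hS⟩ := exists_integral_critExp_le h.two_le
  refine ⟨C, hC, fun u hu => ?_⟩
  have hi := integrable_norm_rpow h.two_le (by linarith [h.pos]) h.lt_crit.le hu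
  have h1 : nonlinearTerm α u ≤ ∫ z, (‖u z‖ ^ 2 + ‖u z‖ ^ critExp d) := by
    refine integral_mono hi ((integrable_norm_sq u).add (hS u hu).1) fun z => ?_
    have := rpow_le_interp (by linarith [h.pos]) h.lt_crit.le (norm_nonneg (u z)) one_pos
    simpa using this
  rw [integral_add (integrable_norm_sq u) (hS u hu).1] at h1
  exact h1.trans (add_le_add_right (hS u hu).2 _)

theorem exists_nonlinearTerm_le {α : ℝ} (h : Admissible d α) : ∃ C : ℝ, 0 ≤ C ∧
    ∀ u ∈ energySpace d, nonlinearTerm α u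
      ≤ mass u + C * √(gradXSq u + derivYSq u + mass u) ^ critExp d := by
  obtain ⟨C, hC, hS⟩ := exists_nonlinearTerm_le_norm h
  refine ⟨(C * (d + 2)) ^ critExp d, by positivity, fun u hu => ?_⟩
  refine (hS u hu).trans (add_le_add_right ?_ _)
  rw [← Real.mul_rpow (by positivity) (by positivity)]
  refine Real.rpow_le_rpow (mul_nonneg hC (add_nonneg (norm_nonneg _) (gradNorm_nonneg u))) ?_
    (critExp_pos h.two_le).le
  rw [mul_assoc]
  exact mul_le_mul_of_nonneg_left (norm_add_gradNorm_le u) hC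

/-- An anisotropic Gagliardo–Nirenberg inequality, obtained by dilating in `x`. -/
theorem exists_rpow_mul_nonlinearTerm_le {α : ℝ} (h : Admissible d α) : ∃ C : ℝ, 0 ≤ C ∧
    ∀ u ∈ energySpace d, ∀ r : ℝ, 0 < r → r ^ (α * d / 2) * nonlinearTerm α u
      ≤ mass u + C * √(r ^ 2 * gradXSq u + derivYSq u + mass u) ^ critExp d := by
  obtain ⟨C, hC, hN⟩ := exists_nonlinearTerm_le h
  refine ⟨C, hC, fun u hu r hr => ?_⟩
  obtain ⟨h1, h2, -, h3, h4, h5⟩ := scal_functionals hr α 0 hu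
  have := hN _ h1
  rwa [h2, h3, h4, h5] at this

/-- If `‖∇_x u‖` vanished, the right side of the anisotropic inequality would not depend on `r`,
while the left side grows without bound as `r → ∞`. -/
theorem gradXSq_pos {α : ℝ} (h : Admissible d α) {u : L2 d} (hu : u ∈ energySpace d)
    (h0 : u ≠ 0) : 0 < gradXSq u := by
  refine (gradXSq_nonneg u).lt_of_ne' fun hA => ?_
  obtain ⟨C, hC, hN⟩ := exists_rpow_mul_nonlinearTerm_le h
  have hpos := nonlinearTerm_pos h.two_le h.pos h.lt_crit.le hu h0
  have hlim : Tendsto (fun r : ℝ => r ^ (α * d / 2) * nonlinearTerm α u) atTop atTop :=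
    (tendsto_rpow_atTop (by linarith [h.four_lt])).atTop_mul_const hpos
  obtain ⟨r, hr1, hr2⟩ := ((hlim.eventually_gt_atTop
    (mass u + C * √(derivYSq u + mass u) ^ critExp d)).and (eventually_gt_atTop 0)).exists
  have := hN u hu r hr2
  rw [hA, mul_zero, zero_add] at this
  linarith

/-- Optimizing the dilation gives `N ≤ K A^(αd/4)` with `A = ‖∇_x u‖²` and `N` the nonlinear term,
while `Q ≤ 0` gives `A ≤ c N`. As `αd/4 > 1`, the two together bound `A` from below. This excludes
collapse of minimizing sequences. -/
theorem exists_le_gradXSq {α : ℝ} (h : Admissible d α) (R : ℝ) : ∃ δ : ℝ, 0 < δ ∧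
    ∀ u ∈ energySpace d, u ≠ 0 → semivirial α u ≤ 0 → derivYSq u ≤ R → mass u ≤ R →
      δ ≤ gradXSq u := by
  obtain ⟨C, hC, hN⟩ := exists_rpow_mul_nonlinearTerm_le h
  set K : ℝ := |R| + 1 + C * √(1 + R + R) ^ critExp d with hK
  have hK0 : 0 < K := by positivity
  set c : ℝ := α * d / (2 * (α + 2)) with hc
  have hα := h.pos
  have hc0 : 0 < c := by
    have := h.four_lt
    rw [hc]; apply div_pos <;> linarith
  set s : ℝ := α * d / 4 - 1 with hs
  have hs0 : 0 < s := by linarith [h.four_lt]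
  refine ⟨((c * K)⁻¹) ^ (1 / s), by positivity, fun u hu h0 hQ hD hM => ?_⟩
  set A := gradXSq u with hA
  have hA0 : 0 < A := gradXSq_pos h hu h0
  -- The choice `r = A^(-1/2)` normalizes `r² A` to `1`.
  have h1 := hN u hu (A ^ (-(1 / 2) : ℝ)) (by positivity)
  have e1 : (A ^ (-(1 / 2) : ℝ)) ^ 2 * A = 1 := by
    rw [← Real.rpow_natCast, ← Real.rpow_mul hA0.le]
    norm_num
    rw [Real.rpow_neg_one, inv_mul_cancel₀ hA0.ne']
  have e2 : (A ^ (-(1 / 2) : ℝ)) ^ (α * d / 2) = (A ^ (s + 1))⁻¹ := by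
    rw [← Real.rpow_mul hA0.le, ← Real.rpow_neg hA0.le]
    congr 1; rw [hs]; ring
  rw [e1, e2] at h1
  have h2 : mass u + C * √(1 + derivYSq u + mass u) ^ critExp d ≤ K := by
    have h3 : √(1 + derivYSq u + mass u) ^ critExp d ≤ √(1 + R + R) ^ critExp d :=
      Real.rpow_le_rpow (by positivity) (Real.sqrt_le_sqrt (by linarith))
        (critExp_pos h.two_le).le
    have := mul_le_mul_of_nonneg_left h3 hC
    have := le_abs_self R
    rw [hK]; linarith
  have h3 : nonlinearTerm α u ≤ K * A ^ (s + 1) := by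
    have h4 := h1.trans h2
    rwa [inv_mul_le_iff₀ (by positivity), mul_comm] at h4
  have h4 : A ≤ c * nonlinearTerm α u := by
    rw [semivirial] at hQ; linarith
  have h5 : A ≤ c * K * (A ^ s * A) := by
    rw [← Real.rpow_add_one hA0.ne', mul_assoc]
    exact h4.trans (mul_le_mul_of_nonneg_left h3 hc0.le)
  have h6 : (c * K)⁻¹ ≤ A ^ s := by
    rw [inv_le_iff_one_le_mul₀ (by positivity)]
    have : 1 * A ≤ (A ^ s * (c * K)) * A := by linarith
    exact le_of_mul_le_mul_right this hA0
  have h7 := Real.rpow_le_rpow (by positivity) h6 (z := 1 / s) (by positivity)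
  rwa [← Real.rpow_mul hA0.le, mul_one_div_cancel hs0.ne', Real.rpow_one] at h7

/-! ### Non-vanishing -/

theorem IsMollifier.integral_moll_sub_sq_le {ε : ℝ} {ρ : Space d → ℝ} (hρ : IsMollifier ε ρ)
    {u : L2 d} (hu : u ∈ energySpace d) :
    Integrable (fun z => ‖moll ρ u z - u z‖ ^ 2) volume ∧
      ∫ z, ‖moll ρ u z - u z‖ ^ 2 ≤ (ε * gradNorm u) ^ 2 := by
  have hm : AEStronglyMeasurable (fun z => moll ρ u z - u z) volume :=
    (hρ.contDiff_moll u).continuous.aestronglyMeasurable.sub (Lp.aestronglyMeasurable u)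
  have e : ∀ z, ENNReal.ofReal (‖moll ρ u z - u z‖ ^ 2) = ‖moll ρ u z - u z‖ₑ ^ 2 := fun z => by
    rw [ENNReal.ofReal_pow (norm_nonneg _), ofReal_norm]
  have hb := hρ.lintegral_moll_sub_sq_le hu
  constructor
  · refine ⟨hm.norm.pow 2, ?_⟩
    rw [hasFiniteIntegral_iff_ofReal (Eventually.of_forall fun z => by positivity)]
    simp_rw [e]
    exact hb.trans_lt ENNReal.ofReal_lt_top
  · rw [integral_eq_lintegral_of_nonneg_ae (f := fun z => ‖moll ρ u z - u z‖ ^ 2)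
      (Eventually.of_forall fun z => sq_nonneg _) (hm.norm.pow 2)]
    simp_rw [e]
    exact ENNReal.toReal_le_of_le_ofReal (by positivity) hb

/-- Suppose the mollification is everywhere below `s/2`. Where `s ≤ |u| ≤ T` it then differs from
`u` by at least `|u|/2`, so that region is paid for by the `L²` mollification error. Small and large
values of `u` are paid for by the `L²` norm and the critical norm. All three contributions are
small, against the lower bound on the nonlinear term. -/
theorem exists_le_norm_moll {α : ℝ} (h : Admissible d α) (R : ℝ) {δ : ℝ} (hδ : 0 < δ) :
    ∃ ε : ℝ, 0 < ε ∧ ∃ η : ℝ, 0 < η ∧ ∀ ρ : Space d → ℝ, IsMollifier ε ρ → ∀ u ∈ energySpace d,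
      ‖u‖ + gradNorm u ≤ R → δ ≤ nonlinearTerm α u → ∃ z, η ≤ ‖moll ρ u z‖ := by
  obtain ⟨C, hC, hS⟩ := exists_integral_critExp_le h.two_le
  have hα := h.pos
  -- Each of `s`, `T` and `ε` makes one of the three contributions less than `δ / 4`. The
  -- mollification scale `ε` comes last because it depends on `T`.
  obtain ⟨s, hs0, hs⟩ : ∃ s : ℝ, 0 < s ∧ s ^ α * R ^ 2 < δ / 4 := by
    have h1 : Tendsto (fun s : ℝ => s ^ α * R ^ 2) (𝓝[>] 0) (𝓝 (0 ^ α * R ^ 2)) :=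
      (((Real.continuous_rpow_const hα.le).tendsto 0).mono_left nhdsWithin_le_nhds).mul_const _
    rw [Real.zero_rpow hα.ne', zero_mul] at h1
    obtain ⟨s, hs1, hs2⟩ := ((h1.eventually_lt_const (show 0 < δ / 4 by positivity)).and
      self_mem_nhdsWithin).exists
    exact ⟨s, hs2, hs1⟩
  obtain ⟨T, hT0, hT⟩ : ∃ T : ℝ, 0 < T ∧
      T ^ (α + 2 - critExp d) * (C * R) ^ critExp d < δ / 4 := by
    have h1 : Tendsto (fun T : ℝ => T ^ (-(critExp d - (α + 2))) * (C * R) ^ critExp d) atTop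
        (𝓝 (0 * (C * R) ^ critExp d)) :=
      (tendsto_rpow_neg_atTop (by linarith [h.lt_crit])).mul_const _
    rw [zero_mul] at h1
    obtain ⟨T, hT1, hT2⟩ := ((h1.eventually_lt_const (show 0 < δ / 4 by positivity)).and
      (eventually_gt_atTop 0)).exists
    refine ⟨T, hT2, ?_⟩
    rwa [neg_sub] at hT1
  obtain ⟨ε, hε0, hε⟩ : ∃ ε : ℝ, 0 < ε ∧ 4 * T ^ α * (ε * R) ^ 2 < δ / 4 := by
    have h1 : Tendsto (fun ε : ℝ => 4 * T ^ α * (ε * R) ^ 2) (𝓝[>] 0)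
        (𝓝 (4 * T ^ α * (0 * R) ^ 2)) :=
      (Continuous.tendsto (by fun_prop) 0).mono_left nhdsWithin_le_nhds
    rw [zero_mul, zero_pow two_ne_zero, mul_zero] at h1
    obtain ⟨s, hs1, hs2⟩ := ((h1.eventually_lt_const (show 0 < δ / 4 by positivity)).and
      self_mem_nhdsWithin).exists
    exact ⟨s, hs2, hs1⟩
  refine ⟨ε, hε0, s / 2, by positivity, fun ρ hρ u hu hH hN => ?_⟩
  by_contra! hcon
  obtain ⟨hi, hb⟩ := hρ.integral_moll_sub_sq_le hu
  have hpt : ∀ z, ‖u z‖ ^ (α + 2) ≤ s ^ α * ‖u z‖ ^ 2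
      + T ^ (α + 2 - critExp d) * ‖u z‖ ^ critExp d + 4 * T ^ α * ‖moll ρ u z - u z‖ ^ 2 := by
    intro z
    set t := ‖u z‖ with ht
    have ht0 : 0 ≤ t := norm_nonneg _
    have n1 : 0 ≤ s ^ α * t ^ 2 := by positivity
    have n2 : 0 ≤ T ^ (α + 2 - critExp d) * t ^ critExp d := by positivity
    have n3 : 0 ≤ 4 * T ^ α * ‖moll ρ u z - u z‖ ^ 2 := by positivity
    rcases ht0.eq_or_lt with h0 | h0
    · rw [← h0, Real.zero_rpow (by linarith)]
      rw [← h0] at n1 n2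
      linarith
    have e1 : t ^ (α + 2) = t ^ α * t ^ 2 := by
      rw [Real.rpow_add h0]; norm_num
    rcases le_total t s with h1 | h1
    · have := mul_le_mul_of_nonneg_right (Real.rpow_le_rpow ht0 h1 hα.le) (sq_nonneg t)
      linarith
    rcases le_total T t with h2 | h2
    · have e2 : t ^ (α + 2) = t ^ (α + 2 - critExp d) * t ^ critExp d := by
        rw [← Real.rpow_add h0]; norm_num
      have := mul_le_mul_of_nonneg_right (Real.rpow_le_rpow_of_nonpos hT0 h2
        (by linarith [h.lt_crit] : α + 2 - critExp d ≤ 0)) (Real.rpow_nonneg ht0 (critExp d))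
      linarith
    · have h3 : t / 2 ≤ ‖moll ρ u z - u z‖ := by
        have := norm_sub_norm_le (u z) (moll ρ u z)
        rw [norm_sub_rev] at this
        have := hcon z
        linarith
      have h4 : t ^ 2 ≤ 4 * ‖moll ρ u z - u z‖ ^ 2 := by
        have := pow_le_pow_left₀ (by positivity) h3 2
        linarith [this, div_pow t 2 2]
      have h5 : t ^ α * t ^ 2 ≤ T ^ α * (4 * ‖moll ρ u z - u z‖ ^ 2) :=
        mul_le_mul (Real.rpow_le_rpow ht0 h2 hα.le) h4 (by positivity) (by positivity)
      linarith
  have i1 := (integrable_norm_sq u).const_mul (s ^ α)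
  have i2 := (hS u hu).1.const_mul (T ^ (α + 2 - critExp d))
  have i3 := hi.const_mul (4 * T ^ α)
  have hint : nonlinearTerm α u ≤ s ^ α * ‖u‖ ^ 2
      + T ^ (α + 2 - critExp d) * (∫ z, ‖u z‖ ^ critExp d)
      + 4 * T ^ α * ∫ z, ‖moll ρ u z - u z‖ ^ 2 := by
    have := integral_mono (integrable_norm_rpow h.two_le (by linarith) h.lt_crit.le hu)
      ((i1.add i2).add i3) hpt
    rw [integral_add' (i1.add i2) i3, integral_add' i1 i2, integral_const_mul, integral_const_mul,
      integral_const_mul, ← norm_sq_eq_integral] at this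
    exact this
  have hg := gradNorm_nonneg u
  have hn := norm_nonneg u
  have b1 : s ^ α * ‖u‖ ^ 2 ≤ s ^ α * R ^ 2 :=
    mul_le_mul_of_nonneg_left (pow_le_pow_left₀ hn (by linarith) 2) (by positivity)
  have b2 : T ^ (α + 2 - critExp d) * (∫ z, ‖u z‖ ^ critExp d)
      ≤ T ^ (α + 2 - critExp d) * (C * R) ^ critExp d :=
    mul_le_mul_of_nonneg_left ((hS u hu).2.trans (Real.rpow_le_rpow (by positivity)
      (mul_le_mul_of_nonneg_left hH hC) (critExp_pos h.two_le).le)) (by positivity)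
  have b3 : 4 * T ^ α * ∫ z, ‖moll ρ u z - u z‖ ^ 2 ≤ 4 * T ^ α * (ε * R) ^ 2 :=
    mul_le_mul_of_nonneg_left (hb.trans (pow_le_pow_left₀ (by positivity)
      (mul_le_mul_of_nonneg_left (by linarith) hε0.le) 2)) (by positivity)
  linarith

/-! ### Almost everywhere convergence of weakly convergent sequences -/

/-- A substitute for local Rellich compactness: in `L²` with a positive integrable weight the
sequence tends to `0`. Its mollifications converge pointwise and boundedly, while the mollification
error is uniformly small by the gradient bound. -/
theorem exists_subseq_tendsto_ae {R : ℝ} {w : ℕ → L2 d} (hw : ∀ n, w n ∈ energySpace d)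
    (hb : ∀ n, ‖w n‖ + gradNorm (w n) ≤ R) (hlim : WeakTendsto w 0) :
    ∃ s : ℕ → ℕ, StrictMono s ∧ ∀ᵐ z, Tendsto (fun n => w (s n) z) atTop (𝓝 0) := by
  have hR : 0 ≤ R := (add_nonneg (norm_nonneg _) (gradNorm_nonneg _)).trans (hb 0)
  obtain ⟨g, hg0, hgm, hg1⟩ :=
    exists_pos_lintegral_lt_of_sigmaFinite (volume : Measure (Space d)) (one_ne_zero (α := ℝ≥0∞))
  -- The weight is integrable for dominated convergence, at most `1` so that weighted errors are
  -- bounded by unweighted ones, and nowhere zero so that its null sets are Lebesgue null.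
  let k : Space d → ℝ≥0∞ := fun z => min (g z) 1
  have hkm : Measurable k := hgm.coe_nnreal_ennreal.min measurable_const
  have hk0 : ∀ z, k z ≠ 0 := fun z => by
    simp only [k, ne_eq, min_eq_bot, ← bot_eq_zero]
    simp [(hg0 z).ne']
  have hkint : ∫⁻ z, k z ≠ ⊤ :=
    ((lintegral_mono fun z => min_le_left _ _).trans_lt (hg1.trans ENNReal.one_lt_top)).ne
  let ν : Measure (Space d) := volume.withDensity k
  have hν : ∀ f : Space d → ℂ, Measurable f → ∫⁻ z, ‖f z‖ₑ ^ 2 ∂ν = ∫⁻ z, k z * ‖f z‖ₑ ^ 2 :=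
    fun f hf => lintegral_withDensity_eq_lintegral_mul _ hkm (hf.enorm.pow_const 2)
  have key : Tendsto (fun n => ∫⁻ z, ‖w n z‖ₑ ^ 2 ∂ν) atTop (𝓝 0) := by
    rw [ENNReal.tendsto_nhds_zero]
    intro η hη
    obtain ⟨ε, hε0, hε⟩ : ∃ ε : ℝ, 0 < ε ∧ 2 * ENNReal.ofReal ((ε * R) ^ 2) ≤ η / 2 := by
      have h1 : Tendsto (fun ε : ℝ => 2 * ENNReal.ofReal ((ε * R) ^ 2)) (𝓝[>] 0) (𝓝 0) := by
        have h2 : Tendsto (fun ε : ℝ => ENNReal.ofReal ((ε * R) ^ 2)) (𝓝[>] 0)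
            (𝓝 (ENNReal.ofReal ((0 * R) ^ 2))) :=
          ENNReal.tendsto_ofReal
            ((Continuous.tendsto (by fun_prop) 0).mono_left nhdsWithin_le_nhds)
        have h3 := ENNReal.Tendsto.const_mul (a := 2) h2 (Or.inr (by simp))
        simpa using h3
      obtain ⟨s, hs1, hs2⟩ := ((ENNReal.tendsto_nhds_zero.1 h1 (η / 2)
        (ENNReal.half_pos hη.ne')).and self_mem_nhdsWithin).exists
      exact ⟨s, hs2, hs1⟩
    obtain ⟨ρ, hρ⟩ := exists_isMollifier d hε0
    obtain ⟨C, hC⟩ : ∃ C : ℝ, ∀ n z, ‖moll ρ (w n) z‖ ≤ C := by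
      refine ⟨‖realL2 ρ‖ * R, fun n z => ?_⟩
      exact (norm_moll_le hρ.contDiff.continuous hρ.hasCompactSupport _ _).trans
        (mul_le_mul_of_nonneg_left ((le_add_of_nonneg_right (gradNorm_nonneg _)).trans (hb n))
          (norm_nonneg _))
    have hmm : ∀ n, Measurable (moll ρ (w n)) := fun n =>
      (hρ.contDiff_moll (w n)).continuous.measurable
    have h1 : Tendsto (fun n => ∫⁻ z, k z * ‖moll ρ (w n) z‖ₑ ^ 2) atTop
        (𝓝 (∫⁻ z : Space d, 0)) := by
      refine tendsto_lintegral_of_dominated_convergence (fun z => k z * ENNReal.ofReal C ^ 2)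
        (fun n => hkm.mul ((hmm n).enorm.pow_const 2)) (fun n => Eventually.of_forall fun z => ?_)
        ?_ (Eventually.of_forall fun z => ?_)
      · refine mul_le_mul_right (pow_le_pow_left' ?_ 2) _
        rw [← ofReal_norm]
        exact ENNReal.ofReal_le_ofReal (hC n z)
      · rw [lintegral_mul_const _ hkm]
        exact ENNReal.mul_ne_top hkint (by simp)
      · have h2 : Tendsto (fun n => moll ρ (w n) z) atTop (𝓝 0) := by
          simp_rw [moll_eq_inner hρ.contDiff.continuous hρ.hasCompactSupport]
          have := hlim (realL2 fun t => ρ (z - t))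
          rwa [inner_zero_right] at this
        have h3 := ((ENNReal.continuous_pow 2).tendsto _).comp h2.enorm
        have h4 := ENNReal.Tendsto.const_mul (a := k z) h3
          (Or.inr (((min_le_right _ _).trans_lt ENNReal.one_lt_top).ne))
        simpa using h4
    rw [lintegral_zero] at h1
    have h2 := ENNReal.Tendsto.const_mul (a := 2) h1 (Or.inr (by simp))
    rw [mul_zero] at h2
    filter_upwards [ENNReal.tendsto_nhds_zero.1 h2 (η / 2) (ENNReal.half_pos hη.ne')] with n hn
    rw [hν _ (IsMollifier.measurable_coe (w n))]
    calc ∫⁻ z, k z * ‖w n z‖ₑ ^ 2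
        ≤ ∫⁻ z, (2 * ‖moll ρ (w n) z - w n z‖ₑ ^ 2 + 2 * (k z * ‖moll ρ (w n) z‖ₑ ^ 2)) := by
          refine lintegral_mono fun z => ?_
          have e1 : ‖w n z‖ₑ ^ 2 ≤ 2 * (‖moll ρ (w n) z - w n z‖ₑ ^ 2 + ‖moll ρ (w n) z‖ₑ ^ 2) := by
            have e2 : ‖w n z‖ₑ ≤ ‖moll ρ (w n) z - w n z‖ₑ + ‖moll ρ (w n) z‖ₑ := by
              have := enorm_sub_le (E := ℂ) (a := moll ρ (w n) z) (b := moll ρ (w n) z - w n z)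
              rw [sub_sub_cancel, add_comm] at this
              exact this
            refine (pow_le_pow_left' e2 2).trans ?_
            have := ENNReal.rpow_add_le_mul_rpow_add_rpow ‖moll ρ (w n) z - w n z‖ₑ
              ‖moll ρ (w n) z‖ₑ (p := 2) (by norm_num)
            norm_num at this
            exact this
          calc k z * ‖w n z‖ₑ ^ 2
              ≤ k z * (2 * (‖moll ρ (w n) z - w n z‖ₑ ^ 2 + ‖moll ρ (w n) z‖ₑ ^ 2)) :=
                mul_le_mul_right e1 _
            _ = k z * (2 * ‖moll ρ (w n) z - w n z‖ₑ ^ 2) + 2 * (k z * ‖moll ρ (w n) z‖ₑ ^ 2) := by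
                ring
            _ ≤ _ := add_le_add_left (mul_le_of_le_one_left' (min_le_right _ _)) _
      _ = 2 * (∫⁻ z, ‖moll ρ (w n) z - w n z‖ₑ ^ 2) + 2 * ∫⁻ z, k z * ‖moll ρ (w n) z‖ₑ ^ 2 := by
          rw [lintegral_add_left, lintegral_const_mul, lintegral_const_mul]
          · exact hkm.mul ((hmm n).enorm.pow_const 2)
          · exact ((hmm n).sub (IsMollifier.measurable_coe (w n))).enorm.pow_const 2
          · exact (((hmm n).sub (IsMollifier.measurable_coe (w n))).enorm.pow_const 2).const_mul 2
      _ ≤ η / 2 + η / 2 := by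
          refine add_le_add (le_trans (mul_le_mul_right
            ((hρ.lintegral_moll_sub_sq_le (hw n)).trans (ENNReal.ofReal_le_ofReal ?_)) _) hε) hn
          exact pow_le_pow_left₀ (mul_nonneg hε0.le (gradNorm_nonneg _))
            (mul_le_mul_of_nonneg_left ((le_add_of_nonneg_left (norm_nonneg _)).trans (hb n))
              hε0.le) 2
      _ = η := ENNReal.add_halves η
  have hL2 : Tendsto (fun n => eLpNorm ((w n : Space d → ℂ) - 0) 2 ν) atTop (𝓝 0) := by
    have h1 := ((ENNReal.continuous_rpow_const (y := 1 / 2)).tendsto 0).comp key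
    rw [ENNReal.zero_rpow_of_pos (by norm_num)] at h1
    refine h1.congr fun n => ?_
    rw [sub_zero, eLpNorm_eq_lintegral_rpow_enorm_toReal (by simp) (by simp)]
    simp
  obtain ⟨s, hs, hae⟩ := (tendstoInMeasure_of_tendsto_eLpNorm (by simp)
    (fun n => (IsMollifier.measurable_coe (w n)).aestronglyMeasurable)
    aestronglyMeasurable_zero hL2).exists_seq_tendsto_ae
  refine ⟨s, hs, ?_⟩
  have hac : (volume : Measure (Space d)) ≪ ν :=
    withDensity_absolutelyContinuous' hkm.aemeasurable (Eventually.of_forall hk0)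
  exact hac.ae_le hae

/-! ### The Brezis–Lieb lemma -/

/-- If `‖b‖ ≤ η‖a‖`, continuity of the power at `1` makes the change a fraction `ε` of `‖a‖ ^ p`.
Otherwise both powers are controlled by `‖b‖ ^ p`. -/
theorem exists_abs_rpow_norm_add_sub_le {p ε : ℝ} (hp : 0 < p) (hε : 0 < ε) : ∃ C : ℝ, 0 ≤ C ∧
    ∀ a b : ℂ, |‖a + b‖ ^ p - ‖a‖ ^ p| ≤ ε * ‖a‖ ^ p + C * ‖b‖ ^ p := by
  obtain ⟨η, hη0, hη1, hη2, hη3⟩ : ∃ η : ℝ, 0 < η ∧ η < 1 ∧ (1 + η) ^ p < 1 + ε ∧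
      1 - ε < (1 - η) ^ p := by
    have h1 : Tendsto (fun η : ℝ => (1 + η) ^ p) (𝓝[>] 0) (𝓝 ((1 + 0) ^ p)) :=
      (((Real.continuous_rpow_const hp.le).comp (continuous_const.add continuous_id)).tendsto
        0).mono_left nhdsWithin_le_nhds
    have h2 : Tendsto (fun η : ℝ => (1 - η) ^ p) (𝓝[>] 0) (𝓝 ((1 - 0) ^ p)) :=
      (((Real.continuous_rpow_const hp.le).comp (continuous_const.sub continuous_id)).tendsto
        0).mono_left nhdsWithin_le_nhds
    rw [add_zero, Real.one_rpow] at h1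
    rw [sub_zero, Real.one_rpow] at h2
    obtain ⟨η, h3, h4, h5, h6⟩ := ((h1.eventually_lt_const (show 1 < 1 + ε by linarith)).and
      ((h2.eventually_const_lt (show 1 - ε < 1 by linarith)).and (Ioo_mem_nhdsGT (zero_lt_one (α := ℝ))))).exists
    exact ⟨η, h5, h6, h3, h4⟩
  refine ⟨(1 + 1 / η) ^ p, by positivity, fun a b => ?_⟩
  have ha := norm_nonneg a
  have hb := norm_nonneg b
  have t1 : ‖a + b‖ ≤ ‖a‖ + ‖b‖ := norm_add_le a b
  have t2 : ‖a‖ - ‖b‖ ≤ ‖a + b‖ := by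
    have := norm_sub_le (a + b) b
    rw [add_sub_cancel_right] at this
    linarith
  have hap : 0 ≤ ‖a‖ ^ p := by positivity
  have hbp : 0 ≤ ‖b‖ ^ p := by positivity
  rcases le_total ‖b‖ (η * ‖a‖) with h | h
  · have u1 : ‖a + b‖ ^ p ≤ (1 + η) ^ p * ‖a‖ ^ p := by
      rw [← Real.mul_rpow (by linarith) ha]
      exact Real.rpow_le_rpow (norm_nonneg _) (by linarith) hp.le
    have u2 : (1 - η) ^ p * ‖a‖ ^ p ≤ ‖a + b‖ ^ p := by
      rw [← Real.mul_rpow (by linarith) ha]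
      exact Real.rpow_le_rpow (mul_nonneg (by linarith) ha) (by linarith) hp.le
    have u3 := mul_le_mul_of_nonneg_right hη2.le hap
    have u4 := mul_le_mul_of_nonneg_right hη3.le hap
    have u5 : 0 ≤ (1 + 1 / η) ^ p * ‖b‖ ^ p := by positivity
    rw [abs_le]
    constructor <;> linarith
  · have h' : ‖a‖ ≤ 1 / η * ‖b‖ := by
      rw [one_div, ← div_eq_inv_mul, le_div_iff₀ hη0]
      linarith
    have u1 : ‖a + b‖ ^ p ≤ (1 + 1 / η) ^ p * ‖b‖ ^ p := by
      rw [← Real.mul_rpow (by positivity) hb]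
      exact Real.rpow_le_rpow (norm_nonneg _) (by linarith) hp.le
    have u2 : ‖a‖ ^ p ≤ (1 + 1 / η) ^ p * ‖b‖ ^ p := by
      rw [← Real.mul_rpow (by positivity) hb]
      exact Real.rpow_le_rpow ha (by linarith) hp.le
    have u3 : 0 ≤ ‖a + b‖ ^ p := by positivity
    have u4 : 0 ≤ ε * ‖a‖ ^ p := by positivity
    rw [abs_le]
    constructor <;> linarith

/-- The defect `g` tends to `0` almost everywhere but has no integrable majorant. What exceeds `ε‖w
n‖ ^ p` does have one, a multiple of `‖f‖ ^ p`, and the amount removed has integral at most `ε K`.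
-/
theorem tendsto_integral_norm_add_rpow_sub {X : Type*} [MeasurableSpace X] {μ : Measure X}
    {p K : ℝ} (hp : 0 < p) {w : ℕ → X → ℂ} {f : X → ℂ}
    (hw : ∀ n, Integrable (fun z => ‖w n z‖ ^ p) μ) (hf : Integrable (fun z => ‖f z‖ ^ p) μ)
    (hwf : ∀ n, Integrable (fun z => ‖w n z + f z‖ ^ p) μ)
    (hK : ∀ n, ∫ z, ‖w n z‖ ^ p ∂μ ≤ K)
    (hlim : ∀ᵐ z ∂μ, Tendsto (fun n => w n z) atTop (𝓝 0)) :
    Tendsto (fun n => ∫ z, ‖w n z + f z‖ ^ p ∂μ - ∫ z, ‖w n z‖ ^ p ∂μ) atTop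
      (𝓝 (∫ z, ‖f z‖ ^ p ∂μ)) := by
  have hcp := Real.continuous_rpow_const hp.le
  have hK0 : 0 ≤ K := (integral_nonneg fun z => by positivity).trans (hK 0)
  let g : ℕ → X → ℝ := fun n z => ‖w n z + f z‖ ^ p - ‖w n z‖ ^ p - ‖f z‖ ^ p
  have hgi : ∀ n, Integrable (g n) μ := fun n => ((hwf n).sub (hw n)).sub hf
  have hgae : ∀ᵐ z ∂μ, Tendsto (fun n => g n z) atTop (𝓝 0) := by
    filter_upwards [hlim] with z hz
    have h1 : Tendsto (fun n => ‖w n z + f z‖ ^ p) atTop (𝓝 (‖0 + f z‖ ^ p)) :=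
      (hcp.tendsto _).comp (hz.add_const _).norm
    have h2 : Tendsto (fun n => ‖w n z‖ ^ p) atTop (𝓝 (‖(0 : ℂ)‖ ^ p)) :=
      (hcp.tendsto _).comp hz.norm
    have h3 := (h1.sub h2).sub_const (‖f z‖ ^ p)
    simpa [Real.zero_rpow hp.ne'] using h3
  have key : Tendsto (fun n => ∫ z, |g n z| ∂μ) atTop (𝓝 0) := by
    rw [Metric.tendsto_atTop]
    intro e he
    -- Makes `ε K ≤ e / 2`; the `+ 1` covers `K = 0`.
    set ε : ℝ := e / (2 * (K + 1)) with hε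
    have hε0 : 0 < ε := by positivity
    obtain ⟨C, hC, hCb⟩ := exists_abs_rpow_norm_add_sub_le hp hε0
    let W : ℕ → X → ℝ := fun n z => max (|g n z| - ε * ‖w n z‖ ^ p) 0
    have hWi : ∀ n, Integrable (W n) μ := fun n =>
      ((hgi n).abs.sub ((hw n).const_mul ε)).pos_part
    have hW0 : Tendsto (fun n => ∫ z, W n z ∂μ) atTop (𝓝 (∫ _, (0 : ℝ) ∂μ)) := by
      refine tendsto_integral_of_dominated_convergence (fun z => (C + 1) * ‖f z‖ ^ p)
        (fun n => (hWi n).aestronglyMeasurable) (hf.const_mul _)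
        (fun n => Eventually.of_forall fun z => ?_) ?_
      · rw [Real.norm_eq_abs, abs_of_nonneg (le_max_right _ _)]
        refine max_le ?_ (by positivity)
        have h1 := hCb (w n z) (f z)
        have h2 : |g n z| ≤ |‖w n z + f z‖ ^ p - ‖w n z‖ ^ p| + |‖f z‖ ^ p| := abs_sub _ _
        rw [abs_of_nonneg (show 0 ≤ ‖f z‖ ^ p by positivity)] at h2
        linarith
      · filter_upwards [hgae, hlim] with z h1 h2
        have h3 : Tendsto (fun n => ‖w n z‖ ^ p) atTop (𝓝 (‖(0 : ℂ)‖ ^ p)) :=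
          (hcp.tendsto _).comp h2.norm
        have h4 := (h1.abs.sub (h3.const_mul ε)).max (tendsto_const_nhds (x := (0 : ℝ)))
        simpa [Real.zero_rpow hp.ne'] using h4
    rw [integral_zero] at hW0
    obtain ⟨n₀, hn₀⟩ := Metric.tendsto_atTop.1 hW0 (e / 2) (by positivity)
    refine ⟨n₀, fun n hn => ?_⟩
    have h1 := hn₀ n hn
    rw [Real.dist_eq, sub_zero] at h1 ⊢
    rw [abs_of_nonneg (integral_nonneg fun z => abs_nonneg _)]
    have h2 : ∫ z, |g n z| ∂μ ≤ ∫ z, (W n z + ε * ‖w n z‖ ^ p) ∂μ := by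
      refine integral_mono (hgi n).abs ((hWi n).add ((hw n).const_mul ε)) fun z => ?_
      have := le_max_left (|g n z| - ε * ‖w n z‖ ^ p) 0
      simp only [W]
      linarith
    rw [integral_add (hWi n) ((hw n).const_mul ε), integral_const_mul] at h2
    have h3 : ε * ∫ z, ‖w n z‖ ^ p ∂μ ≤ ε * K := mul_le_mul_of_nonneg_left (hK n) hε0.le
    have h4 : ε * K ≤ e / 2 := by
      rw [hε, div_mul_eq_mul_div, div_le_div_iff₀ (by positivity) (by positivity)]
      nlinarith
    have h5 := le_abs_self (∫ z, W n z ∂μ)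
    linarith
  have h0 : Tendsto (fun n => ∫ z, g n z ∂μ) atTop (𝓝 0) :=
    squeeze_zero_norm (fun n => norm_integral_le_integral_norm _) key
  have h1 := h0.add_const (∫ z, ‖f z‖ ^ p ∂μ)
  rw [zero_add] at h1
  refine h1.congr fun n => ?_
  simp only [g]
  have e := integral_sub ((hwf n).sub (hw n)) hf
  simp only [Pi.sub_apply] at e
  rw [e, integral_sub (hwf n) (hw n)]
  ring

theorem tendsto_nonlinearTerm_sub {α : ℝ} (h : Admissible d α) {v : ℕ → L2 d} {u : L2 d} {R : ℝ}
    (hv : ∀ n, v n ∈ energySpace d) (hu : u ∈ energySpace d)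
    (hb : ∀ n, ‖v n - u‖ + gradNorm (v n - u) ≤ R)
    (hlim : ∀ᵐ z, Tendsto (fun n => (v n - u) z) atTop (𝓝 0)) :
    Tendsto (fun n => nonlinearTerm α (v n) - nonlinearTerm α (v n - u)) atTop
      (𝓝 (nonlinearTerm α u)) := by
  have hα := h.pos
  obtain ⟨C, hC, hN⟩ := exists_nonlinearTerm_le_norm h
  have hI : ∀ w ∈ energySpace d, Integrable (fun z => ‖w z‖ ^ (α + 2)) volume := fun w hw =>
    integrable_norm_rpow h.two_le (by linarith) h.lt_crit.le hw
  have e : ∀ n, (fun z => ‖v n z‖ ^ (α + 2)) =ᵐ[volume]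
      fun z => ‖(v n - u) z + u z‖ ^ (α + 2) := fun n => by
    filter_upwards [Lp.coeFn_sub (v n) u] with z hz
    rw [hz, Pi.sub_apply, sub_add_cancel]
  have key := tendsto_integral_norm_add_rpow_sub (μ := volume) (p := α + 2)
    (K := R ^ 2 + (C * R) ^ critExp d) (by linarith)
    (w := fun n z => (v n - u) z) (f := u) (fun n => hI _ (sub_mem_energySpace (hv n) hu)) (hI u hu)
    (fun n => (hI _ (hv n)).congr (e n)) (fun n => ?_) hlim
  · refine key.congr fun n => ?_
    rw [nonlinearTerm, nonlinearTerm, integral_congr_ae (e n)]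
  · have hg := gradNorm_nonneg (v n - u)
    refine (hN _ (sub_mem_energySpace (hv n) hu)).trans (add_le_add ?_ ?_)
    · rw [mass_eq]
      exact pow_le_pow_left₀ (norm_nonneg _) (by linarith [hb n]) 2
    · exact Real.rpow_le_rpow (mul_nonneg hC (add_nonneg (norm_nonneg _) hg))
        (mul_le_mul_of_nonneg_left (hb n) hC) (critExp_pos h.two_le).le

/-! ### The reduced action -/

/-- The value of the action on the constraint set, as a quadratic form. -/
def redAction (α ω : ℝ) (u : L2 d) : ℝ :=
  (1 / 2 - 2 / (α * d)) * gradXSq u + 1 / 2 * transForm ω u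

/-- The factor `2 / (αd)` is the one for which the nonlinear terms of the action and of `Q` cancel.
On the constraint the action therefore equals its quadratic part. -/
theorem action_eq_redAction {α : ℝ} (h : Admissible d α) (ω : ℝ) (u : L2 d) :
    action α ω u = redAction α ω u + 2 / (α * d) * semivirial α u := by
  have h0 : α ≠ 0 := h.pos.ne'
  have h1 : (d : ℝ) ≠ 0 := by
    have := h.two_le
    positivity
  have h2 : α + 2 ≠ 0 := by linarith [h.pos]
  rw [action_eq, redAction, semivirial]
  field_simp
  ring

theorem redAction_coeff_pos {α : ℝ} (h : Admissible d α) : 0 < 1 / 2 - 2 / (α * d) := by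
  have := h.four_lt
  rw [sub_pos, div_lt_div_iff₀ (by linarith) (by norm_num)]
  linarith

theorem virial_coeff_pos {α : ℝ} (h : Admissible d α) : 0 < α * d / (2 * (α + 2)) := by
  have := h.four_lt
  have := h.pos
  apply div_pos <;> linarith

theorem transForm_nonneg {ω : ℝ} (hω : 0 < ω) (u : L2 d) : 0 ≤ transForm ω u := by
  have := derivYSq_nonneg u
  have := potentialSq_nonneg u
  have := mul_nonneg hω.le (mass_nonneg u)
  unfold transForm; linarith

theorem redAction_nonneg {α ω : ℝ} (h : Admissible d α) (hω : 0 < ω) (u : L2 d) :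
    0 ≤ redAction α ω u := by
  have := mul_nonneg (redAction_coeff_pos h).le (gradXSq_nonneg u)
  have := transForm_nonneg hω u
  unfold redAction; linarith

theorem redAction_pos {α ω : ℝ} (h : Admissible d α) (hω : 0 < ω) {u : L2 d} (hu : u ≠ 0) :
    0 < redAction α ω u := by
  have h1 := mul_nonneg (redAction_coeff_pos h).le (gradXSq_nonneg u)
  have h2 : 0 < mass u := by rw [mass_eq]; have := norm_pos_iff.2 hu; positivity
  have h3 := mul_pos hω h2
  have h4 := derivYSq_nonneg u
  have h5 := potentialSq_nonneg u
  unfold redAction transForm; linarith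

theorem redAction_smul (α ω : ℝ) (c : ℂ) {u : L2 d} (hu : u ∈ energySpace d) :
    redAction α ω (c • u) = ‖c‖ ^ 2 * redAction α ω u := by
  rw [redAction, redAction, gradXSq_smul c hu, transForm_smul ω c hu]; ring

theorem bddBelow_action {α ω : ℝ} (h : Admissible d α) (hω : 0 < ω) :
    BddBelow (action α ω '' constraintSet d α) := by
  refine ⟨0, ?_⟩
  rintro _ ⟨u, hu, rfl⟩
  rw [action_eq_redAction h, hu.2.2, mul_zero, add_zero]
  exact redAction_nonneg h hω u

theorem minAction_le {α ω : ℝ} (h : Admissible d α) (hω : 0 < ω) {u : L2 d}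
    (hu : u ∈ constraintSet d α) : minAction d α ω ≤ redAction α ω u := by
  have h1 := csInf_le (bddBelow_action h hω) (Set.mem_image_of_mem _ hu)
  rwa [action_eq_redAction h, hu.2.2, mul_zero, add_zero] at h1

/-- Every nonzero element of the energy space has a positive multiple in the constraint set. -/
theorem exists_smul_mem_constraintSet {α : ℝ} (h : Admissible d α) {u : L2 d}
    (hu : u ∈ energySpace d) (h0 : u ≠ 0) : ∃ t : ℝ, 0 < t ∧ (t : ℂ) • u ∈ constraintSet d α ∧
      (semivirial α u ≤ 0 → t ≤ 1) := by
  have hA := gradXSq_pos h hu h0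
  have hN := nonlinearTerm_pos h.two_le h.pos h.lt_crit.le hu h0
  have hc := virial_coeff_pos h
  set c := α * d / (2 * (α + 2)) with hcdef
  have hα := h.pos
  -- Solves `t² ‖∇_x u‖² = c t^(α+2) N`, with `N` the nonlinear term; `Q(u) ≤ 0` says that the
  -- quotient is at most `1`.
  set t : ℝ := (gradXSq u / (c * nonlinearTerm α u)) ^ (1 / α) with ht
  have hq : 0 < gradXSq u / (c * nonlinearTerm α u) := by positivity
  have ht0 : 0 < t := by positivity
  have htα : t ^ α = gradXSq u / (c * nonlinearTerm α u) := by
    rw [ht, ← Real.rpow_mul hq.le, one_div_mul_cancel hα.ne', Real.rpow_one]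
  refine ⟨t, ht0, ⟨smul_mem_energySpace _ hu, ?_, ?_⟩, fun hQ => ?_⟩
  · exact smul_ne_zero (by exact_mod_cast ht0.ne') h0
  · rw [semivirial, gradXSq_smul _ hu, nonlinearTerm_smul, Complex.norm_real, Real.norm_eq_abs,
      abs_of_pos ht0, Real.rpow_add ht0, htα, ← hcdef, Real.rpow_two]
    field_simp
    ring
  · rw [semivirial, ← hcdef] at hQ
    refine Real.rpow_le_one hq.le ?_ (by positivity)
    rw [div_le_one (by positivity)]
    linarith

/-- Relaxing the constraint to `Q ≤ 0` does not lower the infimum: the factor `t ≤ 1` leading back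
to `Q = 0` only decreases a nonnegative quadratic form. Weak limits and moduli are only known to
satisfy this inequality. -/
theorem minAction_le_of_semivirial_nonpos {α ω : ℝ} (h : Admissible d α) (hω : 0 < ω) {u : L2 d}
    (hu : u ∈ energySpace d) (h0 : u ≠ 0) (hQ : semivirial α u ≤ 0) :
    minAction d α ω ≤ redAction α ω u := by
  obtain ⟨t, ht0, htK, ht1⟩ := exists_smul_mem_constraintSet h hu h0
  refine (minAction_le h hω htK).trans ?_
  rw [redAction_smul _ _ _ hu, Complex.norm_real, Real.norm_eq_abs, abs_of_pos ht0]
  exact mul_le_of_le_one_left (redAction_nonneg h hω u) (pow_le_one₀ ht0.le (ht1 hQ))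

theorem exists_minimizer_of_le {α ω : ℝ} (h : Admissible d α) (hω : 0 < ω) {u : L2 d}
    (hu : u ∈ energySpace d) (h0 : u ≠ 0) (hQ : semivirial α u ≤ 0)
    (hle : redAction α ω u ≤ minAction d α ω) : ∃ t : ℝ, 0 < t ∧
      (t : ℂ) • u ∈ constraintSet d α ∧ redAction α ω ((t : ℂ) • u) = minAction d α ω := by
  obtain ⟨t, ht0, htK, ht1⟩ := exists_smul_mem_constraintSet h hu h0
  refine ⟨t, ht0, htK, le_antisymm ?_ (minAction_le h hω htK)⟩
  rw [redAction_smul _ _ _ hu, Complex.norm_real, Real.norm_eq_abs, abs_of_pos ht0]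
  exact (mul_le_of_le_one_left (redAction_nonneg h hω u) (pow_le_one₀ ht0.le (ht1 hQ))).trans hle

open scoped ContDiff in
theorem constraintSet_nonempty {α : ℝ} (h : Admissible d α) : (constraintSet d α).Nonempty := by
  let b : ContDiffBump (0 : Space d) := ⟨1, 2, by norm_num, by norm_num⟩
  have hb : ContDiff ℝ ∞ b := b.contDiff
  have h0 : realL2 b ≠ 0 := by
    intro h0
    have h4 := coeFn_realL2 b.continuous b.hasCompactSupport
    rw [h0] at h4
    have h5 : (fun z => (b z : ℂ)) =ᵐ[volume] fun _ => 0 := by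
      filter_upwards [h4, Lp.coeFn_zero ℂ 2 (volume : Measure (Space d))] with z h1 h2
      rw [← h1, h2]; rfl
    have h6 := (Continuous.ae_eq_iff_eq volume (Complex.continuous_ofReal.comp b.continuous)
      continuous_const).1 h5
    have h7 := congrFun h6 0
    have h8 : b (0 : Space d) = 1 := b.one_of_mem_closedBall (by simp [b])
    simp [h8] at h7
  obtain ⟨t, -, ht, -⟩ := exists_smul_mem_constraintSet h
    (realL2_mem_energySpace hb b.hasCompactSupport) h0
  exact ⟨_, ht⟩

/-! ### Compactness of minimizing sequences -/

theorem weakDeriv_sub {v : Space d} {u w : L2 d} (hu : HasWeakDeriv v u (weakDeriv v u))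
    (hw : HasWeakDeriv v w (weakDeriv v w)) :
    weakDeriv v (u - w) = weakDeriv v u - weakDeriv v w := (hu.sub hw).weakDeriv_eq

theorem gradNorm_sub_le {u v : L2 d} (hu : u ∈ energySpace d) (hv : v ∈ energySpace d) :
    gradNorm (u - v) ≤ gradNorm u + gradNorm v := by
  have hu' := mem_energySpace_iff.1 hu
  have hv' := mem_energySpace_iff.1 hv
  have h1 : ∑ i : Fin d, ‖weakDeriv (dirX i) (u - v)‖
      ≤ ∑ i : Fin d, (‖weakDeriv (dirX i) u‖ + ‖weakDeriv (dirX i) v‖) :=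
    Finset.sum_le_sum fun i _ => by
      rw [weakDeriv_sub (hu'.1 i) (hv'.1 i)]; exact norm_sub_le _ _
  rw [Finset.sum_add_distrib] at h1
  have h2 : ‖weakDeriv (dirY d) (u - v)‖ ≤ ‖weakDeriv (dirY d) u‖ + ‖weakDeriv (dirY d) v‖ := by
    rw [weakDeriv_sub hu'.2.1 hv'.2.1]; exact norm_sub_le _ _
  unfold gradNorm; linarith

/-- Weak limits in the energy space, with the splitting of the quadratic functionals. -/
theorem weakLimit_mem_energySpace {v : ℕ → L2 d} {u : L2 d} {R : ℝ}
    (hv : ∀ n, v n ∈ energySpace d) (hb : ∀ n, gradNorm (v n) ≤ R) (hm : ∀ n, ‖mulY (v n)‖ ≤ R)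
    (hlim : WeakTendsto v u) : u ∈ energySpace d ∧
      Tendsto (fun n => gradXSq (v n) - gradXSq (v n - u)) atTop (𝓝 (gradXSq u)) ∧
      ∀ ω, Tendsto (fun n => transForm ω (v n) - transForm ω (v n - u)) atTop
        (𝓝 (transForm ω u)) := by
  have hv' := fun n => mem_energySpace_iff.1 (hv n)
  have bx : ∀ i n, ‖weakDeriv (dirX i) (v n)‖ ≤ R := fun i n => by
    refine le_trans ?_ (hb n)
    have := Finset.single_le_sum (f := fun i => ‖weakDeriv (dirX i) (v n)‖)
      (fun i _ => norm_nonneg _) (Finset.mem_univ i)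
    have h2 := norm_nonneg (weakDeriv (dirY d) (v n))
    unfold gradNorm
    linarith
  have bY : ∀ n, ‖weakDeriv (dirY d) (v n)‖ ≤ R := fun n => by
    refine le_trans ?_ (hb n)
    have : 0 ≤ ∑ i : Fin d, ‖weakDeriv (dirX i) (v n)‖ := by positivity
    unfold gradNorm
    linarith
  choose kx hkx hkx' using fun i => HasWeakDeriv.of_weakTendsto (fun n => (hv' n).1 i) (bx i) hlim
  obtain ⟨ky, hky, hky'⟩ := HasWeakDeriv.of_weakTendsto (fun n => (hv' n).2.1) bY hlim
  obtain ⟨km, hkm, hkm'⟩ := HasMulY.of_weakTendsto (fun n => (hv' n).2.2) hm hlim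
  have hu : u ∈ energySpace d := mem_energySpace_of hkx hky hkm
  refine ⟨hu, ?_, fun ω => ?_⟩
  · have h1 := tendsto_finsetSum Finset.univ fun i _ => (hkx' i).norm_sq_sub
    have e : ∑ i : Fin d, ‖kx i‖ ^ 2 = gradXSq u :=
      Finset.sum_congr rfl fun i _ => by rw [(hkx i).weakDeriv_eq]
    rw [e] at h1
    refine h1.congr fun n => ?_
    rw [Finset.sum_sub_distrib, gradXSq, gradXSq]
    congr 1
    exact Finset.sum_congr rfl fun i _ => by rw [(((hv' n).1 i).sub (hkx i)).weakDeriv_eq]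
  · have h1 := (hky'.norm_sq_sub.add hkm'.norm_sq_sub).add (hlim.norm_sq_sub.const_mul ω)
    have e : ‖ky‖ ^ 2 + ‖km‖ ^ 2 + ω * ‖u‖ ^ 2 = transForm ω u := by
      rw [transForm, derivYSq, hky.weakDeriv_eq, potentialSq_eq hu, hkm.mulY_eq, mass_eq]
    rw [e] at h1
    refine h1.congr fun n => ?_
    rw [transForm, transForm, derivYSq, derivYSq, potentialSq_eq (hv n),
      potentialSq_eq (sub_mem_energySpace (hv n) hu), mass_eq, mass_eq,
      (((hv' n).2.1).sub hky).weakDeriv_eq, (((hv' n).2.2).sub hkm).mulY_eq]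
    ring

theorem moll_dil_one (ρ : Space d → ℝ) (a : EuclideanSpace ℝ (Fin d)) (u : L2 d) (z : Space d) :
    moll ρ (dil 1 a u) z = moll ρ u (z.1 + a, z.2) := by
  rw [moll_apply, moll_apply]
  have q := (Measure.measurePreserving_sub_left (volume : Measure (Space d)) z).quasiMeasurePreserving
  refine integral_congr_ae ?_
  filter_upwards [q.ae (coeFn_dil one_pos a u)] with w hw
  rw [hw]
  congr 2
  simp only [aff, one_smul]
  refine Prod.ext ?_ ?_
  · simp only [Prod.fst_sub]; abel
  · simp

/-- Mollifications of a bounded sequence are equi-Lipschitz, so moving evaluation points can be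
replaced by their limit. -/
theorem norm_moll_sub_moll_le {ρ : Space d → ℝ} (hc : Continuous ρ) (hs : HasCompactSupport ρ)
    {u : L2 d} (hu : u ∈ energySpace d) (z z' : Space d) :
    ‖moll ρ u z - moll ρ u z'‖ ≤ ‖realL2 ρ‖ * (‖z - z'‖ * gradNorm u) := by
  have h1 : moll ρ u z - moll ρ u z' = moll ρ (trans (z - z') u - u) z' := by
    rw [moll_sub hc hs, moll_trans, add_sub_cancel]
  rw [h1]
  exact (norm_moll_le hc hs _ _).trans
    (mul_le_mul_of_nonneg_left (norm_trans_sub_le hu _) (norm_nonneg _))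

/-- Decay in `y` of the mollification of a function with `y u ∈ L²`. -/
theorem abs_snd_mul_norm_moll_le {ρ : Space d → ℝ} (hc : Continuous ρ) (hs : HasCompactSupport ρ)
    {u : L2 d} (hu : u ∈ energySpace d) (z : Space d) :
    |z.2| * ‖moll ρ u z‖ ≤ ‖realL2 ρ‖ * ‖mulY u‖ + ‖realL2 fun w => w.2 * ρ w‖ * ‖u‖ := by
  have hc' : Continuous fun w : Space d => w.2 * ρ w := continuous_snd.mul hc
  have hs' : HasCompactSupport fun w : Space d => w.2 * ρ w := hs.mul_left
  have i : ∀ {θ : Space d → ℝ}, Continuous θ → HasCompactSupport θ → ∀ g : L2 d,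
      Integrable (fun w => θ w • g (z - w)) volume := fun {θ} h1 h2 g => by
    have h0 := integrable_smul_of_compact (h1.comp (continuous_const.sub continuous_id))
      (h2.comp_homeomorph (Homeomorph.subLeft z)) g
    refine (h0.comp_sub_left z).congr (Eventually.of_forall fun w => ?_)
    simp
  have e : (z.2 : ℂ) * moll ρ u z = moll ρ (mulY u) z + moll (fun w => w.2 * ρ w) u z := by
    rw [moll_apply, moll_apply, moll_apply, ← integral_add (i hc hs _) (i hc' hs' _),
      ← integral_const_mul]
    have q := (Measure.measurePreserving_sub_left
      (volume : Measure (Space d)) z).quasiMeasurePreserving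
    refine integral_congr_ae ?_
    filter_upwards [q.ae (hasMulY_mulY hu.2)] with w hw
    rw [hw]
    simp only [Prod.snd_sub, Complex.real_smul]
    push_cast
    ring
  have h1 : |z.2| * ‖moll ρ u z‖ = ‖(z.2 : ℂ) * moll ρ u z‖ := by
    rw [norm_mul, Complex.norm_real, Real.norm_eq_abs]
  rw [h1, e]
  exact (norm_add_le _ _).trans (add_le_add (norm_moll_le hc hs _ _) (norm_moll_le hc' hs' _ _))

/-- After translation in `x`, a bounded sequence that does not vanish in `L^(α+2)` has a nonzero
weak limit along a subsequence. -/
theorem exists_translate_weakTendsto {α : ℝ} (h : Admissible d α) {u : ℕ → L2 d} {R δ : ℝ}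
    (hδ : 0 < δ) (hu : ∀ n, u n ∈ energySpace d) (hb : ∀ n, ‖u n‖ + gradNorm (u n) ≤ R)
    (hm : ∀ n, ‖mulY (u n)‖ ≤ R) (hN : ∀ n, δ ≤ nonlinearTerm α (u n)) :
    ∃ a : ℕ → EuclideanSpace ℝ (Fin d), ∃ s : ℕ → ℕ, StrictMono s ∧ ∃ v : L2 d, v ≠ 0 ∧
      WeakTendsto (fun n => dil 1 (a n) (u (s n))) v := by
  obtain ⟨ε, hε, η, hη, hmoll⟩ := exists_le_norm_moll h R hδ
  obtain ⟨ρ, hρ⟩ := exists_isMollifier d hε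
  have hc := hρ.contDiff.continuous
  have hs := hρ.hasCompactSupport
  choose z hz using fun n => hmoll ρ hρ (u n) (hu n) (hb n) (hN n)
  -- Recentring acts on `x` only, because the potential `y²` is not invariant under shifts in `y`.
  let v : ℕ → L2 d := fun n => dil 1 (z n).1 (u n)
  have hv : ∀ n, v n ∈ energySpace d := fun n => (dil_mem_energySpace one_pos _ (hu n)).1
  have hvb : ∀ n, ‖v n‖ + gradNorm (v n) ≤ R := fun n => by
    refine le_trans (le_of_eq ?_) (hb n)
    obtain ⟨-, h1, h2, -⟩ := dil_mem_energySpace one_pos (z n).1 (hu n)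
    simp only [v, gradNorm, h1, h2, norm_dil_one, norm_smul]
    simp
  have hvm : ∀ n, ‖mulY (v n)‖ ≤ R := fun n => by
    obtain ⟨-, -, -, h3⟩ := dil_mem_energySpace one_pos (z n).1 (hu n)
    simp only [v, h3, norm_dil_one]
    exact hm n
  have hvz : ∀ n, η ≤ ‖moll ρ (v n) (0, (z n).2)‖ := fun n => by
    simp only [v]
    rw [moll_dil_one]
    simpa using hz n
  -- Decay in `y` of the mollification, against the lower bound `η`, traps the points in `[-Y, Y]`;
  -- compactness then gives a limiting height `y`.
  set Y : ℝ := (‖realL2 ρ‖ * R + ‖realL2 fun w => w.2 * ρ w‖ * R) / η with hY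
  have hyb : ∀ n, (z n).2 ∈ Set.Icc (-Y) Y := fun n => by
    rw [Set.mem_Icc, ← abs_le, hY, le_div_iff₀ hη]
    have h1 := abs_snd_mul_norm_moll_le hc hs (hv n) (0, (z n).2)
    have h2 := mul_le_mul_of_nonneg_left (hvz n) (abs_nonneg (z n).2)
    have h3 := mul_le_mul_of_nonneg_left (hvm n) (norm_nonneg (realL2 ρ))
    have h4 := mul_le_mul_of_nonneg_left
      ((le_add_of_nonneg_right (gradNorm_nonneg _)).trans (hvb n))
      (norm_nonneg (realL2 fun w => w.2 * ρ w))
    simp only at h1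
    linarith
  obtain ⟨y, -, s₁, hs₁, hy⟩ := isCompact_Icc.tendsto_subseq hyb
  obtain ⟨v₀, s₂, hs₂, hw⟩ := exists_weakTendsto_subseq (x := v ∘ s₁)
    (fun n => (le_add_of_nonneg_right (gradNorm_nonneg _)).trans (hvb (s₁ n)))
  refine ⟨fun n => (z (s₁ (s₂ n))).1, s₁ ∘ s₂, hs₁.comp hs₂, v₀, fun h0 => ?_, hw⟩
  -- With weak limit `0` the mollifications at the fixed point `(0, y)` would tend to `0`, and by
  -- the Lipschitz bound so would the values at the nearby points, which are at least `η`.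
  have t1 : Tendsto (fun n => ‖moll ρ (v (s₁ (s₂ n))) (0, y)‖) atTop (𝓝 0) := by
    have := hw (realL2 fun t => ρ ((0, y) - t))
    rw [h0, inner_zero_right] at this
    have := this.norm
    rw [norm_zero] at this
    refine this.congr fun n => ?_
    rw [moll_eq_inner hc hs]; rfl
  have t2 : Tendsto (fun n => ‖realL2 ρ‖ * (|(z (s₁ (s₂ n))).2 - y| * R)) atTop (𝓝 0) := by
    have h1 : Tendsto (fun n => (z (s₁ (s₂ n))).2 - y) atTop (𝓝 (y - y)) :=
      (hy.comp hs₂.tendsto_atTop).sub_const y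
    have h2 := (h1.abs.mul_const R).const_mul ‖realL2 ρ‖
    simpa using h2
  have t3 := t1.add t2
  rw [add_zero] at t3
  refine absurd (ge_of_tendsto' t3 fun n => ?_) (not_le.2 hη)
  have h1 := hvz (s₁ (s₂ n))
  have h2 := norm_moll_sub_moll_le hc hs (hv (s₁ (s₂ n))) (0, (z (s₁ (s₂ n))).2) (0, y)
  have h3 : ‖((0, (z (s₁ (s₂ n))).2) : Space d) - (0, y)‖ = |(z (s₁ (s₂ n))).2 - y| := by
    rw [Prod.mk_sub_mk, sub_self, Prod.norm_mk, norm_zero, Real.norm_eq_abs]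
    exact max_eq_right (abs_nonneg _)
  rw [h3] at h2
  have h4 : ‖realL2 ρ‖ * (|(z (s₁ (s₂ n))).2 - y| * gradNorm (v (s₁ (s₂ n))))
      ≤ ‖realL2 ρ‖ * (|(z (s₁ (s₂ n))).2 - y| * R) := by
    have := (le_add_of_nonneg_left (norm_nonneg _)).trans (hvb (s₁ (s₂ n)))
    gcongr
  have h5 := norm_sub_norm_le (moll ρ (v (s₁ (s₂ n))) (0, (z (s₁ (s₂ n))).2))
    (moll ρ (v (s₁ (s₂ n))) (0, y))
  linarith

/-- Existence for the relaxed problem. With `v` the weak limit, both `Q` and `redAction` split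
asymptotically into the contribution of `v` and that of the remainder. The remainder cannot afford
to have `Q < 0`, since it would then already cost the whole infimum. -/
theorem exists_redAction_le_minAction {α ω : ℝ} (h : Admissible d α) (hω : 0 < ω) :
    ∃ u ∈ energySpace d, u ≠ 0 ∧ semivirial α u ≤ 0 ∧ redAction α ω u ≤ minAction d α ω := by
  set m := minAction d α ω with hmdef
  obtain ⟨x, -, hxlim, hxK⟩ := exists_seq_tendsto_sInf
    ((constraintSet_nonempty h).image (action α ω)) (bddBelow_action h hω)
  choose u huK hux using hxK
  have hred : ∀ n, redAction α ω (u n) = x n := fun n => by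
    rw [← hux, action_eq_redAction h, (huK n).2.2, mul_zero, add_zero]
  obtain ⟨B, hB⟩ := hxlim.bddAbove_range
  have hxB : ∀ n, redAction α ω (u n) ≤ B := fun n => by
    rw [hred]; exact hB (Set.mem_range_self n)
  have hκ := redAction_coeff_pos h
  set κ := 1 / 2 - 2 / (α * d) with hκdef
  have bA : ∀ n, gradXSq (u n) ≤ B / κ := fun n => by
    rw [le_div_iff₀ hκ]
    have h1 := hxB n
    have h2 := transForm_nonneg hω (u n)
    rw [redAction, ← hκdef] at h1
    linarith
  have bT : ∀ n, transForm ω (u n) ≤ 2 * B := fun n => by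
    have h1 := hxB n
    have h2 := mul_nonneg hκ.le (gradXSq_nonneg (u n))
    rw [redAction, ← hκdef] at h1
    linarith
  have bD : ∀ n, derivYSq (u n) ≤ 2 * B := fun n => by
    have h1 := bT n
    have h2 := potentialSq_nonneg (u n)
    have h3 := mul_nonneg hω.le (mass_nonneg (u n))
    unfold transForm at h1; linarith
  have bP : ∀ n, potentialSq (u n) ≤ 2 * B := fun n => by
    have h1 := bT n
    have h2 := derivYSq_nonneg (u n)
    have h3 := mul_nonneg hω.le (mass_nonneg (u n))
    unfold transForm at h1; linarith
  have bM : ∀ n, mass (u n) ≤ 2 * B / ω := fun n => by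
    rw [le_div_iff₀ hω]
    have h1 := bT n
    have h2 := derivYSq_nonneg (u n)
    have h3 := potentialSq_nonneg (u n)
    unfold transForm at h1; linarith
  obtain ⟨δ, hδ, hδA⟩ := exists_le_gradXSq h (max (2 * B) (2 * B / ω))
  have hc := virial_coeff_pos h
  set c := α * d / (2 * (α + 2)) with hcdef
  have bN : ∀ n, δ / c ≤ nonlinearTerm α (u n) := fun n => by
    have h1 := hδA (u n) (huK n).1 (huK n).2.1 (huK n).2.2.le ((bD n).trans (le_max_left _ _))
      ((bM n).trans (le_max_right _ _))
    have h2 := (huK n).2.2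
    rw [semivirial, ← hcdef] at h2
    rw [div_le_iff₀ hc]
    linarith
  set R₁ : ℝ := (d + 2) * √(B / κ + 2 * B + 2 * B / ω) with hR₁
  have bH : ∀ n, ‖u n‖ + gradNorm (u n) ≤ R₁ := fun n => by
    refine (norm_add_gradNorm_le (u n)).trans (mul_le_mul_of_nonneg_left
      (Real.sqrt_le_sqrt ?_) (by positivity))
    linarith [bA n, bD n, bM n]
  have bY : ∀ n, ‖mulY (u n)‖ ≤ √(2 * B) := fun n => by
    refine Real.le_sqrt_of_sq_le ?_
    rw [← potentialSq_eq (huK n).1]; exact bP n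
  set R := max R₁ (√(2 * B)) with hR
  obtain ⟨a, s, hs, v, hv0, hv⟩ := exists_translate_weakTendsto h (R := R) (div_pos hδ hc)
    (fun n => (huK n).1) (fun n => (bH n).trans (le_max_left _ _))
    (fun n => (bY n).trans (le_max_right _ _)) bN
  let w : ℕ → L2 d := fun n => dil 1 (a n) (u (s n))
  have hwF := fun n => dil_one_functionals (a n) α ω (huK (s n)).1
  have hwE : ∀ n, w n ∈ energySpace d := fun n => (hwF n).1
  have hwT : ∀ n, transForm ω (w n) = transForm ω (u (s n)) := fun n => (hwF n).2.2.1
  have hwH : ∀ n, ‖w n‖ + gradNorm (w n) ≤ R := fun n => by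
    refine le_trans (le_of_eq ?_) ((bH (s n)).trans (le_max_left _ _))
    obtain ⟨-, h1, h2, -⟩ := dil_mem_energySpace one_pos (a n) (huK (s n)).1
    simp only [w, gradNorm, h1, h2, norm_dil_one, norm_smul]
    simp
  have hwY : ∀ n, ‖mulY (w n)‖ ≤ R := fun n => by
    obtain ⟨-, -, -, h3⟩ := dil_mem_energySpace one_pos (a n) (huK (s n)).1
    simp only [w, h3, norm_dil_one]
    exact (bY _).trans (le_max_right _ _)
  have hwg : ∀ n, gradNorm (w n) ≤ R := fun n =>
    (le_add_of_nonneg_left (norm_nonneg _)).trans (hwH n)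
  obtain ⟨hvE, hA, hT⟩ := weakLimit_mem_energySpace hwE hwg hwY hv
  have hdb : ∀ n, ‖w n - v‖ + gradNorm (w n - v) ≤ R + (‖v‖ + gradNorm v) := fun n => by
    have h1 := norm_sub_le (w n) v
    have h2 := gradNorm_sub_le (hwE n) hvE
    linarith [hwH n]
  have hd0 : WeakTendsto (fun n => w n - v) 0 := by
    have := hv.sub_const v
    rwa [sub_self] at this
  obtain ⟨t, ht, hae⟩ := exists_subseq_tendsto_ae (fun n => sub_mem_energySpace (hwE n) hvE) hdb hd0
  have hNl := tendsto_nonlinearTerm_sub h (v := fun n => w (t n)) (fun n => hwE (t n)) hvE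
    (fun n => hdb (t n)) hae
  have hAl := hA.comp ht.tendsto_atTop
  have hTl := (hT ω).comp ht.tendsto_atTop
  have hQw : ∀ n, semivirial α (w n) = 0 := fun n => by
    rw [← (huK (s n)).2.2, semivirial, semivirial, (hwF n).2.1, (hwF n).2.2.2]
  have hQl : Tendsto (fun n => semivirial α (w (t n) - v)) atTop (𝓝 (-semivirial α v)) := by
    have h1 := (hAl.sub (hNl.const_mul c)).neg
    refine h1.congr fun n => ?_
    have h2 := hQw (t n)
    simp only [semivirial, ← hcdef, Function.comp_apply] at h2 ⊢
    linarith
  have hRw : ∀ n, redAction α ω (w n) = x (s n) := fun n => by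
    rw [← hred, redAction, redAction, hwT, (hwF n).2.1]
  have hRl : Tendsto (fun n => redAction α ω (w (t n) - v)) atTop (𝓝 (m - redAction α ω v)) := by
    have h1 := (hAl.const_mul κ).add (hTl.const_mul (1 / 2))
    have h2 := (hxlim.comp (hs.comp ht).tendsto_atTop).sub h1
    refine h2.congr fun n => ?_
    have h3 := hRw (t n)
    simp only [Function.comp_apply]
    rw [← h3]
    simp only [redAction, ← hκdef]
    ring
  refine ⟨v, hvE, hv0, ?_, ?_⟩
  -- If `Q(v) > 0`, the remainders eventually satisfy `Q < 0`, so they are nonzero competitors and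
  -- `m ≤ m - redAction v` in the limit, contradicting `redAction v > 0`.
  · by_contra! hQ
    have h1 : ∀ᶠ n in atTop, m ≤ redAction α ω (w (t n) - v) := by
      filter_upwards [hQl.eventually_lt_const (show -semivirial α v < 0 by linarith)] with n hn
      refine minAction_le_of_semivirial_nonpos h hω (sub_mem_energySpace (hwE _) hvE) ?_ hn.le
      intro h0
      rw [h0] at hn
      have e : semivirial α (0 : L2 d) = 0 := by
        have e1 := gradXSq_smul 0 hvE
        have e2 := nonlinearTerm_smul α 0 v
        rw [zero_smul] at e1 e2
        rw [semivirial, e1, e2, norm_zero, Real.zero_rpow (by linarith [h.pos])]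
        ring
      rw [e] at hn
      exact lt_irrefl _ hn
    have h2 := ge_of_tendsto hRl h1
    have h3 := redAction_pos h hω hv0
    linarith
  · have h1 := ge_of_tendsto' hRl fun n => redAction_nonneg h hω _
    linarith

/-- The constraint set contains a minimizer of the action which is real and nonnegative. -/
theorem exists_nonneg_minimizer {α ω : ℝ} (h : Admissible d α) (hω : 0 < ω) :
    ∃ φ ∈ constraintSet d α, redAction α ω φ = minAction d α ω ∧
      ∀ᵐ z : Space d, (φ z).im = 0 ∧ 0 ≤ (φ z).re := by
  obtain ⟨u, hu, h0, hQ, hle⟩ := exists_redAction_le_minAction h hω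
  have hu' := mem_energySpace_iff.1 hu
  have hE := absL2_mem_energySpace hu
  have hA : gradXSq (absL2 u) ≤ gradXSq u := Finset.sum_le_sum fun i _ =>
    pow_le_pow_left₀ (norm_nonneg _) (norm_weakDeriv_absL2_le (hu'.1 i)) 2
  have hD : derivYSq (absL2 u) ≤ derivYSq u :=
    pow_le_pow_left₀ (norm_nonneg _) (norm_weakDeriv_absL2_le hu'.2.1) 2
  have hP : potentialSq (absL2 u) ≤ potentialSq u := by
    rw [potentialSq_eq hE, potentialSq_eq hu]
    exact pow_le_pow_left₀ (norm_nonneg _) (norm_mulY_absL2_le hu'.2.2) 2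
  have hM : mass (absL2 u) = mass u := by rw [mass_eq, mass_eq, norm_absL2]
  have hQ' : semivirial α (absL2 u) ≤ 0 := by
    rw [semivirial, nonlinearTerm_absL2]
    rw [semivirial] at hQ
    linarith
  have hR : redAction α ω (absL2 u) ≤ minAction d α ω := by
    refine le_trans ?_ hle
    have := mul_le_mul_of_nonneg_left hA (redAction_coeff_pos h).le
    unfold redAction transForm
    rw [hM]
    linarith
  have hne : absL2 u ≠ 0 := by
    rw [← norm_pos_iff, norm_absL2]; exact norm_pos_iff.2 h0
  -- The modulus is only known to satisfy `Q ≤ 0`; a positive multiple lies on the constraint and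
  -- keeps the sign.
  obtain ⟨t, ht0, htK, htm⟩ := exists_minimizer_of_le h hω hE hne hQ' hR
  refine ⟨_, htK, htm, ?_⟩
  filter_upwards [Lp.coeFn_smul (t : ℂ) (absL2 u), coeFn_absL2 u] with z h1 h2
  rw [h1, Pi.smul_apply, h2, smul_eq_mul, ← Complex.ofReal_mul]
  exact ⟨Complex.ofReal_im _, by rw [Complex.ofReal_re]; positivity⟩

/-! ### The Euler–Lagrange equation -/

theorem hasDerivAt_norm_add_smul_sq {H : Type*} [NormedAddCommGroup H] [InnerProductSpace ℂ H]
    (a b : H) : HasDerivAt (fun t : ℝ => ‖a + (t : ℂ) • b‖ ^ 2) (2 * (inner ℂ b a).re) 0 := by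
  have e : ∀ t : ℝ, ‖a + (t : ℂ) • b‖ ^ 2
      = ‖a‖ ^ 2 + t * (2 * (inner ℂ b a).re) + t ^ 2 * ‖b‖ ^ 2 := fun t => by
    rw [@norm_add_sq ℂ, inner_smul_right, norm_smul, mul_pow, Complex.norm_real, Real.norm_eq_abs,
      sq_abs, ← inner_conj_symm a b]
    simp only [RCLike.mul_re, RCLike.conj_re, RCLike.conj_im, RCLike.re_to_complex,
      RCLike.im_to_complex, Complex.ofReal_re, Complex.ofReal_im]
    ring
  simp_rw [e]
  have h1 := ((hasDerivAt_id (0 : ℝ)).mul_const (2 * (inner ℂ b a).re)).const_add (‖a‖ ^ 2)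
  have h2 := (hasDerivAt_pow 2 (0 : ℝ)).mul_const (‖b‖ ^ 2)
  exact (h1.add h2).congr_deriv (by simp)

theorem add_rpow_le_mul_add {a b p : ℝ} (ha : 0 ≤ a) (hb : 0 ≤ b) (hp : 0 ≤ p) :
    (a + b) ^ p ≤ 2 ^ p * (a ^ p + b ^ p) := by
  have ha' : 0 ≤ a ^ p := by positivity
  have hb' : 0 ≤ b ^ p := by positivity
  have h2 : (0 : ℝ) ≤ 2 ^ p := by positivity
  rcases le_total a b with h | h
  · calc (a + b) ^ p ≤ (2 * b) ^ p := Real.rpow_le_rpow (by positivity) (by linarith) hp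
      _ = 2 ^ p * b ^ p := Real.mul_rpow (by norm_num) hb
      _ ≤ _ := mul_le_mul_of_nonneg_left (by linarith) h2
  · calc (a + b) ^ p ≤ (2 * a) ^ p := Real.rpow_le_rpow (by positivity) (by linarith) hp
      _ = 2 ^ p * a ^ p := Real.mul_rpow (by norm_num) ha
      _ ≤ _ := mul_le_mul_of_nonneg_left (by linarith) h2

theorem integrable_add_norm_rpow {α : ℝ} (h : Admissible d α) {φ ψ : L2 d}
    (hφ : φ ∈ energySpace d) (hψ : ψ ∈ energySpace d) :
    Integrable (fun z => (‖φ z‖ + ‖ψ z‖) ^ (α + 2)) volume := by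
  have hα := h.pos
  have hI : ∀ w ∈ energySpace d, Integrable (fun z => ‖w z‖ ^ (α + 2)) volume := fun w hw =>
    integrable_norm_rpow h.two_le (by linarith) h.lt_crit.le hw
  refine (((hI φ hφ).add (hI ψ hψ)).const_mul (2 ^ (α + 2))).mono' ?_
    (Eventually.of_forall fun z => ?_)
  · exact (Real.continuous_rpow_const (by linarith)).comp_aestronglyMeasurable
      ((Lp.aestronglyMeasurable φ).norm.add (Lp.aestronglyMeasurable ψ).norm)
  · rw [Real.norm_eq_abs, abs_of_nonneg (by positivity)]
    exact add_rpow_le_mul_add (norm_nonneg _) (norm_nonneg _) (by linarith)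

theorem rpow_mul_mul_le {a b α : ℝ} (ha : 0 ≤ a) (hb : 0 ≤ b) (hα : 0 < α) :
    a ^ α * a * b ≤ (a + b) ^ (α + 2) := by
  rcases (add_nonneg ha hb).eq_or_lt with h0 | h0
  · have : b = 0 := by linarith
    rw [this, mul_zero]; positivity
  · rw [Real.rpow_add h0, Real.rpow_two, mul_assoc]
    refine mul_le_mul (Real.rpow_le_rpow ha (by linarith) hα.le) ?_ (by positivity) (by positivity)
    nlinarith

theorem integrable_nonlinear_pairing {α : ℝ} (h : Admissible d α) {φ ψ : L2 d}
    (hφ : φ ∈ energySpace d) (hψ : ψ ∈ energySpace d) :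
    Integrable (fun z : Space d => ((‖φ z‖ ^ α : ℝ) : ℂ) * φ z * conj (ψ z)) volume := by
  refine (integrable_add_norm_rpow h hφ hψ).mono' ?_ (Eventually.of_forall fun z => ?_)
  · exact ((Complex.continuous_ofReal.comp_aestronglyMeasurable
      (aestronglyMeasurable_norm_rpow φ h.pos.le)).mul (Lp.aestronglyMeasurable φ)).mul
      (Complex.continuous_conj.comp_aestronglyMeasurable (Lp.aestronglyMeasurable ψ))
  · rw [norm_mul, norm_mul, Complex.norm_real, RCLike.norm_conj, Real.norm_eq_abs,
      abs_of_nonneg (by positivity)]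
    exact rpow_mul_mul_le (norm_nonneg _) (norm_nonneg _) h.pos

/-- Differentiation under the integral sign for `|t| < 1`, where `|φ + tψ| ≤ |φ| + |ψ|`. The real
inner product of `ℂ` in the derivative of the modulus is the real part of the complex pairing. -/
theorem hasDerivAt_nonlinearTerm {α : ℝ} (h : Admissible d α) {φ ψ : L2 d}
    (hφ : φ ∈ energySpace d) (hψ : ψ ∈ energySpace d) :
    HasDerivAt (fun t : ℝ => nonlinearTerm α (φ + (t : ℂ) • ψ))
      ((α + 2) * (∫ z : Space d, ((‖φ z‖ ^ α : ℝ) : ℂ) * φ z * conj (ψ z)).re) 0 := by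
  have hα := h.pos
  have e : ∀ t : ℝ, nonlinearTerm α (φ + (t : ℂ) • ψ)
      = ∫ z, ‖φ z + t • ψ z‖ ^ (α + 2) := fun t => by
    refine integral_congr_ae ?_
    filter_upwards [Lp.coeFn_add φ ((t : ℂ) • ψ), Lp.coeFn_smul (t : ℂ) ψ] with z h1 h2
    rw [h1, Pi.add_apply, h2, Pi.smul_apply, Complex.real_smul, smul_eq_mul]
  simp_rw [e]
  let F' : ℝ → Space d → ℝ := fun t z =>
    (α + 2) * ‖φ z + t • ψ z‖ ^ α * inner ℝ (φ z + t • ψ z) (ψ z)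
  have hm : ∀ t : ℝ, AEStronglyMeasurable (fun z => φ z + t • ψ z) volume := fun t =>
    (Lp.aestronglyMeasurable φ).add ((Lp.aestronglyMeasurable ψ).const_smul t)
  have hF'm : ∀ t, AEStronglyMeasurable (F' t) volume := fun t =>
    (((Real.continuous_rpow_const hα.le).comp_aestronglyMeasurable (hm t).norm).const_mul
      (α + 2)).mul ((hm t).inner (Lp.aestronglyMeasurable ψ))
  have key := (hasDerivAt_integral_of_dominated_loc_of_deriv_le (μ := volume) (x₀ := (0 : ℝ))
    (s := Metric.ball 0 1) (F := fun t z => ‖φ z + t • ψ z‖ ^ (α + 2)) (F' := F')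
    (bound := fun z => (α + 2) * (‖φ z‖ + ‖ψ z‖ + ‖ψ z‖) ^ (α + 2))
    (Metric.ball_mem_nhds _ one_pos) (Eventually.of_forall fun t =>
      (Real.continuous_rpow_const (by linarith)).comp_aestronglyMeasurable (hm t).norm)
    ?_ (hF'm 0) (Eventually.of_forall fun z t ht => ?_) ?_
    (Eventually.of_forall fun z t ht => ?_)).2
  · refine key.congr_deriv ?_
    have e1 : (∫ z : Space d, ((‖φ z‖ ^ α : ℝ) : ℂ) * φ z * conj (ψ z)).re
        = ∫ z : Space d, (((‖φ z‖ ^ α : ℝ) : ℂ) * φ z * conj (ψ z)).re := by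
      have := integral_re (integrable_nonlinear_pairing h hφ hψ)
      simpa using this.symm
    rw [e1, ← integral_const_mul]
    refine integral_congr_ae (Eventually.of_forall fun z => ?_)
    simp only [F', zero_smul, add_zero]
    rw [mul_assoc, mul_assoc, Complex.re_ofReal_mul, Complex.inner]
    simp only [Complex.mul_re, Complex.conj_re, Complex.conj_im]
    ring
  · simp only [zero_smul, add_zero]
    exact integrable_norm_rpow h.two_le (by linarith) h.lt_crit.le hφ
  · have ht1 : |t| ≤ 1 := by
      have := mem_ball_zero_iff.1 ht
      rw [Real.norm_eq_abs] at this; exact this.le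
    have h1 : ‖φ z + t • ψ z‖ ≤ ‖φ z‖ + ‖ψ z‖ := by
      refine (norm_add_le _ _).trans (add_le_add_right ?_ _)
      rw [norm_smul, Real.norm_eq_abs]
      exact mul_le_of_le_one_left (norm_nonneg _) ht1
    simp only [F']
    rw [norm_mul, norm_mul, Real.norm_eq_abs, Real.norm_eq_abs, abs_of_pos (by linarith),
      abs_of_nonneg (by positivity), mul_assoc]
    refine mul_le_mul_of_nonneg_left ?_ (by linarith)
    refine le_trans ?_ ((rpow_mul_mul_le (norm_nonneg (φ z + t • ψ z)) (norm_nonneg (ψ z)) hα).trans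
      (Real.rpow_le_rpow (by positivity) (by linarith) (by linarith)))
    rw [mul_assoc]
    exact mul_le_mul_of_nonneg_left (norm_inner_le_norm _ _) (by positivity)
  -- The second copy of `‖ψ‖` in the dominating function is absorbed by using `2ψ` in place of `ψ`.
  · have i1 := integrable_add_norm_rpow h hφ (smul_mem_energySpace 2 hψ)
    refine (i1.congr ?_).const_mul _
    filter_upwards [Lp.coeFn_smul (2 : ℂ) ψ] with z hz
    rw [hz, Pi.smul_apply, norm_smul]
    congr 1
    norm_num
    ring
  · have h1 := hasFDerivAt_norm_rpow (φ z + t • ψ z) (p := α + 2) (by linarith)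
    have h2 : HasDerivAt (fun t : ℝ => φ z + t • ψ z) (ψ z) t := by
      simpa using ((hasDerivAt_id t).smul_const (ψ z)).const_add (φ z)
    have h3 := h1.comp_hasDerivAt t h2
    refine HasDerivAt.congr_deriv (f := fun t : ℝ => ‖φ z + t • ψ z‖ ^ (α + 2)) h3 ?_
    simp only [F', add_sub_cancel_right]
    rfl

/-- The weak form of the equation, tested against `ψ`. -/
def weakForm (α ω : ℝ) (φ ψ : L2 d) : ℂ :=
  ∑ i : Fin d, inner ℂ (weakDeriv (dirX i) ψ) (weakDeriv (dirX i) φ)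
    + inner ℂ (weakDeriv (dirY d) ψ) (weakDeriv (dirY d) φ) + inner ℂ (mulY ψ) (mulY φ)
    + (ω : ℂ) * inner ℂ ψ φ - ∫ z : Space d, ((‖φ z‖ ^ α : ℝ) : ℂ) * φ z * conj (ψ z)

theorem weakForm_smul (α ω : ℝ) (c : ℂ) {φ ψ : L2 d} (hψ : ψ ∈ energySpace d) :
    weakForm α ω φ (c • ψ) = conj c * weakForm α ω φ ψ := by
  have hψ' := mem_energySpace_iff.1 hψ
  have e1 : ∀ i : Fin d, inner ℂ (weakDeriv (dirX i) (c • ψ)) (weakDeriv (dirX i) φ)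
      = conj c * inner ℂ (weakDeriv (dirX i) ψ) (weakDeriv (dirX i) φ) := fun i => by
    rw [weakDeriv_smul c (hψ'.1 i), inner_smul_left]
  have e2 : ∫ z : Space d, ((‖φ z‖ ^ α : ℝ) : ℂ) * φ z * conj ((c • ψ) z)
      = conj c * ∫ z : Space d, ((‖φ z‖ ^ α : ℝ) : ℂ) * φ z * conj (ψ z) := by
    rw [← integral_const_mul]
    refine integral_congr_ae ?_
    filter_upwards [Lp.coeFn_smul c ψ] with z hz
    rw [hz, Pi.smul_apply, smul_eq_mul, map_mul]
    ring
  rw [weakForm, weakForm, e2, Finset.sum_congr rfl fun i _ => e1 i, ← Finset.mul_sum,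
    weakDeriv_smul c hψ'.2.1, (hψ'.2.2.smul c).mulY_eq, inner_smul_left, inner_smul_left,
    inner_smul_left]
  ring

/-- Let `u t = φ + tψ` and dilate it in `x` by the factor `l t` that restores `Q = 0`. The action
along this curve in the constraint has a minimum at `0`. In its derivative, `l'` is multiplied by
`Q(φ) = 0`, so only the weak form remains. -/
theorem re_weakForm_eq_zero {α ω : ℝ} (h : Admissible d α) (hω : 0 < ω) {φ : L2 d}
    (hφ : φ ∈ constraintSet d α) (hmin : redAction α ω φ = minAction d α ω) {ψ : L2 d}
    (hψ : ψ ∈ energySpace d) : (weakForm α ω φ ψ).re = 0 := by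
  have hα := h.pos
  have hφE := hφ.1
  have hφ' := mem_energySpace_iff.1 hφE
  have hψ' := mem_energySpace_iff.1 hψ
  let u : ℝ → L2 d := fun t => φ + (t : ℂ) • ψ
  have hu : ∀ t, u t ∈ energySpace d := fun t =>
    add_mem_energySpace hφE (smul_mem_energySpace _ hψ)
  have hu0 : u 0 = φ := by
    simp only [u, Complex.ofReal_zero, zero_smul, add_zero]
  set A' : ℝ := ∑ i : Fin d, 2 * (inner ℂ (weakDeriv (dirX i) ψ) (weakDeriv (dirX i) φ)).re
    with hA'
  set T' : ℝ := 2 * (inner ℂ (weakDeriv (dirY d) ψ) (weakDeriv (dirY d) φ)).re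
    + 2 * (inner ℂ (mulY ψ) (mulY φ)).re + ω * (2 * (inner ℂ ψ φ).re) with hT'
  set I : ℝ := (∫ z : Space d, ((‖φ z‖ ^ α : ℝ) : ℂ) * φ z * conj (ψ z)).re with hI
  have dA : HasDerivAt (fun t => gradXSq (u t)) A' 0 := by
    have e : ∀ t, gradXSq (u t)
        = ∑ i : Fin d, ‖weakDeriv (dirX i) φ + (t : ℂ) • weakDeriv (dirX i) ψ‖ ^ 2 := fun t =>
      Finset.sum_congr rfl fun i _ => by
        rw [((hφ'.1 i).add ((hψ'.1 i).smul (t : ℂ))).weakDeriv_eq]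
    simp_rw [e]
    exact HasDerivAt.fun_sum fun i _ => hasDerivAt_norm_add_smul_sq _ _
  have dT : HasDerivAt (fun t => transForm ω (u t)) T' 0 := by
    have e : ∀ t, transForm ω (u t)
        = ‖weakDeriv (dirY d) φ + (t : ℂ) • weakDeriv (dirY d) ψ‖ ^ 2
          + ‖mulY φ + (t : ℂ) • mulY ψ‖ ^ 2 + ω * ‖φ + (t : ℂ) • ψ‖ ^ 2 := fun t => by
      rw [transForm, derivYSq, (hφ'.2.1.add (hψ'.2.1.smul (t : ℂ))).weakDeriv_eq,
        potentialSq_eq (hu t), (hφ'.2.2.add (hψ'.2.2.smul (t : ℂ))).mulY_eq, mass_eq]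
    simp_rw [e]
    exact ((hasDerivAt_norm_add_smul_sq _ _).add (hasDerivAt_norm_add_smul_sq _ _)).add
      ((hasDerivAt_norm_add_smul_sq _ _).const_mul ω)
  have dN : HasDerivAt (fun t => nonlinearTerm α (u t)) ((α + 2) * I) 0 :=
    hasDerivAt_nonlinearTerm h hφE hψ
  have hA0 : 0 < gradXSq φ := gradXSq_pos h hφE hφ.2.1
  have hN0 : 0 < nonlinearTerm α φ := nonlinearTerm_pos h.two_le h.pos h.lt_crit.le hφE hφ.2.1
  have hc := virial_coeff_pos h
  have hQ := hφ.2.2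
  rw [semivirial] at hQ
  set c : ℝ := α * d / (2 * (α + 2)) with hcdef
  set κ : ℝ := α * d / 2 with hκ
  have hκ2 : 0 < κ - 2 := by linarith [h.four_lt]
  have hcκ : c = κ / (α + 2) := by
    rw [hcdef, hκ]
    field_simp
  -- The dilation by `l` lies on the constraint when `l² A = c l^κ N`, that is `l^(κ-2) = q`; this
  -- is solvable because `κ = αd/2 > 2`.
  let q : ℝ → ℝ := fun t => gradXSq (u t) / (c * nonlinearTerm α (u t))
  have hq0 : q 0 = 1 := by
    simp only [q, hu0]
    rw [div_eq_one_iff_eq (by positivity)]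
    linarith
  have dq : ∃ q', HasDerivAt q q' 0 :=
    ⟨_, dA.div (dN.const_mul c) (by rw [hu0]; positivity)⟩
  obtain ⟨q', dq⟩ := dq
  let l : ℝ → ℝ := fun t => q t ^ (1 / (κ - 2))
  have hl0 : l 0 = 1 := by simp only [l, hq0, Real.one_rpow]
  obtain ⟨l', dl⟩ : ∃ l', HasDerivAt l l' 0 :=
    ⟨_, dq.rpow_const (Or.inl (by rw [hq0]; exact one_ne_zero))⟩
  let F : ℝ → ℝ := fun t => 1 / 2 * (l t ^ 2 * gradXSq (u t)) + 1 / 2 * transForm ω (u t)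
    - 1 / (α + 2) * (l t ^ κ * nonlinearTerm α (u t))
  have hF0 : F 0 = minAction d α ω := by
    simp only [F, hl0, hu0]
    rw [← hmin]
    have h1 := action_eq_redAction h ω φ
    rw [hφ.2.2, mul_zero, add_zero, action_eq] at h1
    rw [← h1]
    simp
  have hFmin : IsLocalMin F 0 := by
    have eA : ∀ᶠ t in 𝓝 (0 : ℝ), 0 < gradXSq (u t) :=
      dA.continuousAt.eventually_const_lt (by simpa only [hu0] using hA0)
    have eN : ∀ᶠ t in 𝓝 (0 : ℝ), 0 < nonlinearTerm α (u t) :=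
      dN.continuousAt.eventually_const_lt (by simpa only [hu0] using hN0)
    filter_upwards [eA, eN] with t hA hN
    rw [hF0]
    have hq : 0 < q t := by simp only [q]; positivity
    have hl : 0 < l t := by simp only [l]; positivity
    obtain ⟨s1, s2, s3, -, -, s5⟩ := scal_functionals hl α ω (hu t)
    have hQ0 : semivirial α (scal (l t) (u t)) = 0 := by
      rw [semivirial, s2, s5, ← hcdef, ← hκ]
      have e1 : l t ^ κ = l t ^ 2 * q t := by
        have e2 : l t ^ (κ - 2) = q t := by
          simp only [l]
          rw [← Real.rpow_mul hq.le, one_div_mul_cancel hκ2.ne', Real.rpow_one]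
        rw [← e2, ← Real.rpow_two, ← Real.rpow_add hl]
        congr 1; ring
      rw [e1]
      simp only [q]
      field_simp
      ring
    have hne : scal (l t) (u t) ≠ 0 := by
      intro h0
      have : gradXSq (scal (l t) (u t)) = 0 := by
        have e1 := gradXSq_smul 0 s1
        rw [zero_smul, norm_zero] at e1
        rw [h0, e1]; ring
      rw [s2] at this
      have : 0 < l t ^ 2 * gradXSq (u t) := by positivity
      linarith
    have hK : scal (l t) (u t) ∈ constraintSet d α := ⟨s1, hne, hQ0⟩
    have h1 := csInf_le (bddBelow_action h hω) (Set.mem_image_of_mem _ hK)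
    rw [action_eq, s2, s3, s5] at h1
    exact h1
  have dF : HasDerivAt F (1 / 2 * (2 * l' * gradXSq φ + A') + 1 / 2 * T'
      - 1 / (α + 2) * (κ * l' * nonlinearTerm α φ + (α + 2) * I)) 0 := by
    have d2 := (dl.pow 2).mul dA
    have dκ := (dl.rpow_const (p := κ) (Or.inl (by rw [hl0]; exact one_ne_zero))).mul dN
    have d3 := ((d2.const_mul (1 / 2)).add (dT.const_mul (1 / 2))).sub (dκ.const_mul (1 / (α + 2)))
    refine HasDerivAt.congr_deriv (f := F) d3 ?_
    simp only [Pi.pow_apply, hl0, hu0, Real.one_rpow]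
    ring
  have hz := hFmin.hasDerivAt_eq_zero dF
  -- The coefficient of `l'` is `‖∇_x φ‖² - κ/(α+2) N`, with `N` the nonlinear term of `φ`. This is
  -- `Q(φ)` and drops out.
  have e1 : 1 / 2 * A' + 1 / 2 * T' - I = 0 := by
    have h2 : α + 2 ≠ 0 := by linarith
    have e2 : gradXSq φ = κ / (α + 2) * nonlinearTerm α φ := by
      rw [← hcκ]; linarith
    rw [e2] at hz
    field_simp at hz
    have e3 : (α + 2) * (1 / 2 * A' + 1 / 2 * T' - I) = 0 := by linarith
    exact (mul_eq_zero.1 e3).resolve_left h2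
  rw [weakForm, Complex.sub_re, Complex.add_re, Complex.add_re, Complex.add_re, Complex.re_sum,
    Complex.re_ofReal_mul]
  rw [hA', ← Finset.mul_sum, hT'] at e1
  linarith

theorem weakForm_eq_zero {α ω : ℝ} (h : Admissible d α) (hω : 0 < ω) {φ : L2 d}
    (hφ : φ ∈ constraintSet d α) (hmin : redAction α ω φ = minAction d α ω) {ψ : L2 d}
    (hψ : ψ ∈ energySpace d) : weakForm α ω φ ψ = 0 := by
  refine Complex.ext (re_weakForm_eq_zero h hω hφ hmin hψ) ?_
  -- Testing with `iψ` recovers the imaginary part.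
  have h1 := re_weakForm_eq_zero h hω hφ hmin (smul_mem_energySpace Complex.I hψ)
  rw [weakForm_smul _ _ _ hψ] at h1
  simpa using h1

theorem inner_mulY {φ ψ : L2 d} (hφ : φ ∈ energySpace d) (hψ : ψ ∈ energySpace d) :
    inner ℂ (mulY ψ) (mulY φ) = ∫ z : Space d, ((z.2 ^ 2 : ℝ) : ℂ) * φ z * conj (ψ z) := by
  rw [inner_eq_integral]
  refine integral_congr_ae ?_
  filter_upwards [hasMulY_mulY hφ.2, hasMulY_mulY hψ.2] with z h1 h2
  rw [h1, h2, map_mul, Complex.conj_ofReal]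
  push_cast
  ring

theorem isWeakSolution_of_minimizer {α ω : ℝ} (h : Admissible d α) (hω : 0 < ω) {φ : L2 d}
    (hφ : φ ∈ constraintSet d α) (hmin : redAction α ω φ = minAction d α ω) :
    IsWeakSolution α ω φ := by
  refine ⟨hφ.1, fun ψ hψ => ⟨integrable_nonlinear_pairing h hφ.1 hψ, ?_⟩⟩
  have h1 := weakForm_eq_zero h hω hφ hmin hψ
  rw [weakForm, inner_mulY hφ.1 hψ, sub_eq_zero] at h1
  exact h1

/-! ### A smooth radial family of test functions -/

/-- The derivative of `expNegInvGlue`. -/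
def glueD (x : ℝ) : ℝ := (x⁻¹) ^ 2 * expNegInvGlue x

theorem hasDerivAt_expNegInvGlue (x : ℝ) : HasDerivAt expNegInvGlue (glueD x) x := by
  have := expNegInvGlue.hasDerivAt_polynomial_eval_inv_mul 1 x
  simpa [glueD] using this

open scoped ContDiff in
theorem contDiff_glueD : ContDiff ℝ ∞ glueD := by
  have := expNegInvGlue.contDiff_polynomial_eval_inv_mul (n := ⊤) (Polynomial.X ^ 2)
  have e : glueD = fun x => (Polynomial.X ^ 2 : Polynomial ℝ).eval x⁻¹ * expNegInvGlue x := by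
    funext x
    simp only [glueD, Polynomial.eval_pow, Polynomial.eval_X]
  rw [e]
  exact this

theorem glueD_nonneg (x : ℝ) : 0 ≤ glueD x :=
  mul_nonneg (sq_nonneg _) (expNegInvGlue.nonneg x)

theorem glueD_of_nonpos {x : ℝ} (hx : x ≤ 0) : glueD x = 0 := by
  rw [glueD, expNegInvGlue.zero_of_nonpos hx, mul_zero]

theorem glueD_pos {x : ℝ} (hx : 0 < x) : 0 < glueD x :=
  mul_pos (by positivity) (expNegInvGlue.pos_of_pos hx)

/-- For `0 < x ≤ 1` the factor `x⁻²` is at least `1`. This lets the potential term, which carries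
the test profile, be absorbed by the local mean, which carries its derivative. -/
theorem expNegInvGlue_le_glueD {x : ℝ} (hx : x ≤ 1) : expNegInvGlue x ≤ glueD x := by
  rcases le_or_gt x 0 with h | h
  · rw [expNegInvGlue.zero_of_nonpos h, glueD_of_nonpos h]
  · refine le_mul_of_one_le_left (expNegInvGlue.nonneg x) (one_le_pow₀ ?_)
    exact (one_le_inv₀ h).2 hx

theorem deriv_glueD_of_neg {x : ℝ} (hx : x < 0) : deriv glueD x = 0 := by
  have : glueD =ᶠ[𝓝 x] fun _ => 0 := by
    filter_upwards [Iio_mem_nhds hx] with t ht using glueD_of_nonpos (le_of_lt ht)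
  rw [this.deriv_eq, deriv_const]

open scoped ContDiff in
theorem continuous_deriv_glueD : Continuous (deriv glueD) :=
  contDiff_glueD.continuous_deriv (by simp)

theorem hasDerivAt_glueD (x : ℝ) : HasDerivAt glueD (deriv glueD x) x :=
  ((contDiff_glueD.differentiable (by simp)) x).hasDerivAt

/-- The range `x ≤ 1` suffices because the radial variable never exceeds `1`; left of `0` everything
vanishes. -/
theorem exists_bound_glueD : ∃ M : ℝ, 0 ≤ M ∧ ∀ x ≤ 1, glueD x ≤ M ∧ |deriv glueD x| ≤ M := by
  obtain ⟨M₁, h₁⟩ := (isCompact_Icc (a := (0 : ℝ)) (b := 1)).exists_bound_of_continuousOn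
    contDiff_glueD.continuous.continuousOn
  obtain ⟨M₂, h₂⟩ := (isCompact_Icc (a := (0 : ℝ)) (b := 1)).exists_bound_of_continuousOn
    continuous_deriv_glueD.continuousOn
  have hM₁ : 0 ≤ M₁ := (norm_nonneg _).trans (h₁ 0 (by simp))
  refine ⟨max M₁ M₂, le_max_of_le_left hM₁, fun x hx => ?_⟩
  rcases lt_or_ge x 0 with h | h
  · rw [glueD_of_nonpos h.le, deriv_glueD_of_neg h, abs_zero]
    exact ⟨le_max_of_le_left hM₁, le_max_of_le_left hM₁⟩
  · exact ⟨(le_abs_self _).trans ((h₁ x ⟨h, hx⟩).trans (le_max_left _ _)),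
      (h₂ x ⟨h, hx⟩).trans (le_max_right _ _)⟩

/-! ### Euclidean structure and radial profiles -/

/-- The Euclidean inner product of `ℝ^d × ℝ`. -/
def dot (w v : Space d) : ℝ := inner ℝ w.1 v.1 + w.2 * v.2

/-- The squared Euclidean norm of `ℝ^d × ℝ`. -/
def eucSq (w : Space d) : ℝ := ‖w.1‖ ^ 2 + w.2 ^ 2

open scoped ContDiff in
theorem contDiff_eucSq : ContDiff ℝ ∞ (eucSq (d := d)) :=
  (contDiff_fst.norm_sq ℝ).add (contDiff_snd.pow 2)

theorem eucSq_nonneg (w : Space d) : 0 ≤ eucSq w := by unfold eucSq; positivity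

/-- The product norm is a maximum and not smooth, so radial profiles use `eucSq`. This comparison
places their supports in closed balls of the product norm. -/
theorem norm_sq_le_eucSq (w : Space d) : ‖w‖ ^ 2 ≤ eucSq w := by
  rw [Prod.norm_def, eucSq]
  rcases le_total ‖w.1‖ ‖w.2‖ with h | h
  · rw [max_eq_right h, Real.norm_eq_abs, sq_abs]
    nlinarith [sq_nonneg ‖w.1‖]
  · rw [max_eq_left h]
    nlinarith [sq_nonneg w.2]

theorem eucSq_add_smul (w v : Space d) (t : ℝ) :
    eucSq (w + t • v) = eucSq w + t * (2 * dot w v) + t ^ 2 * eucSq v := by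
  simp only [eucSq, dot, Prod.fst_add, Prod.snd_add, Prod.smul_fst, Prod.smul_snd, smul_eq_mul]
  rw [@norm_add_sq ℝ, inner_smul_right, norm_smul, mul_pow, Real.norm_eq_abs, sq_abs]
  simp only [RCLike.re_to_real]
  ring

theorem hasDerivAt_eucSq_line (w v : Space d) :
    HasDerivAt (fun t : ℝ => eucSq (w + t • v)) (2 * dot w v) 0 := by
  simp_rw [eucSq_add_smul]
  have h1 := ((hasDerivAt_id (0 : ℝ)).mul_const (2 * dot w v)).const_add (eucSq w)
  have h2 := (hasDerivAt_pow 2 (0 : ℝ)).mul_const (eucSq v)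
  exact (h1.add h2).congr_deriv (by simp)

theorem hasDerivAt_dot_line (w v : Space d) :
    HasDerivAt (fun t : ℝ => dot (w + t • v) v) (eucSq v) 0 := by
  have e : ∀ t : ℝ, dot (w + t • v) v = dot w v + t * eucSq v := fun t => by
    simp only [eucSq, dot, Prod.fst_add, Prod.snd_add, Prod.smul_fst, Prod.smul_snd, smul_eq_mul]
    rw [inner_add_left, inner_smul_left, real_inner_self_eq_norm_sq]
    simp only [conj_trivial]
    ring
  simp_rw [e]
  exact (((hasDerivAt_id (0 : ℝ)).mul_const (eucSq v)).const_add (dot w v)).congr_deriv (by simp)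

/-- Reduces first and second derivatives of radial functions to calculus in one variable. -/
theorem fderiv_apply_of_line {θ : Space d → ℝ} {z v : Space d} {c : ℝ}
    (hθ : DifferentiableAt ℝ θ z) (h : HasDerivAt (fun t : ℝ => θ (z + t • v)) c 0) :
    fderiv ℝ θ z v = c := by
  have h1 : HasLineDerivAt ℝ θ (fderiv ℝ θ z v) z v := hθ.hasFDerivAt.hasLineDerivAt v
  exact HasDerivAt.unique h1 h

theorem sum_dot_sq (w : Space d) :
    ∑ i : Fin d, dot w (dirX i) ^ 2 + dot w (dirY d) ^ 2 = eucSq w := by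
  have h1 : ∀ i : Fin d, dot w (dirX i) = w.1 i := fun i => by
    simp [dot, dirX, EuclideanSpace.inner_single_right]
  have h2 : dot w (dirY d) = w.2 := by simp [dot, dirY]
  simp_rw [h1, h2]
  rw [eucSq, EuclideanSpace.norm_sq_eq]
  simp

theorem eucSq_dirX (i : Fin d) : eucSq (dirX i) = 1 := by simp [eucSq, dirX]

theorem eucSq_dirY : eucSq (dirY d) = 1 := by simp [eucSq, dirY]

/-- The radial variable `1 - s |z - z₀|²`. -/
def radial (z₀ : Space d) (s : ℝ) (z : Space d) : ℝ := 1 - s * eucSq (z - z₀)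

theorem radial_le_one (z₀ : Space d) {s : ℝ} (hs : 0 ≤ s) (z : Space d) : radial z₀ s z ≤ 1 := by
  have := mul_nonneg hs (eucSq_nonneg (z - z₀))
  unfold radial; linarith

open scoped ContDiff in
theorem contDiff_radial (z₀ : Space d) (s : ℝ) : ContDiff ℝ ∞ (radial z₀ s) :=
  contDiff_const.sub (contDiff_const.mul (contDiff_eucSq.comp (contDiff_id.sub contDiff_const)))

theorem norm_sub_le_of_radial_pos {z₀ : Space d} {s : ℝ} (hs : 0 < s) {z : Space d}
    (h : 0 ≤ radial z₀ s z) : ‖z - z₀‖ ≤ √(1 / s) := by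
  refine Real.le_sqrt_of_sq_le ((norm_sq_le_eucSq _).trans ?_)
  rw [le_div_iff₀ hs]
  unfold radial at h; linarith

theorem hasCompactSupport_comp_radial (z₀ : Space d) {s : ℝ} (hs : 0 < s) {H : ℝ → ℝ}
    (hH : ∀ x < 0, H x = 0) : HasCompactSupport fun z => H (radial z₀ s z) := by
  refine HasCompactSupport.intro (isCompact_closedBall z₀ √(1 / s)) fun z hz => hH _ ?_
  by_contra! h
  exact hz (by rw [mem_closedBall_iff_norm]; exact norm_sub_le_of_radial_pos hs h)

theorem hasDerivAt_radial_line (z₀ : Space d) (s : ℝ) (z v : Space d) :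
    HasDerivAt (fun t : ℝ => radial z₀ s (z + t • v)) (-(s * (2 * dot (z - z₀) v))) 0 := by
  have h1 := ((hasDerivAt_eucSq_line (z - z₀) v).const_mul s).const_sub 1
  refine h1.congr_of_eventuallyEq (Eventually.of_forall fun t => ?_)
  simp only [radial, add_sub_right_comm]

/-- The test function `expNegInvGlue (1 - s |z - z₀|²)`. -/
def testRadial (z₀ : Space d) (s : ℝ) (z : Space d) : ℝ := expNegInvGlue (radial z₀ s z)

open scoped ContDiff in
theorem contDiff_testRadial (z₀ : Space d) (s : ℝ) : ContDiff ℝ ∞ (testRadial z₀ s) :=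
  (expNegInvGlue.contDiff (n := ⊤)).comp (contDiff_radial z₀ s)

theorem hasCompactSupport_testRadial (z₀ : Space d) {s : ℝ} (hs : 0 < s) :
    HasCompactSupport (testRadial z₀ s) :=
  hasCompactSupport_comp_radial z₀ hs fun _ hx => expNegInvGlue.zero_of_nonpos hx.le

theorem fderiv_testRadial (z₀ : Space d) (s : ℝ) (z v : Space d) :
    fderiv ℝ (testRadial z₀ s) z v = -(2 * s) * (glueD (radial z₀ s z) * dot (z - z₀) v) := by
  refine fderiv_apply_of_line ((contDiff_testRadial z₀ s).differentiable (by simp) z) ?_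
  have h1 : HasDerivAt expNegInvGlue (glueD (radial z₀ s z)) (radial z₀ s (z + (0 : ℝ) • v)) := by
    rw [zero_smul, add_zero]; exact hasDerivAt_expNegInvGlue _
  exact (h1.comp 0 (hasDerivAt_radial_line z₀ s z v)).congr_deriv (by ring)

theorem fderiv_fderiv_testRadial (z₀ : Space d) (s : ℝ) (z v : Space d) :
    fderiv ℝ (fun z => fderiv ℝ (testRadial z₀ s) z v) z v
      = 4 * s ^ 2 * (deriv glueD (radial z₀ s z) * dot (z - z₀) v ^ 2)
        - 2 * s * (glueD (radial z₀ s z) * eucSq v) := by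
  refine fderiv_apply_of_line
    ((contDiff_fderiv_apply (contDiff_testRadial z₀ s) v).differentiable (by simp) z) ?_
  simp_rw [fderiv_testRadial]
  have h1 : HasDerivAt glueD (deriv glueD (radial z₀ s z)) (radial z₀ s (z + (0 : ℝ) • v)) := by
    rw [zero_smul, add_zero]; exact hasDerivAt_glueD _
  have h2 := h1.comp 0 (hasDerivAt_radial_line z₀ s z v)
  have h3 : HasDerivAt (fun t : ℝ => dot (z + t • v - z₀) v) (eucSq v) 0 := by
    refine (hasDerivAt_dot_line (z - z₀) v).congr_of_eventuallyEq (Eventually.of_forall fun t => ?_)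
    simp only [add_sub_right_comm]
  refine ((h2.mul h3).const_mul (-(2 * s))).congr_deriv ?_
  simp only [Function.comp_apply, zero_smul, add_zero]
  ring

/-! ### Positivity of nonnegative weak solutions -/

theorem integrable_mul_re {θ : Space d → ℝ} (hc : Continuous θ) (hs : HasCompactSupport θ)
    (φ : L2 d) : Integrable (fun z => θ z * (φ z).re) volume := by
  have := (integrable_smul_of_compact hc hs φ).re
  simpa using this

theorem integral_potential_mul_re {F : Space d → ℝ} (hF : Continuous F) (hs : HasCompactSupport F)
    (ω : ℝ) (φ : L2 d) : ∫ z : Space d, (z.2 ^ 2 + ω) * F z * (φ z).re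
      = (∫ z : Space d, z.2 ^ 2 * F z * (φ z).re) + ω * ∫ z : Space d, F z * (φ z).re := by
  have c1 : Continuous fun z : Space d => z.2 ^ 2 * F z := (continuous_snd.pow 2).mul hF
  have s1 : HasCompactSupport fun z : Space d => z.2 ^ 2 * F z := hs.mul_left
  rw [← integral_const_mul, ← integral_add (integrable_mul_re c1 s1 φ)
    ((integrable_mul_re hF hs φ).const_mul ω)]
  refine integral_congr_ae (Eventually.of_forall fun z => ?_)
  simp only
  ring

/-- The weak equation, tested against a nonnegative smooth function. -/
theorem IsWeakSolution.integral_laplacian_le {α ω : ℝ} {φ : L2 d} (h : IsWeakSolution α ω φ)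
    (hpos : ∀ᵐ z : Space d, (φ z).im = 0 ∧ 0 ≤ (φ z).re) {F : Space d → ℝ}
    (hF : ContDiff ℝ ((⊤ : ℕ∞) : WithTop ℕ∞) F)
    (hs : HasCompactSupport F) (hF0 : ∀ z, 0 ≤ F z) :
    (∑ i : Fin d, ∫ z, fderiv ℝ (fun z => fderiv ℝ F z (dirX i)) z (dirX i) * (φ z).re)
      + ∫ z, fderiv ℝ (fun z => fderiv ℝ F z (dirY d)) z (dirY d) * (φ z).re
      ≤ ∫ z : Space d, (z.2 ^ 2 + ω) * F z * (φ z).re := by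
  obtain ⟨hφ, hw⟩ := h
  obtain ⟨hi, he⟩ := hw (realL2 F) (realL2_mem_energySpace hF hs)
  have hφ' := mem_energySpace_iff.1 hφ
  have hP : ∀ {θ : Space d → ℝ}, Continuous θ → HasCompactSupport θ →
      (inner ℂ (realL2 θ) φ).re = ∫ z, θ z * (φ z).re := fun {θ} hc hs => by
    rw [inner_realL2 hc hs]
    have := integral_re (integrable_smul_of_compact hc hs φ)
    simpa using this.symm
  have e1 : ∀ v : Space d, HasWeakDeriv v φ (weakDeriv v φ) →
      (inner ℂ (weakDeriv v (realL2 F)) (weakDeriv v φ)).re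
        = -∫ z, fderiv ℝ (fun z => fderiv ℝ F z v) z v * (φ z).re := fun v hv => by
    have c1 := contDiff_fderiv_apply hF v
    have c2 := hasCompactSupport_fderiv_apply hs v
    rw [(hasWeakDeriv_realL2 hF hs v).weakDeriv_eq,
      ← hP (continuous_fderiv_apply c1 v) (hasCompactSupport_fderiv_apply c2 v),
      hasWeakDeriv_iff.1 hv _ c1 c2]
    simp
  have e2 : (∫ z : Space d, ((z.2 ^ 2 : ℝ) : ℂ) * φ z * conj (realL2 F z)).re
      = ∫ z : Space d, z.2 ^ 2 * F z * (φ z).re := by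
    have c1 : Continuous fun z : Space d => z.2 ^ 2 * F z :=
      (continuous_snd.pow 2).mul hF.continuous
    have s1 : HasCompactSupport fun z : Space d => z.2 ^ 2 * F z := hs.mul_left
    rw [← hP c1 s1, inner_realL2 c1 s1]
    congr 1
    refine integral_congr_ae ?_
    filter_upwards [coeFn_realL2 hF.continuous hs] with z hz
    rw [hz, Complex.conj_ofReal, Complex.real_smul]
    push_cast
    ring
  have e3 : 0 ≤ (∫ z : Space d, ((‖φ z‖ ^ α : ℝ) : ℂ) * φ z * conj (realL2 F z)).re := by
    have := integral_re hi
    simp only [RCLike.re_to_complex] at this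
    rw [← this]
    refine integral_nonneg_of_ae ?_
    filter_upwards [coeFn_realL2 hF.continuous hs, hpos] with z hz hp
    rw [hz, Complex.conj_ofReal, mul_assoc, Complex.re_ofReal_mul, mul_comm (φ z),
      Complex.re_ofReal_mul]
    exact mul_nonneg (by positivity) (mul_nonneg (hF0 z) hp.2)
  have he' := congrArg Complex.re he
  rw [Complex.add_re, Complex.add_re, Complex.add_re, Complex.re_sum, Complex.re_ofReal_mul, e2,
    hP hF.continuous hs, e1 _ hφ'.2.1, Finset.sum_congr rfl fun i _ => e1 _ (hφ'.1 i),
    Finset.sum_neg_distrib] at he'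
  rw [integral_potential_mul_re hF.continuous hs]
  linarith

/-! ### Local means and their monotonicity in the scale -/

/-- The weighted local mean of `φ` around `z₀` at scale `s^(-1/2)`. -/
def localMean (φ : L2 d) (z₀ : Space d) (s : ℝ) : ℝ := ∫ z, glueD (radial z₀ s z) * (φ z).re

theorem continuous_radial (z₀ : Space d) (s : ℝ) : Continuous (radial z₀ s) :=
  (contDiff_radial z₀ s).continuous

/-- Only the profile depends on `s`. For scales above `s / 2` the integrands live in the fixed ball
of radius `√(2/s)`, which gives an integrable majorant. -/
theorem hasDerivAt_localMean (φ : L2 d) (z₀ : Space d) {s : ℝ} (hs : 0 < s) :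
    HasDerivAt (localMean φ z₀)
      (-∫ z, deriv glueD (radial z₀ s z) * eucSq (z - z₀) * (φ z).re) s := by
  obtain ⟨M, hM, hMb⟩ := exists_bound_glueD
  have hm : AEStronglyMeasurable (fun z => (φ z).re) volume :=
    Complex.continuous_re.comp_aestronglyMeasurable (Lp.aestronglyMeasurable φ)
  have ceu : Continuous fun z : Space d => eucSq (z - z₀) :=
    contDiff_eucSq.continuous.comp (continuous_id.sub continuous_const)
  have key := (hasDerivAt_integral_of_dominated_loc_of_deriv_le (μ := volume) (x₀ := s)
    (s := Set.Ioi (s / 2)) (F := fun s z => glueD (radial z₀ s z) * (φ z).re)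
    (F' := fun s z => -(deriv glueD (radial z₀ s z) * eucSq (z - z₀) * (φ z).re))
    (bound := (Metric.closedBall z₀ √(2 / s)).indicator fun z => M * (2 / s) * ‖φ z‖)
    (Ioi_mem_nhds (by linarith)) (Eventually.of_forall fun t =>
      (contDiff_glueD.continuous.comp (continuous_radial z₀ t)).aestronglyMeasurable.mul hm)
    ?_ ?_ (Eventually.of_forall fun z t ht => ?_) ?_
    (Eventually.of_forall fun z t ht => ?_)).2
  · rw [integral_neg] at key
    exact key
  · exact integrable_mul_re (contDiff_glueD.continuous.comp (continuous_radial z₀ s))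
      (hasCompactSupport_comp_radial z₀ hs fun x hx => glueD_of_nonpos hx.le) φ
  · exact (((continuous_deriv_glueD.comp (continuous_radial z₀ s)).mul
      ceu).aestronglyMeasurable.mul hm).neg
  · have ht' : s / 2 < t := ht
    have ht0 : 0 < t := by linarith
    have hle : 1 / t ≤ 2 / s := by
      rw [div_le_div_iff₀ ht0 hs]; linarith
    rcases lt_or_ge (radial z₀ t z) 0 with h | h
    · rw [deriv_glueD_of_neg h]
      simp only [zero_mul, neg_zero, norm_zero]
      exact Set.indicator_nonneg (fun _ _ => by positivity) _
    · have hz : z ∈ Metric.closedBall z₀ √(2 / s) := by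
        rw [mem_closedBall_iff_norm]
        exact (norm_sub_le_of_radial_pos ht0 h).trans (Real.sqrt_le_sqrt hle)
      rw [Set.indicator_of_mem hz, norm_neg, norm_mul, norm_mul]
      have h1 : ‖deriv glueD (radial z₀ t z)‖ ≤ M := (hMb _ (radial_le_one z₀ ht0.le z)).2
      have h2 : ‖eucSq (z - z₀)‖ ≤ 2 / s := by
        rw [Real.norm_eq_abs, abs_of_nonneg (eucSq_nonneg _)]
        refine le_trans ?_ hle
        rw [le_div_iff₀ ht0]
        unfold radial at h; linarith
      have h3 : ‖(φ z).re‖ ≤ ‖φ z‖ := Complex.abs_re_le_norm _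
      gcongr
  · rw [integrable_indicator_iff Metric.isClosed_closedBall.measurableSet]
    exact ((locallyIntegrable_coe φ).integrableOn_isCompact (isCompact_closedBall _ _)).norm.const_mul
      (M * (2 / s))
  · have h1 : HasDerivAt (fun t => radial z₀ t z) (-eucSq (z - z₀)) t := by
      have := ((hasDerivAt_id t).mul_const (eucSq (z - z₀))).const_sub 1
      exact this.congr_deriv (by simp)
    have h2 := ((hasDerivAt_glueD (radial z₀ t z)).comp t h1).mul_const (φ z).re
    exact h2.congr_deriv (by ring)

theorem localMean_nonneg {φ : L2 d} (hpos : ∀ᵐ z : Space d, (φ z).im = 0 ∧ 0 ≤ (φ z).re)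
    (z₀ : Space d) (s : ℝ) : 0 ≤ localMean φ z₀ s := by
  refine integral_nonneg_of_ae ?_
  filter_upwards [hpos] with z hz
  exact mul_nonneg (glueD_nonneg _) hz.2

theorem integrable_glueD_radial (φ : L2 d) (z₀ : Space d) {s : ℝ} (hs : 0 < s) :
    Integrable (fun z => glueD (radial z₀ s z) * (φ z).re) volume :=
  integrable_mul_re (contDiff_glueD.continuous.comp (continuous_radial z₀ s))
    (hasCompactSupport_comp_radial z₀ hs fun _ hx => glueD_of_nonpos hx.le) φ

theorem integrable_deriv_glueD_radial (φ : L2 d) (z₀ : Space d) {s : ℝ} (hs : 0 < s)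
    (v : Space d) : Integrable
      (fun z => deriv glueD (radial z₀ s z) * dot (z - z₀) v ^ 2 * (φ z).re) volume := by
  have cdot : Continuous fun z : Space d => dot (z - z₀) v := by
    unfold dot; fun_prop
  have cd : Continuous fun z => deriv glueD (radial z₀ s z) :=
    continuous_deriv_glueD.comp (continuous_radial z₀ s)
  have sd : HasCompactSupport fun z => deriv glueD (radial z₀ s z) :=
    hasCompactSupport_comp_radial z₀ hs fun x hx => deriv_glueD_of_neg hx
  have c : Continuous fun z => deriv glueD (radial z₀ s z) * dot (z - z₀) v ^ 2 :=
    cd.mul (cdot.pow 2)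
  have sc : HasCompactSupport fun z => deriv glueD (radial z₀ s z) * dot (z - z₀) v ^ 2 :=
    sd.mul_right
  exact integrable_mul_re c sc φ

theorem integral_fderiv_fderiv_testRadial (φ : L2 d) (z₀ : Space d) {s : ℝ} (hs : 0 < s)
    {v : Space d} (hv : eucSq v = 1) :
    ∫ z, fderiv ℝ (fun z => fderiv ℝ (testRadial z₀ s) z v) z v * (φ z).re
      = 4 * s ^ 2 * (∫ z, deriv glueD (radial z₀ s z) * dot (z - z₀) v ^ 2 * (φ z).re)
        - 2 * s * localMean φ z₀ s := by
  rw [localMean, ← integral_const_mul, ← integral_const_mul,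
    ← integral_sub ((integrable_deriv_glueD_radial φ z₀ hs v).const_mul _)
      ((integrable_glueD_radial φ z₀ hs).const_mul _)]
  refine integral_congr_ae (Eventually.of_forall fun z => ?_)
  simp only [fderiv_fderiv_testRadial, hv]
  ring

theorem sum_integral_deriv_glueD_radial (φ : L2 d) (z₀ : Space d) {s : ℝ} (hs : 0 < s) :
    (∑ i : Fin d, ∫ z, deriv glueD (radial z₀ s z) * dot (z - z₀) (dirX i) ^ 2 * (φ z).re)
      + ∫ z, deriv glueD (radial z₀ s z) * dot (z - z₀) (dirY d) ^ 2 * (φ z).re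
      = ∫ z, deriv glueD (radial z₀ s z) * eucSq (z - z₀) * (φ z).re := by
  have hi := integrable_deriv_glueD_radial φ z₀ hs
  rw [← integral_finsetSum _ fun i _ => hi (dirX i),
    ← integral_add (integrable_finsetSum _ fun i _ => hi (dirX i)) (hi (dirY d))]
  refine integral_congr_ae (Eventually.of_forall fun z => ?_)
  simp only
  rw [← sum_dot_sq, ← Finset.sum_mul, ← Finset.mul_sum]
  ring

/-- On the support `|y|` is at most `|z₀.2|` plus the radius, which is at most `√(1/s₀)`. The
potential is therefore bounded uniformly in `s ≥ s₀`. -/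
theorem integral_potential_testRadial_le {ω : ℝ} (hω : 0 < ω) {φ : L2 d}
    (hpos : ∀ᵐ z : Space d, (φ z).im = 0 ∧ 0 ≤ (φ z).re)
    (z₀ : Space d) {s₀ s : ℝ} (hs₀ : 0 < s₀) (hs : s₀ ≤ s) :
    ∫ z : Space d, (z.2 ^ 2 + ω) * testRadial z₀ s z * (φ z).re
      ≤ ((|z₀.2| + √(1 / s₀)) ^ 2 + ω) * localMean φ z₀ s := by
  have hs1 : 0 < s := hs₀.trans_le hs
  have c : Continuous fun z : Space d => (z.2 ^ 2 + ω) * testRadial z₀ s z :=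
    ((continuous_snd.pow 2).add continuous_const).mul (contDiff_testRadial z₀ s).continuous
  have sc : HasCompactSupport fun z : Space d => (z.2 ^ 2 + ω) * testRadial z₀ s z :=
    (hasCompactSupport_testRadial z₀ hs1).mul_left
  rw [localMean, ← integral_const_mul]
  refine integral_mono_ae (integrable_mul_re c sc φ)
    ((integrable_glueD_radial φ z₀ hs1).const_mul _) ?_
  filter_upwards [hpos] with z hz
  rw [← mul_assoc]
  refine mul_le_mul_of_nonneg_right ?_ hz.2
  rcases lt_or_ge (radial z₀ s z) 0 with hr | hr
  · rw [testRadial, expNegInvGlue.zero_of_nonpos hr.le, glueD_of_nonpos hr.le, mul_zero, mul_zero]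
  · refine mul_le_mul (add_le_add_left ?_ _)
      (expNegInvGlue_le_glueD (radial_le_one z₀ hs1.le z)) (expNegInvGlue.nonneg _)
      (by positivity)
    rw [← sq_abs z.2]
    refine pow_le_pow_left₀ (abs_nonneg _) ?_ 2
    have h3 : |z.2 - z₀.2| ≤ √(1 / s₀) :=
      (norm_snd_le (z - z₀)).trans ((norm_sub_le_of_radial_pos hs1 hr).trans
        (Real.sqrt_le_sqrt (one_div_le_one_div_of_le hs₀ hs)))
    have h4 := abs_sub_abs_le_abs_sub z.2 z₀.2
    linarith

/-- The differential inequality satisfied by the local means of a weak supersolution. -/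
theorem IsWeakSolution.localMean_deriv_ge {α ω : ℝ} (hω : 0 < ω) {φ : L2 d}
    (h : IsWeakSolution α ω φ) (hpos : ∀ᵐ z : Space d, (φ z).im = 0 ∧ 0 ≤ (φ z).re)
    (z₀ : Space d) {s₀ s : ℝ} (hs₀ : 0 < s₀) (hs : s₀ ≤ s) :
    4 * s ^ 2 * (∫ z, deriv glueD (radial z₀ s z) * eucSq (z - z₀) * (φ z).re)
      - 2 * s * (d + 1) * localMean φ z₀ s
      ≤ ((|z₀.2| + √(1 / s₀)) ^ 2 + ω) * localMean φ z₀ s := by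
  have hs1 : 0 < s := hs₀.trans_le hs
  have h1 := (h.integral_laplacian_le hpos (contDiff_testRadial z₀ s)
    (hasCompactSupport_testRadial z₀ hs1) (fun z => expNegInvGlue.nonneg _)).trans
    (integral_potential_testRadial_le hω hpos z₀ hs₀ hs)
  rw [integral_fderiv_fderiv_testRadial φ z₀ hs1 eucSq_dirY,
    Finset.sum_congr rfl fun i _ => integral_fderiv_fderiv_testRadial φ z₀ hs1 (eucSq_dirX i),
    Finset.sum_sub_distrib, ← Finset.mul_sum, Finset.sum_const, Finset.card_univ,
    Fintype.card_fin, nsmul_eq_mul] at h1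
  rw [← sum_integral_deriv_glueD_radial φ z₀ hs1]
  linarith

/-- The differential inequality reads `L' ≥ -(ν/s + K/(4s²)) L` with `ν = (d+1)/2`. Its integrating
factor is `s^ν e^(-K/(4s))`: the power is the volume normalization, the exponential accounts for the
potential. -/
theorem IsWeakSolution.monotoneOn_localMean {α ω : ℝ} (hω : 0 < ω) {φ : L2 d}
    (h : IsWeakSolution α ω φ) (hpos : ∀ᵐ z : Space d, (φ z).im = 0 ∧ 0 ≤ (φ z).re)
    (z₀ : Space d) {s₀ : ℝ} (hs₀ : 0 < s₀) : ∃ C : ℝ, 0 ≤ C ∧ MonotoneOn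
      (fun s => s ^ (((d : ℝ) + 1) / 2) * Real.exp (-(C / s)) * localMean φ z₀ s) (Set.Ici s₀) := by
  set K : ℝ := (|z₀.2| + √(1 / s₀)) ^ 2 + ω with hK
  refine ⟨K / 4, by positivity, ?_⟩
  set ν : ℝ := ((d : ℝ) + 1) / 2 with hν
  have hder : ∀ s : ℝ, 0 < s → HasDerivAt
      (fun s => s ^ ν * Real.exp (-(K / 4 / s)) * localMean φ z₀ s)
      (s ^ ν * Real.exp (-(K / 4 / s)) * (ν / s * localMean φ z₀ s
        + K / (4 * s ^ 2) * localMean φ z₀ s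
        - ∫ z, deriv glueD (radial z₀ s z) * eucSq (z - z₀) * (φ z).re)) s := fun s hs => by
    have d1 : HasDerivAt (fun s : ℝ => s ^ ν) (ν * s ^ (ν - 1)) s :=
      Real.hasDerivAt_rpow_const (Or.inl hs.ne')
    have d2 : HasDerivAt (fun s : ℝ => Real.exp (-(K / 4 / s)))
        (Real.exp (-(K / 4 / s)) * (K / (4 * s ^ 2))) s := by
      have := ((hasDerivAt_inv hs.ne').const_mul (K / 4)).neg.exp
      refine this.congr_deriv ?_
      simp only [Pi.neg_apply, div_eq_mul_inv]
      field_simp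
    refine ((d1.mul d2).mul (hasDerivAt_localMean φ z₀ hs)).congr_deriv ?_
    simp only [Pi.mul_apply]
    rw [Real.rpow_sub_one hs.ne']
    field_simp
    ring
  refine monotoneOn_of_deriv_nonneg (convex_Ici s₀) ?_ ?_ ?_
  · exact fun s hs => (hder s (hs₀.trans_le hs)).continuousAt.continuousWithinAt
  · intro s hs
    rw [interior_Ici] at hs
    exact (hder s (hs₀.trans hs)).differentiableAt.differentiableWithinAt
  · intro s hs
    rw [interior_Ici] at hs
    have hs' : 0 < s := hs₀.trans hs
    rw [(hder s hs').deriv]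
    refine mul_nonneg (by positivity) ?_
    have h1 := h.localMean_deriv_ge hω hpos z₀ hs₀ (le_of_lt hs)
    rw [← hK] at h1
    set L := localMean φ z₀ s
    set J := ∫ z, deriv glueD (radial z₀ s z) * eucSq (z - z₀) * (φ z).re
    have e : ν / s * L + K / (4 * s ^ 2) * L - J
        = (K * L - (4 * s ^ 2 * J - 2 * s * (d + 1) * L)) / (4 * s ^ 2) := by
      rw [hν]
      field_simp
      ring
    rw [e]
    exact div_nonneg (by linarith) (by positivity)

/-- The profile is bounded and supported in the ball of radius `s^(-1/2)`, whose volume is a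
constant times `s^(-(d+1)/2)`. The normalized mean is thus at most a constant times the ball
average. -/
theorem tendsto_rpow_mul_localMean {φ : L2 d}
    (hpos : ∀ᵐ z : Space d, (φ z).im = 0 ∧ 0 ≤ (φ z).re) {z₀ : Space d}
    (hL : Tendsto (fun r => ⨍ z in Metric.closedBall z₀ r, (φ z).re) (𝓝[>] 0) (𝓝 0)) :
    Tendsto (fun s : ℝ => s ^ (((d : ℝ) + 1) / 2) * localMean φ z₀ s) atTop (𝓝 0) := by
  obtain ⟨M, hM, hMb⟩ := exists_bound_glueD
  have hr : Tendsto (fun s : ℝ => √(1 / s)) atTop (𝓝[>] 0) := by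
    rw [tendsto_nhdsWithin_iff]
    refine ⟨?_, ?_⟩
    · have h1 : Tendsto (fun s : ℝ => 1 / s) atTop (𝓝 0) := by
        simpa using tendsto_inv_atTop_zero (𝕜 := ℝ)
      have := (Real.continuous_sqrt.tendsto 0).comp h1
      rw [Real.sqrt_zero] at this
      exact this
    · filter_upwards [eventually_gt_atTop (0 : ℝ)] with s hs
      exact Real.sqrt_pos.2 (by positivity)
  have h1 := (hL.comp hr).const_mul (M * (volume (Metric.closedBall (0 : Space d) 1)).toReal)
  rw [mul_zero] at h1
  refine squeeze_zero' ?_ ?_ h1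
  · filter_upwards [eventually_gt_atTop (0 : ℝ)] with s hs
    exact mul_nonneg (by positivity) (localMean_nonneg hpos z₀ s)
  · filter_upwards [eventually_gt_atTop (0 : ℝ)] with s hs
    set B := Metric.closedBall z₀ √(1 / s) with hB
    have hBi : IntegrableOn (fun z => (φ z).re) B volume :=
      ((locallyIntegrable_coe φ).integrableOn_isCompact (isCompact_closedBall _ _)).re
    have h2 : localMean φ z₀ s ≤ M * ∫ z in B, (φ z).re := by
      rw [localMean, ← integral_const_mul, ← integral_indicator Metric.isClosed_closedBall.measurableSet]
      refine integral_mono_ae (integrable_mul_re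
        (contDiff_glueD.continuous.comp (continuous_radial z₀ s))
        (hasCompactSupport_comp_radial z₀ hs fun x hx => glueD_of_nonpos hx.le) φ)
        ((integrable_indicator_iff Metric.isClosed_closedBall.measurableSet).2 (hBi.const_mul M)) ?_
      filter_upwards [hpos] with z hz
      rcases lt_or_ge (radial z₀ s z) 0 with hr | hr
      · rw [glueD_of_nonpos hr.le, zero_mul]
        by_cases hzB : z ∈ B
        · rw [Set.indicator_of_mem hzB]
          exact mul_nonneg hM hz.2
        · rw [Set.indicator_of_notMem hzB]
      · have hzB : z ∈ B := by
          rw [hB, mem_closedBall_iff_norm]; exact norm_sub_le_of_radial_pos hs hr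
        rw [Set.indicator_of_mem hzB]
        exact mul_le_mul_of_nonneg_right (hMb _ (radial_le_one z₀ hs.le z)).1 hz.2
    have h3 : (volume B).toReal
        = (s ^ (((d : ℝ) + 1) / 2))⁻¹ * (volume (Metric.closedBall (0 : Space d) 1)).toReal := by
      rw [hB, Measure.addHaar_closedBall' volume z₀ (Real.sqrt_nonneg _), ENNReal.toReal_mul,
        ENNReal.toReal_ofReal (by positivity)]
      congr 1
      simp only [Module.finrank_prod, finrank_euclideanSpace, Fintype.card_fin,
        Module.finrank_self]
      rw [Real.sqrt_eq_rpow, ← Real.rpow_natCast, ← Real.rpow_mul (by positivity), one_div,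
        Real.inv_rpow hs.le]
      push_cast
      congr 2
      ring
    have h4 : ∫ z in B, (φ z).re = (volume B).toReal * ⨍ z in B, (φ z).re := by
      rw [setAverage_eq, smul_eq_mul, ← mul_assoc, Measure.real, mul_inv_cancel₀, one_mul]
      rw [h3]
      have : 0 < (volume (Metric.closedBall (0 : Space d) 1)).toReal :=
        ENNReal.toReal_pos (Metric.measure_closedBall_pos _ _ one_pos).ne'
          measure_closedBall_lt_top.ne
      positivity
    simp only [Function.comp_apply]
    calc s ^ (((d : ℝ) + 1) / 2) * localMean φ z₀ s
        ≤ s ^ (((d : ℝ) + 1) / 2) * (M * ∫ z in B, (φ z).re) :=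
          mul_le_mul_of_nonneg_left h2 (by positivity)
      _ = M * (volume (Metric.closedBall (0 : Space d) 1)).toReal * ⨍ z in B, (φ z).re := by
          rw [h4, h3]
          field_simp

/-- A nonnegative nonzero weak solution is positive almost everywhere. -/
theorem IsWeakSolution.isPositive {α ω : ℝ} (hω : 0 < ω) {φ : L2 d} (h : IsWeakSolution α ω φ)
    (hpos : ∀ᵐ z : Space d, (φ z).im = 0 ∧ 0 ≤ (φ z).re) (h0 : φ ≠ 0) : IsPositive φ := by
  have hli : LocallyIntegrable (fun z => (φ z).re) volume := fun z => by
    obtain ⟨U, hU, hi⟩ := locallyIntegrable_coe φ z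
    exact ⟨U, hU, hi.re⟩
  -- At a Lebesgue point where `φ` vanishes, the averages over shrinking balls tend to `0`. It
  -- suffices to show that the existence of one such point forces `φ = 0`.
  have hLeb := IsUnifLocDoublingMeasure.ae_tendsto_average (μ := (volume : Measure (Space d))) hli 1
  filter_upwards [hpos, hLeb] with z₀ hz₀ hL
  refine ⟨hz₀.1, hz₀.2.lt_of_ne' fun hzero => h0 ?_⟩
  have hL0 : Tendsto (fun r => ⨍ z in Metric.closedBall z₀ r, (φ z).re) (𝓝[>] 0) (𝓝 0) := by
    have := hL (fun _ : ℝ => z₀) (fun r => r) (l := 𝓝[>] 0) tendsto_id (by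
      filter_upwards [self_mem_nhdsWithin] with r hr
      have : (0 : ℝ) < r := hr
      simp [this.le])
    rwa [hzero] at this
  have hlim := tendsto_rpow_mul_localMean hpos hL0
  -- A nondecreasing function of `s` that tends to `0` at infinity is nonpositive, so every local
  -- mean around `z₀` vanishes.
  have hmean : ∀ s₀ : ℝ, 0 < s₀ → localMean φ z₀ s₀ = 0 := fun s₀ hs₀ => by
    obtain ⟨C, hC, hmono⟩ := h.monotoneOn_localMean hω hpos z₀ hs₀
    refine le_antisymm ?_ (localMean_nonneg hpos z₀ s₀)
    have h1 : s₀ ^ (((d : ℝ) + 1) / 2) * Real.exp (-(C / s₀)) * localMean φ z₀ s₀ ≤ 0 := by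
      refine ge_of_tendsto hlim ?_
      filter_upwards [eventually_ge_atTop s₀] with s hs
      refine (hmono Set.self_mem_Ici hs hs).trans ?_
      have hs' : 0 < s := hs₀.trans_le hs
      have h2 : Real.exp (-(C / s)) ≤ 1 := Real.exp_le_one_iff.2 (by
        have : 0 ≤ C / s := by positivity
        linarith)
      have h3 : 0 ≤ s ^ (((d : ℝ) + 1) / 2) * localMean φ z₀ s :=
        mul_nonneg (by positivity) (localMean_nonneg hpos z₀ s)
      nlinarith
    have h2 : 0 < s₀ ^ (((d : ℝ) + 1) / 2) * Real.exp (-(C / s₀)) := by positivity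
    exact nonpos_of_mul_nonpos_right h1 h2
  -- The scales `1/(n+1)` give supports that exhaust the space, with weights positive in their
  -- interior.
  have hae : ∀ n : ℕ, ∀ᵐ z : Space d,
      glueD (radial z₀ (1 / ((n : ℝ) + 1)) z) * (φ z).re = 0 := fun n => by
    have hs : (0 : ℝ) < 1 / ((n : ℝ) + 1) := by positivity
    have h1 := hmean _ hs
    rw [localMean, integral_eq_zero_iff_of_nonneg_ae] at h1
    · exact h1
    · filter_upwards [hpos] with z hz
      exact mul_nonneg (glueD_nonneg _) hz.2
    · exact integrable_mul_re (contDiff_glueD.continuous.comp (continuous_radial z₀ _))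
        (hasCompactSupport_comp_radial z₀ hs fun x hx => glueD_of_nonpos hx.le) φ
  refine Lp.ext ?_
  filter_upwards [ae_all_iff.2 hae, hpos, Lp.coeFn_zero ℂ 2 (volume : Measure (Space d))]
    with z h1 h2 h3
  rw [h3]
  obtain ⟨n, hn⟩ := exists_nat_gt (eucSq (z - z₀))
  have h4 : 0 < radial z₀ (1 / ((n : ℝ) + 1)) z := by
    rw [radial, sub_pos, one_div, inv_mul_lt_iff₀ (by positivity)]
    linarith
  have h5 := (mul_eq_zero.1 (h1 n)).resolve_left (glueD_pos h4).ne'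
  exact Complex.ext h5 h2.1

end PartialHarmonic

end

/-! ### Assembly of the theorem -/

theorem theorem4p1 (d : ℕ) (hd : 2 ≤ d) (α : ℝ) (hα₁ : 4 / (d : ℝ) < α)
    (hα₂ : α < 4 / ((d : ℝ) - 1)) (ω : ℝ) (hω : 0 < ω) :
    ∃ φ : PartialHarmonic.L2 d,
      φ ∈ PartialHarmonic.constraintSet d α ∧
      IsMinOn (PartialHarmonic.action α ω) (PartialHarmonic.constraintSet d α) φ ∧
      PartialHarmonic.action α ω φ = PartialHarmonic.minAction d α ω ∧
      PartialHarmonic.IsPositive φ ∧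
      PartialHarmonic.IsWeakSolution α ω φ := by
  have h := PartialHarmonic.admissible_of hd hα₁ hα₂
  obtain ⟨φ, hφ, hmin, hpos⟩ := PartialHarmonic.exists_nonneg_minimizer h hω
  have hw := PartialHarmonic.isWeakSolution_of_minimizer h hω hφ hmin
  have ha : PartialHarmonic.action α ω φ = PartialHarmonic.minAction d α ω := by
    rw [PartialHarmonic.action_eq_redAction h, hφ.2.2, mul_zero, add_zero, hmin]
  refine ⟨φ, hφ, fun v hv => ?_, ha, hw.isPositive hω hpos hφ.2.1, hw⟩
  show PartialHarmonic.action α ω φ ≤ PartialHarmonic.action α ω v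
  rw [ha]
  exact csInf_le (PartialHarmonic.bddBelow_action h hω) (Set.mem_image_of_mem _ hv)
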